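/- **Setting.** For $(x,v)\in\mathbb R^3\times\mathbb R^3$ let $L=|x|^2|v|^2-(x\cdot v)^2$. For $f=f(x,v)$ let $\rho_f(x)=\int f(x,v)\,dv$ and $U_f=-\frac1{|\cdot|}*\rho_f$. Let $Q=Q(f,L)\ge 0$, $f,L\ge0$, with $Q\in C^{1,0}([0,\infty[\times[0,\infty[)\cap C^{2,0}(]0,\infty[\times[0,\infty[)$, and assume that there are constants $c_1,\dots,c_4>0$, $F_0>0$ and $0<\mu_1,\mu_2,\mu_3<3/2$ such that - (Q1) $Q(f,L)\ge c_1f^{1+1/\mu_1}$ for $f\ge F_0$, $L\ge0$; - (Q2) $Q(f,L)\le c_2f^{1+1/\mu_2}$ for $0\le f\le F_0$, $L\ge0$; - (Q3) $Q(\lambda f,L)\ge\lambda^{1+1/\mu_3}Q(f,L)$ for $f\ge0$, $0\le\lambda\le1$, $L\ge0$, and $Q(f,\cdot)$ is decreasing (in the non-strict sense) for all $f\ge0$ if $\mu_3<1/2$; - (Q4) $\partial_f^2Q(f,L)>0$ for $f>0$, $L\ge0$, and $\partial_fQ(0,L)=0$ for $L\ge0$; - (Q5) for all $\lambda$ in some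 neighborhood of $1$, $c_3\,\partial_f^2Q(f,L)\le\partial_f^2Q(\lambda f,L)\le c_4\,\partial_f^2Q(f,L)$ for all $f>0$, $L\ge0$. Fix $M>0$. Let $J(f)=\iint Q(f,L)\,dv\,dx+\frac12\iint|v|^2f\,dv\,dx$, and let $\mathcal F_M$ be the set of all $f\in L^1(\mathbb R^6)$ with $f\ge0$, $\iint f\,dv\,dx=M$, $J(f)<\infty$, that are spherically symmetric, i.e. $f(Ax,Av)=f(x,v)$ for all $A\in\mathrm{SO}(3)$. Let $\mathcal D(f)=J(f)-\frac1{8\pi}\int|\nabla U_f|^2dx$ for $f\in\mathcal F_M$. Assume that $\mathcal D$ has a unique minimizer $f_0$ in $\mathcal F_M$ (up to null sets). Put $U_0=U_{f_0}$, $E=\frac12|v|^2+U_0(x)$, $E_0=\frac1M\iint(\partial_fQ(f_0,L)+E)\,f_0\,dv\,dx$, and $$d(f,f_0)=\iint\bigl[Q(f,L)-Q(f_0,L)+(E-E_0)(f-f_0)\bigr]\,dv\,dx .$$ A solution of the Vlasov-Poisson system is a function $f\in C^1([0,\infty[\times\mathbb R^6)$ whose support in $\mathbb R^6$ is bounded locally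 uniformly in $t$, and which satisfies $\partial_tf+v\cdot\nabla_xf-\nabla U_{f(t)}\cdot\nabla_vf=0$ for $t\ge 0$. Supports of $L^1$ functions are essential supports. **Corollary.** For every $\epsilon>0$ there is $\delta>0$ such that the following holds for every constant $C_0>\|f_0\|_\infty+\sup_{\operatorname{supp}f_0}L$ with $$C_1:=\inf\{\partial_f^2Q(f,L)\mid 0<f\le C_0,\ 0\le L\le C_0\}>0 .$$ If $f(t)$ is a solution of the Vlasov-Poisson system with $f(0)\in C^1_c(\mathbb R^6)\cap\mathcal F_M$, with $f(0)\le C_0$, with $L\le C_0$ on $\operatorname{supp}f(0)$, and with $$d(f(0),f_0)+\frac1{8\pi}\|\nabla U_{f(0)}-\nabla U_0\|_2^2<\delta ,$$ then for all $t\ge0$ $$\iint_{\mathbb R^6\setminus\operatorname{supp}f_0}Q(f(t),L)\,dv\,dx+C_1\iint_{\operatorname{supp}f_0}|f(t)-f_0|^2\,dv\,dx+\frac1{8\pi}\|\nabla U_{f(t)}-\nabla U_0\|_2^2<\epsilon .$$ -/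

import Mathlib

open MeasureTheory Set Filter Topology

noncomputable section

namespace VlasovPoisson

/-- Physical space (and velocity space) with the Euclidean norm. -/
abbrev Space : Type := EuclideanSpace ℝ (Fin 3)

/-- Phase space; a point is `(x, v)`, and `volume` is the Lebesgue measure `dx dv`. -/
abbrev Phase : Type := Space × Space

/-! ### Densities, potentials, and particle invariants -/

/-- The modulus of angular momentum `L = |x × v|² = |v|²|x|² - (x·v)²`. -/
def angMom (z : Phase) : ℝ := ‖z.2‖ ^ 2 * ‖z.1‖ ^ 2 - (inner ℝ z.1 z.2) ^ 2

/-- The spatial mass density `ρ_f(x) = ∫ f(x,v) dv`. -/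
def rho (f : Phase → ℝ) (x : Space) : ℝ := ∫ v : Space, f (x, v)

/-- The gravitational potential `U_f = -(1/|·|) * ρ_f`, i.e. the solution of `ΔU = 4πρ_f` that
vanishes at infinity. -/
def potential (f : Phase → ℝ) (x : Space) : ℝ := -∫ y : Space, rho f y / ‖x - y‖

/-- `∇U_f`. For an integrable spherically symmetric `f`, the potential is continuously
differentiable away from the origin, so that this is the gradient almost everywhere. -/
def field (f : Phase → ℝ) (x : Space) : Space := gradient (potential f) x

/-- The particle energy `E = |v|²/2 + U_{f₀}(x)` in the potential induced by `f₀`. -/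
def energy (f₀ : Phase → ℝ) (z : Phase) : ℝ := ‖z.2‖ ^ 2 / 2 + potential f₀ z.1

/-- Spherical symmetry `f(Ax, Av) = f(x, v)` for every `A ∈ SO(3)`, as an identity between
(classes of) functions defined almost everywhere. -/
def SphericallySymmetric (f : Phase → ℝ) : Prop :=
  ∀ A : Space ≃ₗᵢ[ℝ] Space, LinearMap.det (A.toLinearEquiv : Space →ₗ[ℝ] Space) = 1 →
    ∀ᵐ z : Phase, f (A z.1, A z.2) = f z

/-- The support of an almost everywhere defined function: the complement of the largest open set
on which `f` vanishes almost everywhere. -/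
def essSupport (f : Phase → ℝ) : Set Phase :=
  {z | ∀ W ∈ 𝓝 z, volume (W ∩ Function.support f) ≠ 0}

/-! ### The function `Q = Q(f, L)`; only its values for `f, L ≥ 0` matter -/

/-- `∂_f Q(f, L)` for `f ≥ 0` (one-sided at `f = 0`). -/
def dQ (Q : ℝ → ℝ → ℝ) (f L : ℝ) : ℝ := derivWithin (fun s => Q s L) (Ici 0) f

/-- `∂_f² Q(f, L)`, used for `f > 0`. -/
def d2Q (Q : ℝ → ℝ → ℝ) (f L : ℝ) : ℝ := deriv (fun s => dQ Q s L) f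

/-- `Q ∈ C^{1,0}([0,∞[ × [0,∞[) ∩ C^{2,0}(]0,∞[ × [0,∞[)`. -/
structure Regular (Q : ℝ → ℝ → ℝ) : Prop where
  cont : ContinuousOn (fun p : ℝ × ℝ => Q p.1 p.2) (Ici 0 ×ˢ Ici 0)
  diff : ∀ f L, 0 ≤ f → 0 ≤ L → DifferentiableWithinAt ℝ (fun s => Q s L) (Ici 0) f
  cont_dQ : ContinuousOn (fun p : ℝ × ℝ => dQ Q p.1 p.2) (Ici 0 ×ˢ Ici 0)
  diff_dQ : ∀ f L, 0 < f → 0 ≤ L → DifferentiableAt ℝ (fun s => dQ Q s L) f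
  cont_d2Q : ContinuousOn (fun p : ℝ × ℝ => d2Q Q p.1 p.2) (Ioi 0 ×ˢ Ici 0)

/-- The standing assumptions (Q1)-(Q5) on `Q`. -/
def Admissible (Q : ℝ → ℝ → ℝ) : Prop :=
  Regular Q ∧ (∀ f L, 0 ≤ f → 0 ≤ L → 0 ≤ Q f L) ∧
  ∃ c₁ c₂ c₃ c₄ F₀ μ₁ μ₂ μ₃ : ℝ,
    0 < c₁ ∧ 0 < c₂ ∧ 0 < c₃ ∧ 0 < c₄ ∧ 0 < F₀ ∧
    μ₁ ∈ Ioo 0 (3 / 2) ∧ μ₂ ∈ Ioo 0 (3 / 2) ∧ μ₃ ∈ Ioo 0 (3 / 2) ∧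
    -- (Q1)
    (∀ f L, F₀ ≤ f → 0 ≤ L → c₁ * f ^ (1 + 1 / μ₁) ≤ Q f L) ∧
    -- (Q2)
    (∀ f L, 0 ≤ f → f ≤ F₀ → 0 ≤ L → Q f L ≤ c₂ * f ^ (1 + 1 / μ₂)) ∧
    -- (Q3)
    (∀ f l L, 0 ≤ f → 0 ≤ l → l ≤ 1 → 0 ≤ L → l ^ (1 + 1 / μ₃) * Q f L ≤ Q (l * f) L) ∧
    (μ₃ < 1 / 2 → ∀ f, 0 ≤ f → AntitoneOn (fun L => Q f L) (Ici 0)) ∧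
    -- (Q4)
    (∀ f L, 0 < f → 0 ≤ L → 0 < d2Q Q f L) ∧
    (∀ L, 0 ≤ L → dQ Q 0 L = 0) ∧
    -- (Q5)
    (∀ᶠ l in 𝓝 (1 : ℝ), ∀ f L, 0 < f → 0 ≤ L →
      c₃ * d2Q Q f L ≤ d2Q Q (l * f) L ∧ d2Q Q (l * f) L ≤ c₄ * d2Q Q f L)

/-! ### The energy-Casimir functional and its minimizers -/

/-- `J(f) = ∬ Q(f,L) dv dx + ½ ∬ |v|² f dv dx ∈ [0,∞]`. -/
def J (Q : ℝ → ℝ → ℝ) (f : Phase → ℝ) : ENNReal :=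
  (∫⁻ z : Phase, ENNReal.ofReal (Q (f z) (angMom z))) +
    ENNReal.ofReal (1 / 2) * ∫⁻ z : Phase, ENNReal.ofReal (‖z.2‖ ^ 2 * f z)

/-- The set `𝓕_M` of spherically symmetric densities with mass `M` and `J(f) < ∞`. -/
def admissibleSet (Q : ℝ → ℝ → ℝ) (M : ℝ) : Set (Phase → ℝ) :=
  {f | Integrable f ∧ (∀ᵐ z : Phase, 0 ≤ f z) ∧ ∫ z : Phase, f z = M ∧ J Q f < ⊤ ∧
    SphericallySymmetric f}

/-- The energy-Casimir functional `𝓓(f) = J(f) - (1/8π) ∫ |∇U_f|² dx`, for `f ∈ 𝓕_M`. -/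
def energyCasimir (Q : ℝ → ℝ → ℝ) (f : Phase → ℝ) : ℝ :=
  (J Q f).toReal - 1 / (8 * Real.pi) * ∫ x : Space, ‖field f x‖ ^ 2

/-- `f₀` is a minimizer of `𝓓` over `𝓕_M`. -/
def IsMinimizer (Q : ℝ → ℝ → ℝ) (M : ℝ) (f₀ : Phase → ℝ) : Prop :=
  f₀ ∈ admissibleSet Q M ∧ IsMinOn (energyCasimir Q) (admissibleSet Q M) f₀

/-- `f₀` is the unique minimizer of `𝓓` over `𝓕_M` (up to null sets). -/
def IsUniqueMinimizer (Q : ℝ → ℝ → ℝ) (M : ℝ) (f₀ : Phase → ℝ) : Prop :=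
  IsMinimizer Q M f₀ ∧ ∀ g, IsMinimizer Q M g → g =ᵐ[volume] f₀

/-- The cut-off energy `E₀ = (1/M) ∬ (∂_f Q(f₀,L) + E) f₀ dv dx`. -/
def cutoffEnergy (Q : ℝ → ℝ → ℝ) (M : ℝ) (f₀ : Phase → ℝ) : ℝ :=
  1 / M * ∫ z : Phase, (dQ Q (f₀ z) (angMom z) + energy f₀ z) * f₀ z

/-- `d(f,f₀) = ∬ [Q(f,L) - Q(f₀,L) + (E - E₀)(f - f₀)] dv dx`. -/
def casimirDist (Q : ℝ → ℝ → ℝ) (M : ℝ) (f₀ f : Phase → ℝ) : ℝ :=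
  ∫ z : Phase, (Q (f z) (angMom z) - Q (f₀ z) (angMom z) +
    (energy f₀ z - cutoffEnergy Q M f₀) * (f z - f₀ z))

/-! ### Solutions of the Vlasov-Poisson system -/

/-- Global classical solutions `f` on `[0,∞[` of the Vlasov-Poisson system
`∂_t f + v·∂_x f - ∂_x U·∂_v f = 0`, `ΔU = 4πρ`, `U → 0` at infinity, `ρ = ∫ f dv`,
with compactly supported data: `f` is `C¹` up to `t = 0`, and its support in phase space is
bounded locally uniformly in time. -/
structure IsSolution (f : ℝ → Phase → ℝ) : Prop where
  contDiff : ContDiffOn ℝ 1 (fun p : ℝ × Phase => f p.1 p.2) (Ici 0 ×ˢ univ)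
  support_bdd : ∀ T, ∃ R, ∀ t, 0 ≤ t → t ≤ T → ∀ z, R < ‖z‖ → f t z = 0
  vlasov : ∀ t, 0 ≤ t → ∀ x v : Space,
    derivWithin (fun s => f s (x, v)) (Ici 0) t
      + fderiv ℝ (fun y => f t (y, v)) x v
      - fderiv ℝ (fun w => f t (x, w)) v (field (f t) x) = 0

/-- `inf {∂_f² Q(f,L) | 0 < f ≤ C₀, 0 ≤ L ≤ C₀}`. -/
def convexityConst (Q : ℝ → ℝ → ℝ) (C₀ : ℝ) : ℝ :=
  sInf {y | ∃ f L, 0 < f ∧ f ≤ C₀ ∧ 0 ≤ L ∧ L ≤ C₀ ∧ y = d2Q Q f L}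

end VlasovPoisson

end

noncomputable section

namespace VlasovPoisson

/-! ### Integrals of radial and axially symmetric functions -/

/-! The argument is the energy-Casimir method. Expanding the quadratic potential energy about `f₀`
gives, for `g` of the same mass, the identity `𝓓(g) - 𝓓(f₀) = d(g,f₀) - (1/8π)‖∇U_g - ∇U₀‖²`
(`energyCasimir_sub`). The left side is conserved along solutions, so `d(f(t),f₀)` is controlled as
soon as the field difference is. Two facts about the minimizer then suffice.

First, densities of mass `M` with almost minimal energy have a field close to `∇U₀`
(`exists_delta_potEnergy_lt`). By Newton's shell theorem the field of a symmetric density depends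
only on its mass function `m(r)`, and `(1/8π)‖∇U‖² = ½∫ m(r)²/r² dr`. Splitting in velocity and in
height bounds `m` by `profile`, so the potential energy is at most `B(1 + J)^κ` with `κ < 1`: energy
controls `J`. Along a minimizing sequence Helly's theorem makes the mass functions converge, and
domination makes the potential energies converge. A limit density is obtained not from weak
compactness but from `exists_selection_tendsto_ae`, which picks an almost everywhere convergent
sequence out of decreasing convex sets. The limit keeps all its mass, because the minimal energy is
negative (`exists_energyCasimir_neg`) and a density of smaller mass can be rescaled to one of lower
energy (`exists_rescale_energyCasimir_le`). Hence it is a minimizer, and by uniqueness it is `f₀`.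

Second, `d` dominates the quantities in the conclusion (`IsMinimizer.lintegral_le_casimirDist`). The
Euler-Lagrange relations say that `∂_f Q(f₀,L) + E - E₀` is nonnegative, and zero where `f₀` does
not vanish. They reduce the integrand of `d` to a convexity remainder plus a nonnegative term.

For the dynamics, a maximum principle shows that a solution stays spherically symmetric
(`IsSolution.comp_isometry`). The force is then radial, so `L` is transported along with `f`, and
the joint distribution of `(f, L)` is conserved (`IsSolution.lintegral_comp_eq`). This preserves
mass, sign, sup bound, bound on `L`, and `∬ Q(f,L)`. Conservation of `𝓓` follows from the same
expansion, now about `f(s)`: the linear term has zero derivative at `t = s` and the quadratic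
remainder is `O((t - s)²)` (`IsSolution.energyCasimir_eq`). -/

theorem lintegral_fun_norm {E : Type*} [NormedAddCommGroup E] [NormedSpace ℝ E] [MeasurableSpace E]
    [BorelSpace E] [FiniteDimensional ℝ E] [Nontrivial E] (μ : Measure E) [μ.IsAddHaarMeasure]
    {g : ℝ → ENNReal} (hg : Measurable g) :
    ∫⁻ x, g ‖x‖ ∂μ = Module.finrank ℝ E * μ (Metric.ball 0 1) *
      ∫⁻ r in Ioi (0 : ℝ), ENNReal.ofReal (r ^ (Module.finrank ℝ E - 1)) * g r := by
  have h1 : ∫⁻ x, g ‖x‖ ∂μ = ∫⁻ x : ({(0 : E)}ᶜ : Set E), g ‖x.1‖ ∂(μ.comap (↑)) := by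
    rw [lintegral_subtype_comap (measurableSet_singleton _).compl (fun x => g ‖x‖),
      restrict_compl_singleton]
  have h2 := μ.measurePreserving_homeomorphUnitSphereProd.lintegral_comp_emb
    (Homeomorph.measurableEmbedding _) (fun p => g p.2.1)
  simp only [homeomorphUnitSphereProd_apply_snd_coe] at h2
  rw [h1, h2, lintegral_prod _ (by fun_prop)]
  simp only [lintegral_const]
  rw [μ.toSphere_apply_univ, mul_comm]
  congr 1
  rw [Measure.volumeIoiPow, lintegral_withDensity_eq_lintegral_mul _ (by fun_prop) (by fun_prop),
    ← lintegral_subtype_comap measurableSet_Ioi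
      (fun r : ℝ => ENNReal.ofReal (r ^ (Module.finrank ℝ E - 1)) * g r)]
  rfl

theorem lintegral_fun_norm_plane {g : ℝ → ENNReal} (hg : Measurable g) :
    ∫⁻ w : EuclideanSpace ℝ (Fin 2), g ‖w‖ =
      ∫⁻ r in Ioi (0 : ℝ), ENNReal.ofReal (2 * Real.pi * r) * g r := by
  rw [lintegral_fun_norm volume hg, EuclideanSpace.volume_ball_fin_two, ← lintegral_const_mul _
    (by fun_prop)]
  refine setLIntegral_congr_fun measurableSet_Ioi fun r hr => ?_
  have hr : 0 < r := hr
  simp only [finrank_euclideanSpace, Fintype.card_fin]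
  rw [← mul_assoc]
  congr 1
  rw [show ((2 : ℕ) : ENNReal) = ENNReal.ofReal 2 by simp,
    ENNReal.ofReal_one, one_pow, one_mul, ← ENNReal.ofReal_mul (by norm_num), ← ENNReal.ofReal_mul (by positivity)]
  norm_num

/-- The point of `ℝ³` with given first coordinate and given projection to the remaining plane. -/
def axisPoint (p : ℝ × EuclideanSpace ℝ (Fin 2)) : Space := WithLp.toLp 2 (Fin.cons p.1 p.2)

theorem norm_axisPoint (p : ℝ × EuclideanSpace ℝ (Fin 2)) :
    ‖axisPoint p‖ = √(p.1 ^ 2 + ‖p.2‖ ^ 2) := by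
  rw [EuclideanSpace.norm_eq, EuclideanSpace.norm_eq p.2, Real.sq_sqrt (by positivity)]
  simp [axisPoint, Fin.sum_univ_succ]

theorem measurePreserving_axisPoint : MeasurePreserving axisPoint := by
  have h1 : MeasurePreserving (fun p : ℝ × EuclideanSpace ℝ (Fin 2) => (p.1, (p.2 : Fin 2 → ℝ))) :=
    (MeasurePreserving.id volume).prod (PiLp.volume_preserving_ofLp (Fin 2))
  have h2 := (volume_preserving_piFinSuccAbove (fun _ : Fin 3 => ℝ) 0).symm
  have h3 := PiLp.volume_preserving_toLp (Fin 3)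
  convert (h3.comp h2).comp h1 using 1
  ext p i
  simp [axisPoint, MeasurableEquiv.piFinSuccAbove, Fin.insertNthEquiv]

/-- Slice by the height `z`, use plane polar coordinates in each slice, and substitute `q = √(z² +
r²)`, so that `r dr = q dq`. After Tonelli this is Archimedes' theorem: on the sphere of radius `q`
the height is uniformly distributed on `(-q, q)`. -/
theorem lintegral_axial {G : ℝ → ℝ → ENNReal} (hG : Measurable (fun p : ℝ × ℝ => G p.1 p.2)) :
    ∫⁻ y : Space, G ‖y‖ (y 0) =
      ∫⁻ q in Ioi (0 : ℝ), ENNReal.ofReal (2 * Real.pi * q) * ∫⁻ z in Ioo (-q) q, G q z := by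
  have hmeas : Measurable (fun y : Space => G ‖y‖ (y 0)) := by
    have : Measurable (fun y : Space => (‖y‖, y 0)) := by fun_prop
    exact hG.comp this
  rw [← measurePreserving_axisPoint.lintegral_comp hmeas, Measure.volume_eq_prod,
    lintegral_prod (fun a => G ‖axisPoint a‖ (axisPoint a 0))
      (hmeas.comp measurePreserving_axisPoint.measurable).aemeasurable]
  have key : ∀ z : ℝ, ∫⁻ w : EuclideanSpace ℝ (Fin 2), G ‖axisPoint (z, w)‖ (axisPoint (z, w) 0) =
      ∫⁻ q in Ioi |z|, ENNReal.ofReal (2 * Real.pi * q) * G q z := by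
    intro z
    have e1 : ∀ w : EuclideanSpace ℝ (Fin 2), G ‖axisPoint (z, w)‖ (axisPoint (z, w) 0) =
        (fun r => G (√(z ^ 2 + r ^ 2)) z) ‖w‖ := by
      intro w; rw [norm_axisPoint]; simp [axisPoint]
    simp_rw [e1]
    have hm : Measurable fun r : ℝ => G (√(z ^ 2 + r ^ 2)) z := by
      have : Measurable (fun r : ℝ => (√(z ^ 2 + r ^ 2), z)) := by fun_prop
      exact hG.comp this
    rw [lintegral_fun_norm_plane hm]
    have himg : (fun r : ℝ => √(z ^ 2 + r ^ 2)) '' Ioi 0 = Ioi |z| := by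
      ext q
      simp only [mem_image, mem_Ioi]
      constructor
      · rintro ⟨r, hr, rfl⟩
        exact Real.lt_sqrt_of_sq_lt (by rw [sq_abs]; nlinarith)
      · intro hq
        have h0 := abs_nonneg z
        have h1 : z ^ 2 < q ^ 2 := by rw [← sq_abs z]; nlinarith
        refine ⟨√(q ^ 2 - z ^ 2), Real.sqrt_pos.2 (by linarith), ?_⟩
        rw [Real.sq_sqrt (by linarith)]
        rw [show z ^ 2 + (q ^ 2 - z ^ 2) = q ^ 2 by ring, Real.sqrt_sq (by linarith)]
    have hinj : InjOn (fun r : ℝ => √(z ^ 2 + r ^ 2)) (Ioi 0) := by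
      intro a ha b hb hab
      have ha : 0 < a := ha
      have hb : 0 < b := hb
      have h := (Real.sqrt_inj (by positivity) (by positivity)).1 hab
      nlinarith
    have hder : ∀ r ∈ Ioi (0 : ℝ), HasDerivWithinAt (fun r : ℝ => √(z ^ 2 + r ^ 2))
        (r / √(z ^ 2 + r ^ 2)) (Ioi 0) r := by
      intro r hr
      have hr : 0 < r := hr
      have h := (((hasDerivAt_pow 2 r).const_add (z ^ 2)).sqrt
        (by have := sq_nonneg z; have := pow_pos hr 2; linarith))
      refine (h.congr_deriv ?_).hasDerivWithinAt
      simp only [Nat.cast_ofNat, Nat.add_one_sub_one, pow_one]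
      rw [mul_div_mul_left _ _ (by norm_num)]
    rw [← himg, lintegral_image_eq_lintegral_abs_deriv_mul measurableSet_Ioi hder hinj]
    refine setLIntegral_congr_fun measurableSet_Ioi fun r hr => ?_
    have hr : 0 < r := hr
    have hs : 0 < √(z ^ 2 + r ^ 2) := Real.sqrt_pos.2 (by positivity)
    rw [← mul_assoc, ← ENNReal.ofReal_mul (abs_nonneg _)]
    congr 2
    rw [abs_of_pos (by positivity)]
    field_simp
  simp_rw [key]
  -- The domain `q > |z|` depends on `z`; an indicator moves it into the integrand so that the order
  -- of integration can be exchanged.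
  have e2 : ∀ z : ℝ, ∫⁻ q in Ioi |z|, ENNReal.ofReal (2 * Real.pi * q) * G q z =
      ∫⁻ q in Ioi (0 : ℝ), (Ioi |z|).indicator
        (fun q => ENNReal.ofReal (2 * Real.pi * q) * G q z) q := by
    intro z
    rw [lintegral_indicator measurableSet_Ioi, Measure.restrict_restrict measurableSet_Ioi,
      inter_eq_left.2 (Ioi_subset_Ioi (abs_nonneg z))]
  simp_rw [e2]
  have hset : MeasurableSet {p : ℝ × ℝ | |p.1| < p.2} :=
    measurableSet_lt (by fun_prop) (by fun_prop)
  have hmeas2 : Measurable (fun p : ℝ × ℝ => (Ioi |p.1|).indicator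
        (fun q => ENNReal.ofReal (2 * Real.pi * q) * G q p.1) p.2) := by
    have : (fun p : ℝ × ℝ => (Ioi |p.1|).indicator
        (fun q => ENNReal.ofReal (2 * Real.pi * q) * G q p.1) p.2) =
        {p : ℝ × ℝ | |p.1| < p.2}.indicator
          (fun p => ENNReal.ofReal (2 * Real.pi * p.2) * G p.2 p.1) := by
      ext p; simp [indicator]
    rw [this]
    have hs : Measurable (fun p : ℝ × ℝ => (p.2, p.1)) := by fun_prop
    exact (Measurable.mul (by fun_prop) (hG.comp hs)).indicator hset
  rw [lintegral_lintegral_swap hmeas2.aemeasurable]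
  refine setLIntegral_congr_fun measurableSet_Ioi fun q hq => ?_
  have hq : 0 < q := hq
  have hGq : Measurable (fun z => G q z) := by
    have : Measurable (fun z : ℝ => (q, z)) := by fun_prop
    exact hG.comp this
  rw [← lintegral_const_mul _ hGq, ← lintegral_indicator measurableSet_Ioo]
  refine lintegral_congr fun z => ?_
  simp [indicator, abs_lt]

/-- The antiderivative is `-√(q² + s² - 2sz)/s`, and at the ends the root is a perfect square. The
difference `(q + s - |q - s|)/s` equals `2q / max s q`, which is where the `max` in Newton's theorem
comes from. -/
theorem lintegral_inv_sqrt {q s : ℝ} (hq : 0 < q) (hs : 0 < s) (hqs : q ≠ s) :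
    ∫⁻ z in Ioo (-q) q, ENNReal.ofReal (1 / √(q ^ 2 + s ^ 2 - 2 * s * z)) =
      ENNReal.ofReal (2 * q / max s q) := by
  have hpos : ∀ z ∈ Icc (-q) q, 0 < q ^ 2 + s ^ 2 - 2 * s * z := by
    intro z hz
    have : 0 < (q - s) ^ 2 := by positivity [sub_ne_zero.2 hqs]
    nlinarith [hz.2]
  have hcont : ContinuousOn (fun z => 1 / √(q ^ 2 + s ^ 2 - 2 * s * z)) (Icc (-q) q) := by
    refine ContinuousOn.div continuousOn_const (by fun_prop) fun z hz => ?_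
    exact (Real.sqrt_pos.2 (hpos z hz)).ne'
  have hle : -q ≤ q := by linarith
  rw [Measure.restrict_congr_set (Ioo_ae_eq_Ioc (μ := volume) (a := -q) (b := q)), ← ofReal_integral_eq_lintegral_ofReal,
    ← intervalIntegral.integral_of_le hle]
  · congr 1
    have hder : ∀ z ∈ uIcc (-q) q, HasDerivAt (fun z => -(√(q ^ 2 + s ^ 2 - 2 * s * z)) / s)
        (1 / √(q ^ 2 + s ^ 2 - 2 * s * z)) z := by
      intro z hz
      rw [uIcc_of_le hle] at hz
      have h0 : HasDerivAt (fun z => q ^ 2 + s ^ 2 - 2 * s * z) (-(2 * s)) z := by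
        simpa using ((hasDerivAt_id z).const_mul (2 * s)).const_sub (q ^ 2 + s ^ 2)
      have h := (h0.sqrt (hpos z hz).ne').neg.div_const s
      refine h.congr_deriv ?_
      have := (Real.sqrt_pos.2 (hpos z hz)).ne'
      field_simp
    rw [intervalIntegral.integral_eq_sub_of_hasDerivAt hder
      (by rw [← uIcc_of_le hle] at hcont; exact hcont.intervalIntegrable)]
    rw [show q ^ 2 + s ^ 2 - 2 * s * q = (q - s) ^ 2 by ring,
      show q ^ 2 + s ^ 2 - 2 * s * -q = (q + s) ^ 2 by ring, Real.sqrt_sq_eq_abs,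
      Real.sqrt_sq_eq_abs, abs_of_pos (by linarith : 0 < q + s)]
    rcases lt_or_gt_of_ne hqs with h | h
    · rw [abs_of_neg (by linarith), max_eq_left h.le]; field_simp; ring
    · rw [abs_of_pos (by linarith), max_eq_right h.le]; field_simp; ring
  · exact (hcont.integrableOn_Icc).mono_set Ioc_subset_Icc_self
  · exact Eventually.of_forall fun z => by positivity

theorem norm_single_sub_sq (s : ℝ) (y : Space) :
    ‖EuclideanSpace.single 0 s - y‖ = √(‖y‖ ^ 2 + s ^ 2 - 2 * s * y 0) := by
  rw [← Real.sqrt_sq (norm_nonneg (EuclideanSpace.single 0 s - y)), norm_sub_sq_real]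
  congr 1
  rw [EuclideanSpace.inner_single_left, PiLp.norm_single]
  simp
  ring

/-! ### Rotations -/

/-- `A` is a rotation: `A ∈ SO(3)`. -/
def IsRotation (A : Space ≃ₗᵢ[ℝ] Space) : Prop :=
  LinearMap.det (A.toLinearEquiv : Space →ₗ[ℝ] Space) = 1

theorem det_reflection_orthogonal_singleton {w : Space} (hw : w ≠ 0) :
    LinearMap.det ((Submodule.reflection (ℝ ∙ w)ᗮ).toLinearEquiv : Space →ₗ[ℝ] Space) = -1 := by
  have h := Submodule.det_reflection (ℝ ∙ w)ᗮ
  rw [Submodule.orthogonal_orthogonal, finrank_span_singleton hw, pow_one] at h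
  exact h

theorem exists_ne_zero_orthogonal (y : Space) : ∃ w : Space, w ≠ 0 ∧ inner ℝ w y = 0 := by
  have h : (ℝ ∙ y)ᗮ ≠ ⊥ := by
    intro h
    have h1 := Submodule.finrank_add_finrank_orthogonal (ℝ ∙ y)
    have h2 := finrank_span_le_card (R := ℝ) ({y} : Set Space)
    rw [h, finrank_bot, finrank_euclideanSpace] at h1
    simp at h1 h2
    omega
  obtain ⟨w, hw, hw0⟩ := Submodule.exists_mem_ne_zero_of_ne_bot h
  refine ⟨w, hw0, ?_⟩
  rw [real_inner_comm]
  exact Submodule.mem_orthogonal_singleton_iff_inner_right.1 hw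

/-- The reflection exchanging `x` and `y` has determinant `-1`. Composing it with a reflection in a
plane containing `y` restores the determinant without moving `y`. -/
theorem exists_isRotation_apply_eq {x y : Space} (h : ‖x‖ = ‖y‖) :
    ∃ A : Space ≃ₗᵢ[ℝ] Space, IsRotation A ∧ A x = y := by
  by_cases hxy : x = y
  · refine ⟨LinearIsometryEquiv.refl ℝ Space, ?_, hxy⟩
    exact LinearMap.det_id
  obtain ⟨w, hw0, hw⟩ := exists_ne_zero_orthogonal y
  refine ⟨(Submodule.reflection (ℝ ∙ (x - y))ᗮ).trans (Submodule.reflection (ℝ ∙ w)ᗮ), ?_, ?_⟩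
  · have := LinearMap.det_comp
      ((Submodule.reflection (ℝ ∙ w)ᗮ).toLinearEquiv : Space →ₗ[ℝ] Space)
      ((Submodule.reflection (ℝ ∙ (x - y))ᗮ).toLinearEquiv : Space →ₗ[ℝ] Space)
    rw [det_reflection_orthogonal_singleton hw0,
      det_reflection_orthogonal_singleton (sub_ne_zero.2 hxy)] at this
    exact this.trans (by norm_num)
  · rw [LinearIsometryEquiv.trans_apply, Submodule.reflection_sub h]
    rw [Submodule.reflection_mem_subspace_eq_self]
    exact Submodule.mem_orthogonal_singleton_iff_inner_right.2 hw

/-! ### The angular momentum -/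

theorem angMom_nonneg (z : Phase) : 0 ≤ angMom z := by
  have h := abs_real_inner_le_norm z.1 z.2
  have h2 : (inner ℝ z.1 z.2) ^ 2 ≤ (‖z.1‖ * ‖z.2‖) ^ 2 := sq_le_sq' (abs_le.1 h).1 (abs_le.1 h).2
  rw [angMom]
  linarith [mul_pow ‖z.1‖ ‖z.2‖ 2]

theorem angMom_isometry (A : Space ≃ₗᵢ[ℝ] Space) (z : Phase) : angMom (A z.1, A z.2) = angMom z := by
  simp [angMom]

theorem contDiff_angMom : ContDiff ℝ 1 angMom := by
  unfold angMom
  exact ((contDiff_snd.norm_sq ℝ).mul (contDiff_fst.norm_sq ℝ)).sub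
    ((contDiff_fst.inner ℝ contDiff_snd).pow 2)

theorem continuous_angMom : Continuous angMom := contDiff_angMom.continuous

/-! ### Newton's shell theorem -/

/-- Rotating `x` onto the first axis makes both integrands axially symmetric. On each sphere `|y| =
q` the mean of `1/|x - y|` over the height is then computed explicitly. -/
theorem newton_radial {g : ℝ → ENNReal} (hg : Measurable g) {x : Space} (hx : x ≠ 0) :
    ∫⁻ y : Space, g ‖y‖ * ENNReal.ofReal (1 / ‖x - y‖) =
      ∫⁻ y : Space, g ‖y‖ * ENNReal.ofReal (1 / max ‖x‖ ‖y‖) := by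
  have hs : 0 < ‖x‖ := norm_pos_iff.2 hx
  set s := ‖x‖ with hsdef
  obtain ⟨A, -, hA⟩ := exists_isRotation_apply_eq (x := EuclideanSpace.single 0 s) (y := x)
    (by rw [PiLp.norm_single, Real.norm_of_nonneg hs.le])
  rw [← A.measurePreserving.lintegral_comp_emb A.toHomeomorph.measurableEmbedding]
  have e1 : ∀ y : Space, g ‖A y‖ * ENNReal.ofReal (1 / ‖x - A y‖) =
      (fun q z => g q * ENNReal.ofReal (1 / √(q ^ 2 + s ^ 2 - 2 * s * z))) ‖y‖ (y 0) := by
    intro y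
    rw [A.norm_map, ← hA, ← map_sub, A.norm_map, norm_single_sub_sq]
  rw [lintegral_congr e1, lintegral_axial
      (G := fun q z => g q * ENNReal.ofReal (1 / √(q ^ 2 + s ^ 2 - 2 * s * z))) (by fun_prop),
    lintegral_axial (G := fun q _ => g q * ENNReal.ofReal (1 / max s q)) (by fun_prop)]
  -- On the sphere through `x` the kernel is singular; this single radius is negligible.
  have hne : ∀ᵐ q : ℝ, q ≠ s := by simp [ae_iff]
  refine lintegral_congr_ae ?_
  filter_upwards [ae_restrict_of_ae hne, ae_restrict_mem measurableSet_Ioi] with q hqs hq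
  have hq : 0 < q := hq
  congr 1
  rw [lintegral_const_mul _ (by fun_prop), lintegral_inv_sqrt hq hs hqs]
  simp only [lintegral_const, Measure.restrict_apply MeasurableSet.univ, univ_inter,
    Real.volume_Ioo]
  rw [mul_assoc, ← ENNReal.ofReal_mul (by positivity)]
  congr 2
  ring

/-- A density on `ℝ³` that is almost everywhere invariant under each rotation agrees almost
everywhere with a function of the radius. -/
theorem exists_radial_ae_eq {η : Space → ENNReal} (hm : Measurable η) (hfin : ∫⁻ y, η y ≠ ⊤)
    (hsym : ∀ A : Space ≃ₗᵢ[ℝ] Space, IsRotation A → ∀ᵐ y, η (A y) = η y) :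
    ∃ g : ℝ → ENNReal, Measurable g ∧ η =ᵐ[volume] fun y => g ‖y‖ := by
  set ν : Measure Space := volume.withDensity η with hν
  have hνfin : IsFiniteMeasure ν := isFiniteMeasure_withDensity hfin
  have hinv : ∀ A : Space ≃ₗᵢ[ℝ] Space, IsRotation A → ∀ x r,
      ν (Metric.closedBall (A x) r) = ν (Metric.closedBall x r) := by
    intro A hA x r
    rw [hν, withDensity_apply _ measurableSet_closedBall, withDensity_apply _ measurableSet_closedBall,
      ← lintegral_indicator measurableSet_closedBall, ← lintegral_indicator measurableSet_closedBall,
      ← A.measurePreserving.lintegral_comp_emb A.toHomeomorph.measurableEmbedding]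
    refine lintegral_congr_ae ?_
    filter_upwards [hsym A hA] with y hy
    simp only [indicator, Metric.mem_closedBall, A.dist_map, hy]
  have hballmeas : ∀ r, Measurable fun x : Space => ν (Metric.closedBall x r) := by
    intro r
    have hset : MeasurableSet {p : Space × Space | dist p.2 p.1 ≤ r} :=
      measurableSet_le (by fun_prop) (by fun_prop)
    exact measurable_measure_prodMk_left hset
  -- For each rotation the invariance of `η` fails on a null set that depends on the rotation. Its
  -- ball averages are invariant at every point, so this upper density is radial everywhere, and
  -- Lebesgue differentiation identifies it with `η` almost everywhere.
  let h : Space → ENNReal := fun x => limsup (fun n : ℕ =>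
    ν (Metric.closedBall x (1 / (n + 1 : ℝ))) / volume (Metric.closedBall (0 : Space) (1 / (n + 1 : ℝ)))) atTop
  have hh : Measurable h := Measurable.limsup fun n => (hballmeas _).div_const _
  have hradial : ∀ x y : Space, ‖x‖ = ‖y‖ → h x = h y := by
    intro x y hxy
    obtain ⟨A, hA, rfl⟩ := exists_isRotation_apply_eq hxy
    simp only [h, hinv A hA]
  refine ⟨fun r => h (EuclideanSpace.single 0 r), hh.comp ?_, ?_⟩
  · have : Continuous fun r : ℝ => (EuclideanSpace.single 0 r : Space) := by
      refine (PiLp.continuous_toLp 2 _).comp (continuous_pi fun i => ?_)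
      by_cases hi : i = 0
      · subst hi; simpa using continuous_id'
      · simpa [Pi.single_apply, hi] using continuous_const
    exact this.measurable
  have h1 := Besicovitch.ae_tendsto_rnDeriv ν (volume : Measure Space)
  have h2 := Measure.rnDeriv_withDensity volume hm
  filter_upwards [h1, h2] with x hx1 hx2
  have h3 : h x = η x := by
    rw [← hx2]
    have h4 : Tendsto (fun n : ℕ => 1 / ((n : ℝ) + 1)) atTop (𝓝[>] 0) := by
      refine tendsto_nhdsWithin_iff.2 ⟨tendsto_one_div_add_atTop_nhds_zero_nat, ?_⟩
      exact Eventually.of_forall fun n => mem_Ioi.2 Nat.one_div_pos_of_nat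
    have h5 := (hx1.comp h4).limsup_eq
    rw [← h5]
    simp only [h, Function.comp_def]
    congr 1
    ext n
    rw [Measure.addHaar_closedBall_center (μ := volume) x]
  rw [← h3]
  exact hradial _ _ (by simp)

theorem newton_shell {η : Space → ENNReal} (hm : Measurable η) (hfin : ∫⁻ y, η y ≠ ⊤)
    (hsym : ∀ A : Space ≃ₗᵢ[ℝ] Space, IsRotation A → ∀ᵐ y, η (A y) = η y)
    {x : Space} (hx : x ≠ 0) :
    ∫⁻ y, η y * ENNReal.ofReal (1 / ‖x - y‖) =
      ∫⁻ y, η y * ENNReal.ofReal (1 / max ‖x‖ ‖y‖) := by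
  obtain ⟨g, hg, hηg⟩ := exists_radial_ae_eq hm hfin hsym
  rw [lintegral_congr_ae (hηg.mono fun y hy => by simp only [hy]; rfl), newton_radial hg hx]
  exact lintegral_congr_ae (hηg.mono fun y hy => by simp only [hy])

end VlasovPoisson
end

/-! ### Mass functions, and the potential and field of symmetric densities. -/

noncomputable section

namespace VlasovPoisson

/-- A nonnegative, integrable, spherically symmetric density on phase space. -/
structure IsSymmDensity (f : Phase → ℝ) : Prop where
  integrable : Integrable f
  nonneg : ∀ᵐ z : Phase, 0 ≤ f z
  symm : SphericallySymmetric f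

/-- The mass in the ball of radius `r`. -/
def massIn (f : Phase → ℝ) (r : ℝ) : ℝ := ∫ z in {z : Phase | ‖z.1‖ < r}, f z

theorem measurableSet_norm_fst_lt (r : ℝ) : MeasurableSet {z : Phase | ‖z.1‖ < r} :=
  measurableSet_lt (by fun_prop) (by fun_prop)

theorem massIn_add {f g : Phase → ℝ} (hf : Integrable f) (hg : Integrable g) (r : ℝ) :
    massIn (fun z => f z + g z) r = massIn f r + massIn g r :=
  integral_add hf.integrableOn hg.integrableOn

theorem massIn_sub {f g : Phase → ℝ} (hf : Integrable f) (hg : Integrable g) (r : ℝ) :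
    massIn (fun z => f z - g z) r = massIn f r - massIn g r :=
  integral_sub hf.integrableOn hg.integrableOn

theorem massIn_const_mul (c : ℝ) (f : Phase → ℝ) (r : ℝ) :
    massIn (fun z => c * f z) r = c * massIn f r :=
  integral_const_mul _ _

theorem massIn_congr_ae {f g : Phase → ℝ} (h : f =ᵐ[volume] g) : massIn f = massIn g := by
  ext r
  exact integral_congr_ae (ae_restrict_of_ae h)

theorem massIn_nonneg {f : Phase → ℝ} (h : ∀ᵐ z : Phase, 0 ≤ f z) (r : ℝ) : 0 ≤ massIn f r :=
  integral_nonneg_of_ae (ae_restrict_of_ae h)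

theorem massIn_le {f : Phase → ℝ} (hf : Integrable f) (h : ∀ᵐ z : Phase, 0 ≤ f z) (r : ℝ) :
    massIn f r ≤ ∫ z, f z :=
  setIntegral_le_integral hf h

theorem massIn_mono {f : Phase → ℝ} (hf : Integrable f) (h : ∀ᵐ z : Phase, 0 ≤ f z) :
    Monotone (massIn f) := fun r s hrs =>
  setIntegral_mono_set hf.integrableOn (ae_restrict_of_ae h)
    (Eventually.of_forall fun z (hz : ‖z.1‖ < r) => (hz.trans_le hrs : ‖z.1‖ < s))

theorem ofReal_massIn {f : Phase → ℝ} (hf : Integrable f) (h : ∀ᵐ z : Phase, 0 ≤ f z) (r : ℝ) :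
    ENNReal.ofReal (massIn f r) = ∫⁻ z in {z : Phase | ‖z.1‖ < r}, ENNReal.ofReal (f z) :=
  ofReal_integral_eq_lintegral_ofReal hf.integrableOn (ae_restrict_of_ae h)

theorem ae_norm_fst_ne (r : ℝ) : ∀ᵐ z : Phase, ‖z.1‖ ≠ r := by
  have h : {z : Phase | ¬ ‖z.1‖ ≠ r} = Metric.sphere (0 : Space) r ×ˢ (univ : Set Space) := by
    ext z; simp
  rw [ae_iff, h, Measure.volume_eq_prod, Measure.prod_prod, Measure.addHaar_sphere, zero_mul]

/-- Dominated convergence: the indicators of `|x| < r` converge as `r → r₀` off the null set `|x| =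
r₀`. -/
theorem continuous_massIn {f : Phase → ℝ} (hf : Integrable f) : Continuous (massIn f) := by
  have e : massIn f = fun r => ∫ z, {z : Phase | ‖z.1‖ < r}.indicator f z := by
    ext r; rw [integral_indicator (measurableSet_norm_fst_lt r)]; rfl
  rw [e, continuous_iff_continuousAt]
  intro r₀
  refine continuousAt_of_dominated (bound := fun z => ‖f z‖)
    (Eventually.of_forall fun r => hf.1.indicator (measurableSet_norm_fst_lt r))
    (Eventually.of_forall fun r => Eventually.of_forall fun z => norm_indicator_le_norm_self _ _)
    hf.norm ?_
  filter_upwards [ae_norm_fst_ne r₀] with z hz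
  rcases lt_or_gt_of_ne hz with h | h
  · refine (continuousAt_const (y := f z)).congr ?_
    filter_upwards [lt_mem_nhds h] with r hr
    rw [indicator_of_mem (by exact hr)]
  · refine (continuousAt_const (y := (0 : ℝ))).congr ?_
    filter_upwards [gt_mem_nhds h] with r hr
    rw [indicator_of_notMem (by simpa using hr.le)]

/-- A pair of rotations acting on phase space preserves the volume. -/
theorem measurePreserving_isometry (A : Space ≃ₗᵢ[ℝ] Space) :
    MeasurePreserving (fun z : Phase => (A z.1, A z.2)) :=
  A.measurePreserving.prod A.measurePreserving

/-- This is the spatial density in the form that Newton's theorem needs: a measurable `[0,∞]`-valued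
version, of finite integral, invariant almost everywhere under each rotation, against which any
measurable weight integrates by Tonelli. -/
theorem exists_density {f : Phase → ℝ} (hf : IsSymmDensity f) :
    ∃ η : Space → ENNReal, Measurable η ∧ ∫⁻ y, η y ≠ ⊤ ∧
      (∀ A : Space ≃ₗᵢ[ℝ] Space, IsRotation A → ∀ᵐ y, η (A y) = η y) ∧
      (∀ᵐ y, 0 ≤ rho f y ∧ ENNReal.ofReal (rho f y) = η y) ∧
      ∀ H : Space → ENNReal, Measurable H →
        ∫⁻ y, η y * H y = ∫⁻ z : Phase, ENNReal.ofReal (f z) * H z.1 := by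
  obtain ⟨f', hf'm, hff'⟩ := hf.integrable.1.aemeasurable
  have hm : Measurable fun z => ENNReal.ofReal (f' z) := hf'm.ennreal_ofReal
  have hH : ∀ H : Space → ENNReal, Measurable H →
        ∫⁻ y, (∫⁻ v, ENNReal.ofReal (f' (y, v))) * H y =
          ∫⁻ z : Phase, ENNReal.ofReal (f z) * H z.1 := by
    intro H hHm
    rw [lintegral_congr_ae (g := fun z : Phase => ENNReal.ofReal (f' z) * H z.1)
      (hff'.mono fun z hz => by simp only [hz]), Measure.volume_eq_prod,
      lintegral_prod _ (by fun_prop)]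
    refine lintegral_congr fun y => ?_
    exact (lintegral_mul_const _ (hm.comp measurable_prodMk_left)).symm
  refine ⟨fun y => ∫⁻ v, ENNReal.ofReal (f' (y, v)), hm.lintegral_prod_right', ?_, ?_, ?_, hH⟩
  · have h1 := hH (fun _ => 1) measurable_const
    simp only [mul_one] at h1
    rw [h1]
    exact hf.integrable.lintegral_lt_top.ne
  · intro A hA
    have h1 : ∀ᵐ z : Phase, f' (A z.1, A z.2) = f' z := by
      have h2 := (measurePreserving_isometry A).quasiMeasurePreserving.ae_eq_comp hff'
      filter_upwards [hf.symm A hA, hff', h2] with z h3 h4 h5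
      simp only [Function.comp_apply] at h5
      rw [← h5, h3, h4]
    rw [Measure.volume_eq_prod] at h1
    filter_upwards [Measure.ae_ae_of_ae_prod h1] with y hy
    rw [← A.measurePreserving.lintegral_comp_emb A.toHomeomorph.measurableEmbedding]
    exact lintegral_congr_ae (hy.mono fun v hv => by simp only at hv ⊢; rw [hv])
  · have h1 := hf.nonneg
    have h2 := hf.integrable
    rw [Measure.volume_eq_prod] at h1 hff' h2
    filter_upwards [Measure.ae_ae_of_ae_prod h1, Measure.ae_ae_of_ae_prod hff', h2.prod_right_ae]
      with y hy1 hy2 hy3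
    refine ⟨integral_nonneg_of_ae hy1, ?_⟩
    rw [rho, ofReal_integral_eq_lintegral_ofReal hy3 hy1]
    exact lintegral_congr_ae (hy2.mono fun v hv => by simp only [hv])

theorem lintegral_Ioi_inv_sq {s : ℝ} (hs : 0 < s) :
    ∫⁻ r in Ioi s, ENNReal.ofReal (1 / r ^ 2) = ENNReal.ofReal (1 / s) := by
  have h := integral_Ioi_rpow_of_lt (a := -2) (by norm_num) hs
  have h2 := integrableOn_Ioi_rpow_of_lt (a := -2) (by norm_num) hs
  have e : ∀ r ∈ Ioi s, ENNReal.ofReal (1 / r ^ 2) = ENNReal.ofReal (r ^ (-2 : ℝ)) := by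
    intro r hr
    rw [Real.rpow_neg (hs.trans hr).le, one_div]
    norm_num
  rw [setLIntegral_congr_fun measurableSet_Ioi e, ← ofReal_integral_eq_lintegral_ofReal h2, h]
  · norm_num [Real.rpow_neg_one]
  · filter_upwards [ae_restrict_mem measurableSet_Ioi] with r hr
    exact Real.rpow_nonneg (hs.trans hr).le _

/-- Layer cake: `1/max(s,|x|)` is the integral of `1/r²` over `r > max(s,|x|)`. Exchanging the
integrals collects the mass with `|x| < r`. -/
theorem lintegral_mul_inv_max {f : Phase → ℝ} (hf : Integrable f) (h : ∀ᵐ z : Phase, 0 ≤ f z)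
    {s : ℝ} (hs : 0 < s) :
    ∫⁻ z : Phase, ENNReal.ofReal (f z) * ENNReal.ofReal (1 / max s ‖z.1‖) =
      ∫⁻ r in Ioi s, ENNReal.ofReal (massIn f r / r ^ 2) := by
  have e1 : ∀ z : Phase, ENNReal.ofReal (f z) * ENNReal.ofReal (1 / max s ‖z.1‖) =
      ∫⁻ r in Ioi s, ENNReal.ofReal (1 / r ^ 2) *
        {z : Phase | ‖z.1‖ < r}.indicator (fun z => ENNReal.ofReal (f z)) z := by
    intro z
    rw [← lintegral_Ioi_inv_sq (lt_max_of_lt_left hs), ← lintegral_const_mul _ (by fun_prop),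
      ← lintegral_indicator measurableSet_Ioi, ← lintegral_indicator measurableSet_Ioi]
    refine lintegral_congr fun r => ?_
    by_cases h1 : s < r <;> by_cases h2 : ‖z.1‖ < r <;> simp [h1, h2, mul_comm]
  rw [lintegral_congr e1, lintegral_lintegral_swap]
  · refine setLIntegral_congr_fun measurableSet_Ioi fun r hr => ?_
    have hr : 0 < r := hs.trans hr
    have hset := measurableSet_norm_fst_lt r
    rw [lintegral_const_mul'' _ (hf.1.aemeasurable.ennreal_ofReal.indicator hset),
      lintegral_indicator hset, ← ofReal_massIn hf h, ← ENNReal.ofReal_mul (by positivity)]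
    congr 1
    ring
  · refine AEMeasurable.mul (by fun_prop) ?_
    have hset : MeasurableSet {p : Phase × ℝ | ‖p.1.1‖ < p.2} :=
      measurableSet_lt (by fun_prop) (by fun_prop)
    exact (hf.1.aemeasurable.ennreal_ofReal.comp_quasiMeasurePreserving
      Measure.quasiMeasurePreserving_fst).indicator hset

theorem integrableOn_Ioi_div_sq {f : Phase → ℝ} (hf : Integrable f)
    {s : ℝ} (hs : 0 < s) : IntegrableOn (fun r => massIn f r / r ^ 2) (Ioi s) := by
  have h2 := integrableOn_Ioi_rpow_of_lt (a := -2) (by norm_num) hs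
  refine (h2.const_mul (∫ z, ‖f z‖)).mono' ?_ ?_
  · refine (ContinuousOn.div (continuous_massIn hf).continuousOn (by fun_prop)
      fun r hr => ?_).aestronglyMeasurable measurableSet_Ioi
    exact pow_ne_zero 2 (hs.trans hr).ne'
  · filter_upwards [ae_restrict_mem measurableSet_Ioi] with r hr
    have hr0 : 0 < r := hs.trans hr
    rw [Real.rpow_neg hr0.le, norm_div, Real.norm_of_nonneg (by positivity : 0 ≤ r ^ 2), div_eq_mul_inv]
    norm_num
    refine mul_le_mul_of_nonneg_right ?_ (by positivity)
    exact (norm_integral_le_integral_norm _).trans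
      (setIntegral_le_integral hf.norm (Eventually.of_forall fun z => norm_nonneg _))

/-- Newton's theorem replaces `1/|x - y|` by `1/max(|x|,|y|)`, and the layer cake formula finishes.
Since only an integral of `rho f` enters, the formula holds at every `x ≠ 0`, which is what allows
it to be differentiated. -/
theorem potential_eq {f : Phase → ℝ} (hf : IsSymmDensity f) {x : Space} (hx : x ≠ 0) :
    potential f x = -∫ r in Ioi ‖x‖, massIn f r / r ^ 2 := by
  obtain ⟨η, hm, hfin, hsym, hrho, hH⟩ := exists_density hf
  have hs : 0 < ‖x‖ := norm_pos_iff.2 hx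
  have h1 := newton_shell hm hfin hsym hx
  rw [hH (fun y => ENNReal.ofReal (1 / max ‖x‖ ‖y‖)) (by fun_prop), lintegral_mul_inv_max hf.integrable hf.nonneg hs] at h1
  rw [potential]
  congr 1
  have hrm : AEStronglyMeasurable (rho f) volume :=
    hf.integrable.1.integral_prod_right'
  rw [integral_eq_lintegral_of_nonneg_ae, integral_eq_lintegral_of_nonneg_ae, ← h1]
  · congr 1
    refine lintegral_congr_ae (hrho.mono fun y hy => ?_)
    simp only
    rw [← hy.2, ← ENNReal.ofReal_mul hy.1, div_eq_mul_one_div]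
  · exact Eventually.of_forall fun r => div_nonneg (massIn_nonneg hf.nonneg r) (sq_nonneg r)
  · exact (integrableOn_Ioi_div_sq hf.integrable hs).1
  · exact hrho.mono fun y hy => div_nonneg hy.1 (norm_nonneg _)
  · have : Measurable fun y : Space => ‖x - y‖ := by fun_prop
    exact (hrm.aemeasurable.div this.aemeasurable).aestronglyMeasurable

theorem potential_nonpos {f : Phase → ℝ} (hf : IsSymmDensity f) {x : Space} (hx : x ≠ 0) :
    potential f x ≤ 0 := by
  rw [potential_eq hf hx]
  refine neg_nonpos.2 (integral_nonneg fun r => ?_)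
  exact div_nonneg (massIn_nonneg hf.nonneg r) (sq_nonneg r)

theorem hasFDerivAt_norm_of_ne_zero {x : Space} (hx : x ≠ 0) :
    HasFDerivAt (fun y : Space => ‖y‖) ((1 / ‖x‖) • innerSL ℝ x) x := by
  have h := (hasStrictFDerivAt_norm_sq x).hasFDerivAt.sqrt (by positivity)
  simp only [Real.sqrt_sq (norm_nonneg _)] at h
  refine h.congr_fderiv ?_
  have : ‖x‖ ≠ 0 := norm_ne_zero_iff.2 hx
  ext v
  simp
  field_simp

theorem hasGradientAt_potential {f : Phase → ℝ} (hf : IsSymmDensity f) {x : Space} (hx : x ≠ 0) :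
    HasGradientAt (potential f) ((massIn f ‖x‖ / ‖x‖ ^ 3) • x) x := by
  have hs : 0 < ‖x‖ := norm_pos_iff.2 hx
  have hcont : ContinuousOn (fun r => massIn f r / r ^ 2) (Ioi 0) :=
    ContinuousOn.div (continuous_massIn hf.integrable).continuousOn (by fun_prop)
      fun r hr => pow_ne_zero 2 (ne_of_gt hr)
  have hder : HasDerivAt (fun s => -∫ r in Ioi s, massIn f r / r ^ 2)
      (massIn f ‖x‖ / ‖x‖ ^ 2) ‖x‖ := by
    -- A fixed base point below `‖x‖` writes the tail integral as a constant minus an integral from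
    -- `a`, to which the fundamental theorem of calculus applies.
    set a := ‖x‖ / 2 with ha
    have ha0 : 0 < a := by positivity
    have hax : a < ‖x‖ := by rw [ha]; linarith
    have h1 : HasDerivAt (fun s => ∫ r in a..s, massIn f r / r ^ 2)
        (massIn f ‖x‖ / ‖x‖ ^ 2) ‖x‖ := by
      refine intervalIntegral.integral_hasDerivAt_right ?_ ?_ ?_
      · refine ContinuousOn.intervalIntegrable (hcont.mono ?_)
        rw [uIcc_of_le hax.le]
        exact fun r hr => ha0.trans_le hr.1
      · exact hcont.stronglyMeasurableAtFilter isOpen_Ioi _ hs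
      · exact hcont.continuousAt (Ioi_mem_nhds hs)
    have h2 := h1.sub_const (∫ r in Ioi a, massIn f r / r ^ 2)
    refine h2.congr_of_eventuallyEq ?_
    filter_upwards [Ioi_mem_nhds hax] with s hs'
    have hs' : a < s := hs'
    have h3 := intervalIntegral.integral_interval_add_Ioi
      (integrableOn_Ioi_div_sq hf.integrable ha0)
      (integrableOn_Ioi_div_sq hf.integrable (ha0.trans hs'))
    linarith
  have h4 := hder.comp_hasFDerivAt x (hasFDerivAt_norm_of_ne_zero hx)
  rw [hasGradientAt_iff_hasFDerivAt]
  refine (h4.congr_of_eventuallyEq ?_).congr_fderiv ?_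
  · filter_upwards [isOpen_ne.mem_nhds hx] with y hy
    exact potential_eq hf hy
  · ext v
    simp only [smul_apply, innerSL_apply_apply, smul_eq_mul,
      InnerProductSpace.toDual_apply_apply, inner_smul_left]
    simp
    field_simp

theorem field_eq {f : Phase → ℝ} (hf : IsSymmDensity f) {x : Space} (hx : x ≠ 0) :
    field f x = (massIn f ‖x‖ / ‖x‖ ^ 3) • x :=
  (hasGradientAt_potential hf hx).gradient

/-- The potential energy (up to sign) of a mass distribution `m`. -/
def potEnergy (m : ℝ → ℝ) : ℝ := 1 / 2 * ∫ r in Ioi (0 : ℝ), m r ^ 2 / r ^ 2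

theorem norm_field_sub_sq {f g : Phase → ℝ} (hf : IsSymmDensity f) (hg : IsSymmDensity g)
    {x : Space} (hx : x ≠ 0) :
    ‖field f x - field g x‖ ^ 2 = (massIn f ‖x‖ - massIn g ‖x‖) ^ 2 / ‖x‖ ^ 4 := by
  have hs : ‖x‖ ≠ 0 := norm_ne_zero_iff.2 hx
  rw [field_eq hf hx, field_eq hg hx, ← sub_smul, norm_smul, mul_pow, Real.norm_eq_abs, sq_abs]
  field_simp

theorem norm_field_sq {f : Phase → ℝ} (hf : IsSymmDensity f) {x : Space} (hx : x ≠ 0) :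
    ‖field f x‖ ^ 2 = massIn f ‖x‖ ^ 2 / ‖x‖ ^ 4 := by
  have hs : ‖x‖ ≠ 0 := norm_ne_zero_iff.2 hx
  rw [field_eq hf hx, norm_smul, mul_pow, Real.norm_eq_abs, sq_abs]
  field_simp

theorem ae_ne_zero_space : ∀ᵐ x : Space, x ≠ 0 := by simp [ae_iff]

/-- Polar coordinates: the area factor `4π` against `1/(8π)` leaves the `1/2` of `potEnergy`. -/
theorem integral_sq_div_norm_pow (m : ℝ → ℝ) :
    1 / (8 * Real.pi) * ∫ x : Space, m ‖x‖ ^ 2 / ‖x‖ ^ 4 = potEnergy m := by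
  rw [integral_fun_norm_addHaar volume (fun r => m r ^ 2 / r ^ 4), potEnergy]
  have e : ∫ y in Ioi (0 : ℝ), y ^ (Module.finrank ℝ Space - 1) • (m y ^ 2 / y ^ 4) =
      ∫ r in Ioi (0 : ℝ), m r ^ 2 / r ^ 2 := by
    refine setIntegral_congr_fun measurableSet_Ioi fun r hr => ?_
    have hr : r ≠ 0 := ne_of_gt hr
    simp only [finrank_euclideanSpace, Fintype.card_fin, smul_eq_mul]
    norm_num
    field_simp
  rw [e, Measure.real, EuclideanSpace.volume_ball_fin_three]
  simp only [finrank_euclideanSpace, Fintype.card_fin, ENNReal.ofReal_one, one_pow, one_mul,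
    nsmul_eq_mul, smul_eq_mul]
  rw [ENNReal.toReal_ofReal (by positivity)]
  push_cast
  field_simp
  ring

theorem integral_norm_field_sub_sq {f g : Phase → ℝ} (hf : IsSymmDensity f)
    (hg : IsSymmDensity g) :
    1 / (8 * Real.pi) * ∫ x, ‖field f x - field g x‖ ^ 2 =
      potEnergy (fun r => massIn f r - massIn g r) := by
  rw [← integral_sq_div_norm_pow]
  congr 1
  exact integral_congr_ae (ae_ne_zero_space.mono fun x hx => norm_field_sub_sq hf hg hx)

theorem integral_norm_field_sq {f : Phase → ℝ} (hf : IsSymmDensity f) :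
    1 / (8 * Real.pi) * ∫ x, ‖field f x‖ ^ 2 = potEnergy (massIn f) := by
  rw [← integral_sq_div_norm_pow]
  congr 1
  exact integral_congr_ae (ae_ne_zero_space.mono fun x hx => norm_field_sq hf hx)

theorem lintegral_norm_field_sub_sq {f g : Phase → ℝ} (hf : IsSymmDensity f)
    (hg : IsSymmDensity g)
    (hint : IntegrableOn (fun r => (massIn f r - massIn g r) ^ 2 / r ^ 2) (Ioi 0)) :
    ENNReal.ofReal (1 / (8 * Real.pi)) * ∫⁻ x, ENNReal.ofReal (‖field f x - field g x‖ ^ 2) =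
      ENNReal.ofReal (potEnergy (fun r => massIn f r - massIn g r)) := by
  rw [← integral_norm_field_sub_sq hf hg, ENNReal.ofReal_mul (by positivity),
    ofReal_integral_eq_lintegral_ofReal]
  · have h : Integrable (fun x : Space => (massIn f ‖x‖ - massIn g ‖x‖) ^ 2 / ‖x‖ ^ 4) := by
      rw [integrable_fun_norm_addHaar volume
        (f := fun r => (massIn f r - massIn g r) ^ 2 / r ^ 4)]
      refine hint.congr_fun (fun r hr => ?_) measurableSet_Ioi
      have hr : r ≠ 0 := ne_of_gt hr
      simp only [finrank_euclideanSpace, Fintype.card_fin, smul_eq_mul]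
      norm_num
      field_simp
    exact h.congr (ae_ne_zero_space.mono fun x hx => (norm_field_sub_sq hf hg hx).symm)
  · exact Eventually.of_forall fun x => by positivity

/-- The layer cake argument again, now with weight `m_f(r)/r²`: the potential of `f` at `x` collects
`r > |x|`, and exchanging integrals turns the density `g` into its mass function. -/
theorem lintegral_mul_neg_potential {f g : Phase → ℝ} (hf : IsSymmDensity f)
    (hg : IsSymmDensity g) :
    ∫⁻ z : Phase, ENNReal.ofReal (g z) * ENNReal.ofReal (-potential f z.1) =
      ∫⁻ r in Ioi (0 : ℝ), ENNReal.ofReal (massIn f r * massIn g r / r ^ 2) := by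
  have e1 : ∀ᵐ z : Phase, ENNReal.ofReal (g z) * ENNReal.ofReal (-potential f z.1) =
      ∫⁻ r in Ioi (0 : ℝ), ENNReal.ofReal (massIn f r / r ^ 2) *
        {z : Phase | ‖z.1‖ < r}.indicator (fun z => ENNReal.ofReal (g z)) z := by
    filter_upwards [ae_norm_fst_ne 0] with z hz
    have hz : z.1 ≠ 0 := norm_ne_zero_iff.1 hz
    have hmeas : Measurable fun r => ENNReal.ofReal (massIn f r / r ^ 2) := by
      have := (continuous_massIn hf.integrable).measurable
      fun_prop
    rw [potential_eq hf hz, neg_neg, ofReal_integral_eq_lintegral_ofReal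
      (integrableOn_Ioi_div_sq hf.integrable (norm_pos_iff.2 hz))
      (Eventually.of_forall fun r => div_nonneg (massIn_nonneg hf.nonneg r) (sq_nonneg r)),
      ← lintegral_const_mul _ hmeas, ← lintegral_indicator measurableSet_Ioi,
      ← lintegral_indicator measurableSet_Ioi]
    refine lintegral_congr fun r => ?_
    by_cases h2 : ‖z.1‖ < r
    · simp [h2, (norm_nonneg z.1).trans_lt h2, mul_comm]
    · by_cases h1 : 0 < r <;> simp [h1, h2]
  have hmeas : Measurable fun r => ENNReal.ofReal (massIn f r / r ^ 2) := by
    have := (continuous_massIn hf.integrable).measurable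
    fun_prop
  rw [lintegral_congr_ae e1, lintegral_lintegral_swap]
  · refine setLIntegral_congr_fun measurableSet_Ioi fun r hr => ?_
    have hr : 0 < r := hr
    have hset := measurableSet_norm_fst_lt r
    rw [lintegral_const_mul'' _ (hg.integrable.1.aemeasurable.ennreal_ofReal.indicator hset),
      lintegral_indicator hset, ← ofReal_massIn hg.integrable hg.nonneg,
      ← ENNReal.ofReal_mul (div_nonneg (massIn_nonneg hf.nonneg r) (sq_nonneg r))]
    congr 1
    ring
  · refine AEMeasurable.mul (hmeas.comp measurable_snd).aemeasurable ?_
    have hset : MeasurableSet {p : Phase × ℝ | ‖p.1.1‖ < p.2} :=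
      measurableSet_lt (by fun_prop) (by fun_prop)
    exact (hg.integrable.1.aemeasurable.ennreal_ofReal.comp_quasiMeasurePreserving
      Measure.quasiMeasurePreserving_fst).indicator hset

theorem aestronglyMeasurable_potential {f : Phase → ℝ} (hf : IsSymmDensity f) :
    AEStronglyMeasurable (fun z : Phase => potential f z.1) := by
  have h : AEMeasurable (potential f) (volume : Measure Space) := by
    have hc : ContinuousOn (potential f) {x | x ≠ 0} := fun x hx =>
      (hasGradientAt_potential hf hx).hasFDerivAt.continuousAt.continuousWithinAt
    have := hc.aestronglyMeasurable (μ := volume) isOpen_ne.measurableSet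
    rw [Measure.restrict_eq_self_of_ae_mem (s := {x : Space | x ≠ 0}) ae_ne_zero_space] at this
    exact this.aemeasurable
  exact (h.comp_quasiMeasurePreserving Measure.quasiMeasurePreserving_fst).aestronglyMeasurable

theorem integrable_mul_potential {f g : Phase → ℝ} (hf : IsSymmDensity f)
    (hg : IsSymmDensity g)
    (hint : IntegrableOn (fun r => massIn f r * massIn g r / r ^ 2) (Ioi 0)) :
    Integrable (fun z : Phase => potential f z.1 * g z) ∧
      ∫ z : Phase, potential f z.1 * g z = -∫ r in Ioi (0 : ℝ), massIn f r * massIn g r / r ^ 2 := by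
  have hnn : ∀ᵐ z : Phase, 0 ≤ -(potential f z.1 * g z) := by
    filter_upwards [ae_norm_fst_ne 0, hg.nonneg] with z hz hgz
    have := potential_nonpos hf (norm_ne_zero_iff.1 hz)
    nlinarith
  have hms : AEStronglyMeasurable (fun z : Phase => -(potential f z.1 * g z)) :=
    ((aestronglyMeasurable_potential hf).mul hg.integrable.1).neg
  have e : ∫⁻ z : Phase, ENNReal.ofReal (-(potential f z.1 * g z)) =
      ∫⁻ r in Ioi (0 : ℝ), ENNReal.ofReal (massIn f r * massIn g r / r ^ 2) := by
    rw [← lintegral_mul_neg_potential hf hg]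
    refine lintegral_congr_ae (hg.nonneg.mono fun z hz => ?_)
    simp only
    rw [← ENNReal.ofReal_mul hz]
    congr 1
    ring
  have hnn2 : 0 ≤ᵐ[volume.restrict (Ioi 0)] fun r => massIn f r * massIn g r / r ^ 2 :=
    Eventually.of_forall fun r => div_nonneg
      (mul_nonneg (massIn_nonneg hf.nonneg r) (massIn_nonneg hg.nonneg r)) (sq_nonneg r)
  have hI : Integrable (fun z : Phase => -(potential f z.1 * g z)) := by
    refine ⟨hms, ?_⟩
    rw [hasFiniteIntegral_iff_ofReal hnn, e]
    exact (hasFiniteIntegral_iff_ofReal hnn2).1 hint.2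
  refine ⟨by simpa using hI.neg, ?_⟩
  rw [integral_eq_lintegral_of_nonneg_ae hnn2 hint.1, ← e,
    ← integral_eq_lintegral_of_nonneg_ae hnn hms, integral_neg, neg_neg]

end VlasovPoisson
end

noncomputable section

namespace VlasovPoisson

/-! ### Pointwise properties of `Q` -/

section Pointwise

variable {Q : ℝ → ℝ → ℝ}

theorem Regular.hasDerivWithinAt (h : Regular Q) {s L : ℝ} (hs : 0 ≤ s) (hL : 0 ≤ L) :
    HasDerivWithinAt (fun s => Q s L) (dQ Q s L) (Ici 0) s :=
  (h.diff s L hs hL).hasDerivWithinAt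

theorem Regular.hasDerivAt (h : Regular Q) {s L : ℝ} (hs : 0 < s) (hL : 0 ≤ L) :
    HasDerivAt (fun s => Q s L) (dQ Q s L) s :=
  (h.hasDerivWithinAt hs.le hL).hasDerivAt (Ici_mem_nhds hs)

theorem Regular.hasDerivAt_dQ (h : Regular Q) {s L : ℝ} (hs : 0 < s) (hL : 0 ≤ L) :
    HasDerivAt (fun s => dQ Q s L) (d2Q Q s L) s :=
  (h.diff_dQ s L hs hL).hasDerivAt

theorem Regular.continuousOn_dQ (h : Regular Q) {L : ℝ} (hL : 0 ≤ L) :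
    ContinuousOn (fun s => dQ Q s L) (Ici 0) :=
  h.cont_dQ.comp (f := fun s : ℝ => (s, L)) (by fun_prop) fun s hs => ⟨hs, mem_Ici.2 hL⟩

theorem Regular.continuousOn_Q (h : Regular Q) {L : ℝ} (hL : 0 ≤ L) :
    ContinuousOn (fun s => Q s L) (Ici 0) :=
  h.cont.comp (f := fun s : ℝ => (s, L)) (by fun_prop) fun s hs => ⟨hs, mem_Ici.2 hL⟩

/-- `dQ` grows at least linearly with slope a lower bound for `d2Q`. -/
theorem Regular.mul_sub_le_dQ_sub (h : Regular Q) {a b c L : ℝ} (ha : 0 ≤ a) (hab : a ≤ b)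
    (hL : 0 ≤ L) (hc : ∀ s, 0 < s → s ≤ b → c ≤ d2Q Q s L) :
    c * (b - a) ≤ dQ Q b L - dQ Q a L := by
  have hmono : MonotoneOn (fun s => dQ Q s L - c * s) (Icc a b) := by
    refine monotoneOn_of_deriv_nonneg (convex_Icc a b) ?_ ?_ ?_
    · exact ((h.continuousOn_dQ hL).mono fun s hs => ha.trans hs.1).sub (by fun_prop)
    · intro s hs
      rw [interior_Icc] at hs
      exact ((h.hasDerivAt_dQ (ha.trans_lt hs.1) hL).sub
        ((hasDerivAt_id s).const_mul c)).differentiableAt.differentiableWithinAt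
    · intro s hs
      rw [interior_Icc] at hs
      have hs0 := ha.trans_lt hs.1
      have := ((h.hasDerivAt_dQ hs0 hL).sub ((hasDerivAt_id s).const_mul c)).deriv
      have e : (fun s => dQ Q s L - c * s) = (fun s => dQ Q s L) - fun y => c * id y := rfl
      rw [e, this]
      linarith [hc s hs0 hs.2.le]
  have := hmono (left_mem_Icc.2 hab) (right_mem_Icc.2 hab) hab
  simp only at this
  linarith

/-- Subtracting the tangent and the parabola `c/2 (s - a)²` from `Q(·,L)` leaves a function whose
derivative has the sign of `s - a`. The lower bound on `∂_f²Q` is needed only for `s > 0`, since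
nothing is known at `0`. The choice `c = 0` gives convexity; a positive `c` gives the quadratic gain
in the stability estimate. -/
theorem Regular.taylor (h : Regular Q) {a b c L : ℝ} (ha : 0 ≤ a) (hb : 0 ≤ b) (hL : 0 ≤ L)
    (hc : ∀ s, 0 < s → s ≤ max a b → c ≤ d2Q Q s L) :
    c / 2 * (b - a) ^ 2 ≤ Q b L - Q a L - dQ Q a L * (b - a) := by
  set φ : ℝ → ℝ := fun s => Q s L - Q a L - dQ Q a L * (s - a) - c / 2 * (s - a) ^ 2 with hφ
  have hd : ∀ s, 0 < s → HasDerivAt φ (dQ Q s L - dQ Q a L - c * (s - a)) s := by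
    intro s hs
    have h1 := ((hasDerivAt_id s).sub_const a)
    refine ((((h.hasDerivAt hs hL).sub_const _).sub (h1.const_mul (dQ Q a L))).sub
      ((h1.pow 2).const_mul (c / 2))).congr_deriv ?_
    simp
    ring
  have hcont : ContinuousOn φ (Ici 0) :=
    (((h.continuousOn_Q hL).sub continuousOn_const).sub (by fun_prop)).sub (by fun_prop)
  have hφa : φ a = 0 := by simp [hφ]
  suffices 0 ≤ φ b by simp only [hφ] at this; linarith
  rcases le_total a b with hab | hab
  · have hmono : MonotoneOn φ (Icc a b) := by
      refine monotoneOn_of_deriv_nonneg (convex_Icc a b) (hcont.mono fun s hs => ha.trans hs.1) ?_ ?_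
      · intro s hs
        rw [interior_Icc] at hs
        exact (hd s (ha.trans_lt hs.1)).differentiableAt.differentiableWithinAt
      · intro s hs
        rw [interior_Icc] at hs
        rw [(hd s (ha.trans_lt hs.1)).deriv]
        have := h.mul_sub_le_dQ_sub ha hs.1.le hL
          fun t ht hts => hc t ht (hts.trans (hs.2.le.trans (le_max_right _ _)))
        linarith
    rw [← hφa]
    exact hmono (left_mem_Icc.2 hab) (right_mem_Icc.2 hab) hab
  · have hanti : AntitoneOn φ (Icc b a) := by
      refine antitoneOn_of_deriv_nonpos (convex_Icc b a) (hcont.mono fun s hs => hb.trans hs.1) ?_ ?_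
      · intro s hs
        rw [interior_Icc] at hs
        exact (hd s (hb.trans_lt hs.1)).differentiableAt.differentiableWithinAt
      · intro s hs
        rw [interior_Icc] at hs
        rw [(hd s (hb.trans_lt hs.1)).deriv]
        have := h.mul_sub_le_dQ_sub (hb.trans hs.1.le) hs.2.le hL
          fun t ht hts => hc t ht (hts.trans (le_max_left _ _))
        linarith
    rw [← hφa]
    exact hanti (left_mem_Icc.2 hab) (right_mem_Icc.2 hab) hab

theorem Admissible.regular (h : Admissible Q) : Regular Q := h.1

theorem Admissible.nonneg (h : Admissible Q) {a L : ℝ} (ha : 0 ≤ a) (hL : 0 ≤ L) : 0 ≤ Q a L :=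
  h.2.1 a L ha hL

theorem Admissible.zero (h : Admissible Q) {L : ℝ} (hL : 0 ≤ L) : Q 0 L = 0 := by
  obtain ⟨-, hnn, c₁, c₂, c₃, c₄, F₀, μ₁, μ₂, μ₃, -, hc₂, -, -, hF, -, hμ₂, -, -, h2, -⟩ := h
  refine le_antisymm ?_ (hnn 0 L le_rfl hL)
  have := h2 0 L le_rfl hF.le hL
  have h0 : (0 : ℝ) < 1 + 1 / μ₂ := by have := hμ₂.1; positivity
  rwa [Real.zero_rpow h0.ne', mul_zero] at this

theorem Admissible.d2Q_pos (h : Admissible Q) {a L : ℝ} (ha : 0 < a) (hL : 0 ≤ L) :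
    0 < d2Q Q a L := by
  obtain ⟨-, hnn, c₁, c₂, c₃, c₄, F₀, μ₁, μ₂, μ₃, -, -, -, -, -, -, -, -, -, -, -, -, h4, -⟩ := h
  exact h4 a L ha hL

theorem Admissible.dQ_zero (h : Admissible Q) {L : ℝ} (hL : 0 ≤ L) : dQ Q 0 L = 0 := by
  obtain ⟨-, hnn, c₁, c₂, c₃, c₄, F₀, μ₁, μ₂, μ₃, -, -, -, -, -, -, -, -, -, -, -, -, -, h4, -⟩ := h
  exact h4 L hL

theorem Admissible.dQ_mono (h : Admissible Q) {a b L : ℝ} (ha : 0 ≤ a) (hab : a ≤ b)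
    (hL : 0 ≤ L) : dQ Q a L ≤ dQ Q b L := by
  have := h.regular.mul_sub_le_dQ_sub ha hab hL (c := 0) fun s hs _ => (h.d2Q_pos hs hL).le
  linarith

theorem Admissible.dQ_nonneg (h : Admissible Q) {a L : ℝ} (ha : 0 ≤ a) (hL : 0 ≤ L) :
    0 ≤ dQ Q a L := by
  rw [← h.dQ_zero hL]
  exact h.dQ_mono le_rfl ha hL

theorem Admissible.tangent_le (h : Admissible Q) {a b L : ℝ} (ha : 0 ≤ a) (hb : 0 ≤ b)
    (hL : 0 ≤ L) : dQ Q a L * (b - a) ≤ Q b L - Q a L := by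
  have := h.regular.taylor ha hb hL (c := 0) fun s hs _ => (h.d2Q_pos hs hL).le
  linarith

theorem Admissible.convex (h : Admissible Q) {a b t L : ℝ} (ha : 0 ≤ a) (hb : 0 ≤ b)
    (ht0 : 0 ≤ t) (ht1 : t ≤ 1) (hL : 0 ≤ L) :
    Q ((1 - t) * a + t * b) L ≤ (1 - t) * Q a L + t * Q b L := by
  have hm : 0 ≤ (1 - t) * a + t * b := add_nonneg (mul_nonneg (by linarith) ha) (mul_nonneg ht0 hb)
  have h1 := h.tangent_le hm ha hL
  have h2 := h.tangent_le hm hb hL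
  have h3 := mul_le_mul_of_nonneg_left h1 (by linarith : 0 ≤ 1 - t)
  have h4 := mul_le_mul_of_nonneg_left h2 ht0
  nlinarith

/-- By (Q3), `f ∂_f Q ≤ (1 + 1/μ₃) Q`. -/
theorem Admissible.exists_dQ_mul_le (h : Admissible Q) :
    ∃ k : ℝ, 0 < k ∧ ∀ a L, 0 ≤ a → 0 ≤ L → dQ Q a L * a ≤ k * Q a L := by
  obtain ⟨hr, hnn, c₁, c₂, c₃, c₄, F₀, μ₁, μ₂, μ₃, -, -, -, -, -, -, -, hμ₃, -, -, h3, -⟩ := h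
  have hk : 0 < 1 + 1 / μ₃ := by have := hμ₃.1; positivity
  refine ⟨1 + 1 / μ₃, hk, fun a L ha hL => ?_⟩
  rcases ha.eq_or_lt with rfl | ha
  · simpa using mul_nonneg hk.le (hnn 0 L le_rfl hL)
  -- By (Q3) this function of `l` is nonnegative on `[0,1]`, and it vanishes at `1`. Its derivative
  -- there, computed from the left, is therefore nonpositive, which is the claim.
  have hd : HasDerivAt (fun l : ℝ => Q (l * a) L - l ^ (1 + 1 / μ₃) * Q a L)
      (dQ Q a L * a - (1 + 1 / μ₃) * Q a L) 1 := by
    have h1 : HasDerivAt (fun l : ℝ => l * a) a 1 := by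
      simpa using (hasDerivAt_id (1 : ℝ)).mul_const a
    have h2 : HasDerivAt (fun s => Q s L) (dQ Q a L) (1 * a) := by
      rw [one_mul]; exact hr.hasDerivAt ha hL
    have h4 := (Real.hasDerivAt_rpow_const (x := 1) (p := 1 + 1 / μ₃) (Or.inl one_ne_zero)).mul_const
      (Q a L)
    rw [Real.one_rpow, mul_one] at h4
    exact (h2.comp 1 h1).sub h4
  have hd' := hd.hasDerivWithinAt (s := Iic 1)
  rw [hasDerivWithinAt_iff_tendsto_slope] at hd'
  have hle : dQ Q a L * a - (1 + 1 / μ₃) * Q a L ≤ 0 := by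
    have hne : (𝓝[Iic 1 \ {1}] (1 : ℝ)).NeBot := by
      rw [Iic_sdiff_right]; infer_instance
    refine le_of_tendsto hd' ?_
    have h01 : Ioo (0 : ℝ) 1 ∈ 𝓝[Iic 1 \ {1}] (1 : ℝ) := by
      rw [Iic_sdiff_right]; exact Ioo_mem_nhdsLT one_pos
    filter_upwards [h01] with l hl
    rw [slope_def_field]
    simp only [one_mul, Real.one_rpow, sub_self, sub_zero]
    have := h3 a l L ha.le hl.1.le hl.2.le hL
    exact div_nonpos_of_nonneg_of_nonpos (by linarith) (by linarith [hl.2])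
  linarith

/-- Nothing is assumed about `Q` at negative arguments. Truncating them gives a continuous function
on the whole plane, which settles measurability of compositions. -/
theorem Regular.continuous_ext (h : Regular Q) :
    Continuous fun p : ℝ × ℝ => Q (max p.1 0) (max p.2 0) :=
  h.cont.comp_continuous (f := fun p : ℝ × ℝ => (max p.1 0, max p.2 0)) (by fun_prop)
    fun p => ⟨mem_Ici.2 (le_max_right _ _), mem_Ici.2 (le_max_right _ _)⟩

theorem Regular.continuous_dQ_ext (h : Regular Q) :
    Continuous fun p : ℝ × ℝ => dQ Q (max p.1 0) (max p.2 0) :=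
  h.cont_dQ.comp_continuous (f := fun p : ℝ × ℝ => (max p.1 0, max p.2 0)) (by fun_prop)
    fun p => ⟨mem_Ici.2 (le_max_right _ _), mem_Ici.2 (le_max_right _ _)⟩

theorem Regular.aestronglyMeasurable (h : Regular Q) {f : Phase → ℝ}
    (hf : AEStronglyMeasurable f) (hnn : ∀ᵐ z, 0 ≤ f z) :
    AEStronglyMeasurable (fun z => Q (f z) (angMom z)) := by
  have h1 : AEStronglyMeasurable fun z => (f z, angMom z) :=
    hf.prodMk continuous_angMom.aestronglyMeasurable
  refine (h.continuous_ext.comp_aestronglyMeasurable h1).congr (hnn.mono fun z hz => ?_)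
  simp [max_eq_left hz, max_eq_left (angMom_nonneg z)]

theorem Regular.aestronglyMeasurable_dQ (h : Regular Q) {f : Phase → ℝ}
    (hf : AEStronglyMeasurable f) (hnn : ∀ᵐ z, 0 ≤ f z) :
    AEStronglyMeasurable (fun z => dQ Q (f z) (angMom z)) := by
  have h1 : AEStronglyMeasurable fun z => (f z, angMom z) :=
    hf.prodMk continuous_angMom.aestronglyMeasurable
  refine (h.continuous_dQ_ext.comp_aestronglyMeasurable h1).congr (hnn.mono fun z hz => ?_)
  simp [max_eq_left hz, max_eq_left (angMom_nonneg z)]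

end Pointwise

/-! ### Densities with finite `J` -/

section FiniteJ

variable {Q : ℝ → ℝ → ℝ} {f : Phase → ℝ}

/-- A symmetric density with finite `J`. -/
structure HasFiniteJ (Q : ℝ → ℝ → ℝ) (f : Phase → ℝ) : Prop extends IsSymmDensity f where
  J_lt_top : J Q f < ⊤

/-- The value of `J` as a real number. -/
def Jreal (Q : ℝ → ℝ → ℝ) (f : Phase → ℝ) : ℝ := (J Q f).toReal

theorem mem_admissibleSet_iff {M : ℝ} :
    f ∈ admissibleSet Q M ↔ HasFiniteJ Q f ∧ ∫ z, f z = M :=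
  ⟨fun h => ⟨⟨⟨h.1, h.2.1, h.2.2.2.2⟩, h.2.2.2.1⟩, h.2.2.1⟩,
    fun h => ⟨h.1.integrable, h.1.nonneg, h.2, h.1.J_lt_top, h.1.symm⟩⟩

theorem HasFiniteJ.integrable_Q (hf : HasFiniteJ Q f) (hQ : Admissible Q) :
    Integrable fun z => Q (f z) (angMom z) := by
  refine ⟨hQ.regular.aestronglyMeasurable hf.integrable.1 hf.nonneg, ?_⟩
  rw [hasFiniteIntegral_iff_ofReal (hf.nonneg.mono fun z hz => hQ.nonneg hz (angMom_nonneg z))]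
  exact (ENNReal.add_lt_top.1 hf.J_lt_top).1

theorem HasFiniteJ.integrable_kinetic (hf : HasFiniteJ Q f) :
    Integrable fun z : Phase => ‖z.2‖ ^ 2 * f z := by
  have hm : AEStronglyMeasurable (fun z : Phase => ‖z.2‖ ^ 2) volume :=
    (by fun_prop : Continuous fun z : Phase => ‖z.2‖ ^ 2).aestronglyMeasurable
  refine ⟨hm.mul hf.integrable.1, ?_⟩
  rw [hasFiniteIntegral_iff_ofReal
    (hf.nonneg.mono fun z hz => mul_nonneg (sq_nonneg _) hz)]
  have h := (ENNReal.add_lt_top.1 hf.J_lt_top).2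
  by_contra hc
  rw [not_lt, top_le_iff] at hc
  rw [hc, ENNReal.mul_top (by norm_num)] at h
  exact lt_irrefl _ h

theorem HasFiniteJ.Jreal_eq (hf : HasFiniteJ Q f) (hQ : Admissible Q) :
    Jreal Q f = (∫ z, Q (f z) (angMom z)) + 1 / 2 * ∫ z : Phase, ‖z.2‖ ^ 2 * f z := by
  have h1 := ofReal_integral_eq_lintegral_ofReal (hf.integrable_Q hQ)
    (hf.nonneg.mono fun z hz => hQ.nonneg hz (angMom_nonneg z))
  have h2 := ofReal_integral_eq_lintegral_ofReal hf.integrable_kinetic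
    (hf.nonneg.mono fun z hz => mul_nonneg (sq_nonneg _) hz)
  have h3 : 0 ≤ ∫ z, Q (f z) (angMom z) :=
    integral_nonneg_of_ae (hf.nonneg.mono fun z hz => hQ.nonneg hz (angMom_nonneg z))
  have h4 : 0 ≤ ∫ z : Phase, ‖z.2‖ ^ 2 * f z :=
    integral_nonneg_of_ae (hf.nonneg.mono fun z hz => mul_nonneg (sq_nonneg _) hz)
  rw [Jreal, J, ← h1, ← h2, ← ENNReal.ofReal_mul (by norm_num), ← ENNReal.ofReal_add h3 (by positivity),
    ENNReal.toReal_ofReal (by positivity)]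

theorem HasFiniteJ.integral_Q_nonneg (hf : HasFiniteJ Q f) (hQ : Admissible Q) :
    0 ≤ ∫ z, Q (f z) (angMom z) :=
  integral_nonneg_of_ae (hf.nonneg.mono fun z hz => hQ.nonneg hz (angMom_nonneg z))

theorem HasFiniteJ.kinetic_nonneg (hf : HasFiniteJ Q f) :
    0 ≤ ∫ z : Phase, ‖z.2‖ ^ 2 * f z :=
  integral_nonneg_of_ae (hf.nonneg.mono fun _ hz => mul_nonneg (sq_nonneg _) hz)

theorem Jreal_nonneg : 0 ≤ Jreal Q f := ENNReal.toReal_nonneg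

/-- The phase space volume of the product of two unit balls. -/
def unitVol : ℝ := (volume (Metric.ball (0 : Space) 1)).toReal ^ 2

theorem unitVol_nonneg : 0 ≤ unitVol := sq_nonneg _

theorem volume_prod_ball {r R : ℝ} (hr : 0 ≤ r) (hR : 0 ≤ R) :
    volume (Metric.ball (0 : Space) r ×ˢ Metric.ball (0 : Space) R) =
      ENNReal.ofReal (unitVol * r ^ 3 * R ^ 3) := by
  have h : ∀ {s : ℝ}, 0 ≤ s → volume (Metric.ball (0 : Space) s) =
      ENNReal.ofReal (s ^ 3 * (volume (Metric.ball (0 : Space) 1)).toReal) := by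
    intro s hs
    rw [Measure.addHaar_ball _ _ hs, ENNReal.ofReal_mul (by positivity),
      ENNReal.ofReal_toReal measure_ball_lt_top.ne]
    simp
  rw [Measure.volume_eq_prod, Measure.prod_prod, h hr, h hR, ← ENNReal.ofReal_mul (by positivity),
    unitVol]
  congr 1
  ring

/-- Three regions: for `|v| ≥ R` the kinetic energy dominates `f`; for `f > N` assumption (Q1) gives
`f ≤ Q/(c N^{1/μ})`; what remains is a bounded function on a bounded set. The first two terms
express that a bound on `J` prevents mass from escaping to high velocities or concentrating. -/
theorem massIn_le_truncated (hQ : Admissible Q) {c F μ : ℝ} (hc : 0 < c) (hμ : 0 < μ)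
    (hF : 0 < F) (h1 : ∀ f L, F ≤ f → 0 ≤ L → c * f ^ (1 + 1 / μ) ≤ Q f L)
    (hf : HasFiniteJ Q f) {r R N : ℝ} (hR : 0 < R) (hN : F ≤ N) :
    massIn f r ≤ 2 * Jreal Q f / R ^ 2 + Jreal Q f / (c * N ^ (1 / μ)) +
      ∫ z in Metric.ball (0 : Space) r ×ˢ Metric.ball (0 : Space) R, min (f z) N := by
  have hN0 : 0 < N := hF.trans_le hN
  set B := Metric.ball (0 : Space) r ×ˢ Metric.ball (0 : Space) R with hB
  have hBm : MeasurableSet B := measurableSet_ball.prod measurableSet_ball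
  have hNp : 0 < c * N ^ (1 / μ) := by positivity
  have hI1 := hf.integrable_kinetic.div_const (R ^ 2)
  have hI2 := (hf.integrable_Q hQ).div_const (c * N ^ (1 / μ))
  have hmin : Integrable fun z => min (f z) N := by
    refine hf.integrable.mono (hf.integrable.1.inf aestronglyMeasurable_const) ?_
    filter_upwards [hf.nonneg] with z hz
    rw [Real.norm_of_nonneg hz, Real.norm_of_nonneg (le_min hz hN0.le)]
    exact min_le_left _ _
  have hI3 : Integrable (B.indicator fun z => min (f z) N) := hmin.indicator hBm
  have hI12 : Integrable fun z : Phase =>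
      ‖z.2‖ ^ 2 * f z / R ^ 2 + Q (f z) (angMom z) / (c * N ^ (1 / μ)) := hI1.add hI2
  have hbound : ∀ᵐ z : Phase, {z : Phase | ‖z.1‖ < r}.indicator f z ≤
      ‖z.2‖ ^ 2 * f z / R ^ 2 + Q (f z) (angMom z) / (c * N ^ (1 / μ)) +
        B.indicator (fun z => min (f z) N) z := by
    filter_upwards [hf.nonneg] with z hz
    have t1 : 0 ≤ ‖z.2‖ ^ 2 * f z / R ^ 2 := by positivity
    have t2 : 0 ≤ Q (f z) (angMom z) / (c * N ^ (1 / μ)) :=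
      div_nonneg (hQ.nonneg hz (angMom_nonneg z)) hNp.le
    have t3 : 0 ≤ B.indicator (fun z => min (f z) N) z :=
      indicator_apply_nonneg fun _ => le_min hz hN0.le
    by_cases hx : ‖z.1‖ < r
    · rw [indicator_of_mem (by exact hx)]
      by_cases hv : ‖z.2‖ < R
      · by_cases hfN : f z ≤ N
        · have : z ∈ B := by simp [hB, hx, hv]
          rw [indicator_of_mem this, min_eq_left hfN]
          linarith
        · rw [not_le] at hfN
          have h2 := h1 (f z) (angMom z) (hN.trans hfN.le) (angMom_nonneg z)
          have hfp : 0 < f z := hN0.trans hfN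
          rw [Real.rpow_add hfp, Real.rpow_one] at h2
          have h3 : N ^ (1 / μ) ≤ f z ^ (1 / μ) :=
            Real.rpow_le_rpow hN0.le hfN.le (by positivity)
          have h4 : f z ≤ Q (f z) (angMom z) / (c * N ^ (1 / μ)) := by
            rw [le_div_iff₀ hNp]
            refine le_trans ?_ h2
            have := mul_le_mul_of_nonneg_left h3 (mul_nonneg hc.le hz)
            linarith
          linarith
      · rw [not_lt] at hv
        have h4 : f z ≤ ‖z.2‖ ^ 2 * f z / R ^ 2 := by
          rw [le_div_iff₀ (by positivity), mul_comm]
          exact mul_le_mul_of_nonneg_right (by gcongr) hz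
        linarith
    · rw [indicator_of_notMem (by exact hx)]
      linarith
  have hmono := integral_mono_ae (hf.integrable.indicator (measurableSet_norm_fst_lt r))
    (hI12.add hI3) hbound
  rw [integral_indicator (measurableSet_norm_fst_lt r), integral_add' hI12 hI3,
    integral_add hI1 hI2, integral_div, integral_div, integral_indicator hBm] at hmono
  have hJ := hf.Jreal_eq hQ
  have := hf.integral_Q_nonneg hQ
  have := hf.kinetic_nonneg
  refine hmono.trans ?_
  gcongr ?_ / _ + ?_ / _ + ?_
  · linarith
  · linarith
  · exact le_rfl

theorem massIn_le_of_cutoffs (hQ : Admissible Q) {c F μ : ℝ} (hc : 0 < c) (hμ : 0 < μ)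
    (hF : 0 < F) (h1 : ∀ f L, F ≤ f → 0 ≤ L → c * f ^ (1 + 1 / μ) ≤ Q f L)
    (hf : HasFiniteJ Q f) {r R N : ℝ} (hr : 0 < r) (hR : 0 < R) (hN : F ≤ N) :
    massIn f r ≤ 2 * Jreal Q f / R ^ 2 + Jreal Q f / (c * N ^ (1 / μ)) +
      N * (unitVol * r ^ 3 * R ^ 3) := by
  have hN0 : 0 < N := hF.trans_le hN
  refine (massIn_le_truncated hQ hc hμ hF h1 hf hR hN).trans ?_
  gcongr
  have hBv := volume_prod_ball hr.le hR.le
  have h2 := norm_setIntegral_le_of_norm_le_const_ae (μ := (volume : Measure Phase))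
    (s := Metric.ball (0 : Space) r ×ˢ Metric.ball (0 : Space) R)
    (f := fun z => min (f z) N) (C := N) (by rw [hBv]; exact ENNReal.ofReal_lt_top) ?_
  · rw [Measure.real, hBv, ENNReal.toReal_ofReal (by have := unitVol_nonneg; positivity)] at h2
    exact (le_abs_self _).trans h2
  · filter_upwards [ae_restrict_of_ae hf.nonneg] with z hz
    rw [Real.norm_of_nonneg (le_min hz hN0.le)]
    exact min_le_right _ _

/-! ### A dominating profile for mass functions. -/

/-- The profile `min(1, (b r)^{3/5})`, which dominates the mass functions. -/
def profile (b r : ℝ) : ℝ := min 1 ((b * r) ^ (3 / 5 : ℝ))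

theorem profile_nonneg {b r : ℝ} (hb : 0 ≤ b) (hr : 0 ≤ r) : 0 ≤ profile b r :=
  le_min zero_le_one (Real.rpow_nonneg (mul_nonneg hb hr) _)

theorem measurable_profile (b : ℝ) : Measurable (profile b) := by
  unfold profile; fun_prop

theorem integrableOn_profile_sq_one :
    IntegrableOn (fun r => profile 1 r ^ 2 / r ^ 2) (Ioi 0) := by
  rw [← Ioc_union_Ioi_eq_Ioi (zero_le_one' ℝ)]
  have hm : Measurable fun r => profile 1 r ^ 2 / r ^ 2 := by
    have := measurable_profile 1
    fun_prop
  refine IntegrableOn.union ?_ ?_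
  -- The exponent is `2·(3/5) - 2 = -4/5 > -1`; any power above `1/2` in the profile would be
  -- integrable here.
  · have h := (intervalIntegral.intervalIntegrable_rpow' (a := 0) (b := 1) (r := -4 / 5)
      (by norm_num)).1
    refine h.mono' hm.aestronglyMeasurable ?_
    filter_upwards [ae_restrict_mem measurableSet_Ioc] with r hr
    have hr0 : 0 < r := hr.1
    rw [Real.norm_of_nonneg (by positivity), div_le_iff₀ (by positivity), profile, one_mul]
    have e : r ^ (-4 / 5 : ℝ) * r ^ 2 = (r ^ (3 / 5 : ℝ)) ^ 2 := by
      rw [← Real.rpow_natCast, ← Real.rpow_add hr0, ← Real.rpow_natCast, ← Real.rpow_mul hr0.le]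
      norm_num
    rw [e]
    gcongr
    exact min_le_right _ _
  · refine (integrableOn_Ioi_rpow_of_lt (a := -2) (by norm_num) one_pos).mono'
      hm.aestronglyMeasurable ?_
    filter_upwards [ae_restrict_mem measurableSet_Ioi] with r hr
    have hr0 : 0 < r := one_pos.trans hr
    rw [Real.norm_of_nonneg (by positivity), Real.rpow_neg hr0.le, ← one_div]
    norm_num
    rw [div_eq_mul_inv]
    have : profile 1 r ^ 2 ≤ 1 := by
      refine pow_le_one₀ (profile_nonneg zero_le_one hr0.le) (min_le_left _ _)
    have h3 : 0 ≤ (r ^ 2)⁻¹ := by positivity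
    nlinarith

/-- The integral `∫ profile₁² / r²`. -/
def profileConst : ℝ := ∫ r in Ioi (0 : ℝ), profile 1 r ^ 2 / r ^ 2

theorem integrableOn_profile_sq {b : ℝ} (hb : 0 < b) :
    IntegrableOn (fun r => profile b r ^ 2 / r ^ 2) (Ioi 0) ∧
      ∫ r in Ioi (0 : ℝ), profile b r ^ 2 / r ^ 2 = b * profileConst := by
  have e : (fun r => profile b r ^ 2 / r ^ 2) =
      fun r => b ^ 2 * (fun r => profile 1 r ^ 2 / r ^ 2) (b * r) := by
    ext r
    simp only [profile, one_mul]
    field_simp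
  rw [e]
  constructor
  · have h := (integrableOn_Ioi_comp_mul_left_iff (fun r => profile 1 r ^ 2 / r ^ 2) 0 hb).2
      (by rw [mul_zero]; exact integrableOn_profile_sq_one)
    exact h.const_mul _
  · rw [integral_const_mul, integral_comp_mul_left_Ioi (fun r => profile 1 r ^ 2 / r ^ 2) 0 hb,
      mul_zero, profileConst, smul_eq_mul]
    field_simp

theorem profileConst_nonneg : 0 ≤ profileConst := by
  unfold profileConst
  exact integral_nonneg fun r => by positivity

theorem integrableOn_of_le_profile {m : ℝ → ℝ} (hm : Measurable m) {A b : ℝ} (hb : 0 < b)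
    (h : ∀ r, 0 < r → |m r| ≤ A * profile b r ^ 2) :
    IntegrableOn (fun r => m r / r ^ 2) (Ioi 0) := by
  refine ((integrableOn_profile_sq hb).1.const_mul A).mono'
    (hm.div (by fun_prop)).aestronglyMeasurable ?_
  filter_upwards [ae_restrict_mem measurableSet_Ioi] with r hr
  have hr : 0 < r := hr
  rw [norm_div, Real.norm_eq_abs, Real.norm_of_nonneg (by positivity : 0 ≤ r ^ 2), ← mul_div_assoc]
  gcongr
  exact h r hr

end FiniteJ

end VlasovPoisson
end

/-! ### Control of the potential energy by `J`, and the expansion of the energy about a state. -/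

noncomputable section

namespace VlasovPoisson

variable {Q : ℝ → ℝ → ℝ} {f g : Phase → ℝ}

/-- In terms of `s = j^κ r`, the cutoffs `R² = j/s` and `N = F j^μ s^{-9/10}` bound each of the
three terms of the mass estimate by a multiple of `s^{3/5}` when `s < 1`; for `s ≥ 1` the total mass
is enough. The hypothesis `μ < 3/2` enters through `κ < 1`, and it also makes the middle term
`s^{9/(10μ)}` at most `s^{3/5}`. -/
theorem exists_profile_bound (hQ : Admissible Q) {M : ℝ} (hM : 0 < M) :
    ∃ κ A : ℝ, 0 < κ ∧ κ < 1 ∧ 0 < A ∧ ∀ f, HasFiniteJ Q f → ∫ z, f z ≤ M →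
      ∀ j : ℝ, 1 ≤ j → Jreal Q f ≤ j → ∀ r, 0 < r → massIn f r ≤ A * profile (j ^ κ) r := by
  obtain ⟨-, -, c, c₂, c₃, c₄, F, μ, μ₂, μ₃, hc, -, -, -, hF, hμ, -, -, h1, -⟩ := id hQ
  have hμ0 : 0 < μ := hμ.1
  have hμ1 : μ < 3 / 2 := hμ.2
  -- Chosen so that the powers of `j` cancel in `N r³ R³`: `μ - 3κ + 3/2 = 0`.
  set κ : ℝ := (μ + 3 / 2) / 3 with hκ
  have hA0 : 0 ≤ 1 / (c * F ^ (1 / μ)) := by positivity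
  have hA1 : 0 ≤ F * unitVol := mul_nonneg hF.le unitVol_nonneg
  set A : ℝ := M + 2 + 1 / (c * F ^ (1 / μ)) + F * unitVol with hA
  refine ⟨κ, A, by positivity, by rw [hκ]; linarith, by positivity, ?_⟩
  intro f hf hfM j hj hJ r hr
  have hj0 : 0 < j := by linarith
  set b : ℝ := j ^ κ with hb
  have hb0 : 0 < b := by positivity
  set s : ℝ := b * r with hs
  have hs0 : 0 < s := by positivity
  by_cases h : 1 ≤ s
  · have : profile b r = 1 := min_eq_left (Real.one_le_rpow h (by norm_num))
    rw [this, mul_one]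
    have := massIn_le hf.integrable hf.nonneg r
    linarith
  rw [not_le] at h
  have hprof : profile b r = s ^ (3 / 5 : ℝ) :=
    min_eq_right (Real.rpow_le_one hs0.le h.le (by norm_num))
  rw [hprof]
  set S := s ^ (3 / 5 : ℝ) with hS
  have hS0 : 0 < S := by positivity
  set R : ℝ := j ^ (1 / 2 : ℝ) * s ^ (-1 / 2 : ℝ) with hR
  set N : ℝ := F * (j ^ μ * s ^ (-9 / 10 : ℝ)) with hN
  have hFN : F ≤ N := by
    refine le_mul_of_one_le_right hF.le ?_
    exact one_le_mul_of_one_le_of_one_le (Real.one_le_rpow hj hμ0.le)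
      (Real.one_le_rpow_of_pos_of_le_one_of_nonpos hs0 h.le (by norm_num))
  have hmain := massIn_le_of_cutoffs hQ hc hμ0 hF h1 hf hr (by positivity : 0 < R) hFN
  have hJ0 : 0 ≤ Jreal Q f := Jreal_nonneg
  have hR2 : R ^ 2 = j / s := by
    rw [hR, mul_pow, ← Real.rpow_natCast, ← Real.rpow_natCast, ← Real.rpow_mul hj0.le,
      ← Real.rpow_mul hs0.le]
    norm_num
    rw [Real.rpow_neg_one, div_eq_mul_inv]
  have hsS : s ≤ S := by
    calc s = s ^ (1 : ℝ) := (Real.rpow_one s).symm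
      _ ≤ S := Real.rpow_le_rpow_of_exponent_ge hs0 h.le (by norm_num)
  have hT1 : 2 * Jreal Q f / R ^ 2 ≤ 2 * S := by
    rw [hR2, div_div_eq_mul_div, div_le_iff₀ hj0]
    nlinarith [mul_le_mul hJ hsS hs0.le hj0.le]
  have hNp : N ^ (1 / μ) = F ^ (1 / μ) * (j * s ^ (-9 / 10 / μ)) := by
    rw [hN, Real.mul_rpow hF.le (by positivity), Real.mul_rpow (by positivity) (by positivity),
      ← Real.rpow_mul hj0.le, ← Real.rpow_mul hs0.le, mul_one_div_cancel hμ0.ne', Real.rpow_one]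
    congr 3
    ring
  have hT2 : Jreal Q f / (c * N ^ (1 / μ)) ≤ 1 / (c * F ^ (1 / μ)) * S := by
    have e : s ^ (-9 / 10 / μ) * S ≥ 1 := by
      rw [hS, ← Real.rpow_add hs0]
      refine Real.one_le_rpow_of_pos_of_le_one_of_nonpos hs0 h.le ?_
      have : 3 / 5 ≤ 9 / 10 / μ := by rw [le_div_iff₀ hμ0]; linarith
      have e2 : -9 / 10 / μ = -(9 / 10 / μ) := by ring
      rw [e2]; linarith
    rw [hNp, div_le_iff₀ (by positivity)]
    have e3 : 1 / (c * F ^ (1 / μ)) * S * (c * (F ^ (1 / μ) * (j * s ^ (-9 / 10 / μ)))) =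
        j * (s ^ (-9 / 10 / μ) * S) := by
      field_simp
    rw [e3]
    nlinarith
  have hT3 : N * (unitVol * r ^ 3 * R ^ 3) = F * unitVol * S := by
    have hr3 : r ^ 3 = s ^ (3 : ℝ) * j ^ (-(μ + 3 / 2)) := by
      have : r = s * j ^ (-κ) := by
        rw [hs, hb, Real.rpow_neg hj0.le]; field_simp
      rw [this, mul_pow, ← Real.rpow_natCast, ← Real.rpow_natCast (j ^ (-κ)), ← Real.rpow_mul hj0.le]
      congr 2
      rw [hκ]; push_cast; ring
    have hR3 : R ^ 3 = j ^ (3 / 2 : ℝ) * s ^ (-3 / 2 : ℝ) := by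
      rw [hR, mul_pow, ← Real.rpow_natCast, ← Real.rpow_natCast, ← Real.rpow_mul hj0.le,
        ← Real.rpow_mul hs0.le]
      norm_num
    rw [hr3, hR3, hN]
    have e1 : j ^ μ * j ^ (-(μ + 3 / 2)) * j ^ (3 / 2 : ℝ) = 1 := by
      rw [← Real.rpow_add hj0, ← Real.rpow_add hj0]
      ring_nf
      exact Real.rpow_zero j
    -- The powers of `s` in `N r³ R³` add up to `-9/10 + 3 - 3/2 = 3/5`.
    have e2 : s ^ (-9 / 10 : ℝ) * s ^ (3 : ℝ) * s ^ (-3 / 2 : ℝ) = S := by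
      rw [← Real.rpow_add hs0, ← Real.rpow_add hs0, hS]
      norm_num
    calc _ = F * unitVol * (j ^ μ * j ^ (-(μ + 3 / 2)) * j ^ (3 / 2 : ℝ)) *
          (s ^ (-9 / 10 : ℝ) * s ^ (3 : ℝ) * s ^ (-3 / 2 : ℝ)) := by ring
      _ = _ := by rw [e1, e2, mul_one]
  rw [hT3] at hmain
  calc massIn f r ≤ 2 * S + 1 / (c * F ^ (1 / μ)) * S + F * unitVol * S := by linarith
    _ ≤ A * S := by rw [hA]; nlinarith

/-- The interaction energy of two densities with finite `J` is finite. -/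
theorem HasFiniteJ.integrableOn_massIn_mul (hQ : Admissible Q) (hf : HasFiniteJ Q f)
    (hg : HasFiniteJ Q g) :
    IntegrableOn (fun r => massIn f r * massIn g r / r ^ 2) (Ioi 0) := by
  have hf0 := integral_nonneg_of_ae hf.nonneg
  have hg0 := integral_nonneg_of_ae hg.nonneg
  obtain ⟨κ, A, hκ0, -, hA, h⟩ := exists_profile_bound hQ
    (by positivity : 0 < (∫ z, f z) + (∫ z, g z) + 1)
  have hJf : 0 ≤ Jreal Q f := Jreal_nonneg
  have hJg : 0 ≤ Jreal Q g := Jreal_nonneg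
  set j := 1 + Jreal Q f + Jreal Q g with hj
  have hj0 : 0 < j := by positivity
  have h1 := h f hf (by linarith) j (by linarith) (by linarith)
  have h2 := h g hg (by linarith) j (by linarith) (by linarith)
  refine integrableOn_of_le_profile (A := A ^ 2) (b := j ^ κ)
    ((continuous_massIn hf.integrable).mul (continuous_massIn hg.integrable)).measurable
    (by positivity) fun r hr => ?_
  have a1 := massIn_nonneg hf.nonneg r
  have a2 := massIn_nonneg hg.nonneg r
  rw [abs_of_nonneg (mul_nonneg a1 a2)]
  calc _ ≤ (A * profile (j ^ κ) r) * (A * profile (j ^ κ) r) :=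
        mul_le_mul (h1 r hr) (h2 r hr) a2 (a1.trans (h1 r hr))
    _ = _ := by ring

theorem HasFiniteJ.integrableOn_massIn_sub_sq (hQ : Admissible Q) (hf : HasFiniteJ Q f)
    (hg : HasFiniteJ Q g) :
    IntegrableOn (fun r => (massIn f r - massIn g r) ^ 2 / r ^ 2) (Ioi 0) := by
  have h1 := hf.integrableOn_massIn_mul hQ hf
  have h2 := hf.integrableOn_massIn_mul hQ hg
  have h3 := hg.integrableOn_massIn_mul hQ hg
  refine ((h1.sub (h2.const_mul 2)).add h3).congr_fun (fun r _ => ?_) measurableSet_Ioi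
  simp only [Pi.add_apply, Pi.sub_apply]
  ring

theorem potEnergy_nonneg (m : ℝ → ℝ) : 0 ≤ potEnergy m :=
  mul_nonneg (by norm_num) (integral_nonneg fun r => by positivity)

/-- The integral of `profile b r ^ 2 / r ^ 2` scales linearly in `b = (1 + J)^κ`. The exponent `κ <
1` makes the potential energy sublinear in `J`. -/
theorem potEnergy_massIn_le (hQ : Admissible Q) {M : ℝ} (hM : 0 < M) :
    ∃ κ B : ℝ, 0 < κ ∧ κ < 1 ∧ 0 ≤ B ∧ ∀ f, HasFiniteJ Q f → ∫ z, f z ≤ M →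
      potEnergy (massIn f) ≤ B * (1 + Jreal Q f) ^ κ := by
  obtain ⟨κ, A, hκ0, hκ1, hA, h⟩ := exists_profile_bound hQ hM
  refine ⟨κ, 1 / 2 * (A ^ 2 * profileConst), hκ0, hκ1,
    by have := profileConst_nonneg; positivity, fun f hf hfM => ?_⟩
  have hJ0 : 0 ≤ Jreal Q f := Jreal_nonneg
  set j := 1 + Jreal Q f with hj
  have hj0 : 0 < j := by positivity
  have hb : 0 < j ^ κ := by positivity
  have h1 := h f hf hfM j (by linarith) (by linarith)
  obtain ⟨hi, he⟩ := integrableOn_profile_sq hb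
  have hle : ∫ r in Ioi (0 : ℝ), massIn f r ^ 2 / r ^ 2 ≤
      ∫ r in Ioi (0 : ℝ), A ^ 2 * (profile (j ^ κ) r ^ 2 / r ^ 2) := by
    refine setIntegral_mono_on ?_ (hi.const_mul _) measurableSet_Ioi fun r hr => ?_
    · simpa only [sq] using hf.integrableOn_massIn_mul hQ hf
    · have hr : 0 < r := hr
      have := massIn_nonneg hf.nonneg r
      rw [← mul_div_assoc, ← mul_pow]
      gcongr
      exact h1 r hr
  rw [integral_const_mul, he] at hle
  rw [potEnergy]
  linarith

theorem exists_mul_rpow_le {κ B : ℝ} (hκ1 : κ < 1) (hB : 0 ≤ B) :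
    ∃ C : ℝ, 0 ≤ C ∧ ∀ y : ℝ, 1 ≤ y → B * y ^ κ ≤ y / 2 + C := by
  have h1 : Tendsto (fun y : ℝ => y ^ (-(1 - κ))) atTop (𝓝 0) :=
    tendsto_rpow_neg_atTop (by linarith)
  have h2 := (h1.const_mul B).eventually (gt_mem_nhds (by norm_num : B * 0 < 1 / 2))
  obtain ⟨Y, hY⟩ := eventually_atTop.1 h2
  refine ⟨B * max 1 Y ^ |κ|, by positivity, fun y hy => ?_⟩
  have hy0 : 0 < y := by linarith
  rcases le_total Y y with h | h
  · have h3 := hY y h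
    have e : y ^ κ = y ^ (-(1 - κ)) * y := by
      nth_rewrite 3 [← Real.rpow_one y]
      rw [← Real.rpow_add hy0]; ring_nf
    rw [e]
    have : 0 ≤ B * max 1 Y ^ |κ| := by positivity
    nlinarith
  · have h3 : y ^ κ ≤ max 1 Y ^ |κ| :=
      (Real.rpow_le_rpow_of_exponent_le hy (le_abs_self κ)).trans
        (Real.rpow_le_rpow hy0.le (h.trans (le_max_right _ _)) (abs_nonneg κ))
    have := mul_le_mul_of_nonneg_left h3 hB
    linarith

theorem energyCasimir_eq (hf : IsSymmDensity f) :
    energyCasimir Q f = Jreal Q f - potEnergy (massIn f) := by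
  rw [energyCasimir, integral_norm_field_sq hf, Jreal]

/-- Half of `J` absorbs the sublinear potential energy. In particular `𝓓` is bounded below at
bounded mass, and minimizing sequences have bounded `J`. -/
theorem exists_Jreal_le (hQ : Admissible Q) {M : ℝ} (hM : 0 < M) :
    ∃ C : ℝ, ∀ f, HasFiniteJ Q f → ∫ z, f z ≤ M → Jreal Q f ≤ 2 * energyCasimir Q f + C := by
  obtain ⟨κ, B, -, hκ1, hB, h⟩ := potEnergy_massIn_le hQ hM
  obtain ⟨C, hC, h2⟩ := exists_mul_rpow_le hκ1 hB
  refine ⟨1 + 2 * C, fun f hf hfM => ?_⟩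
  have h3 := h f hf hfM
  have hJ0 : 0 ≤ Jreal Q f := Jreal_nonneg
  have h4 := h2 (1 + Jreal Q f) (by linarith)
  rw [energyCasimir_eq hf.toIsSymmDensity]
  linarith

/-! ### The relative energy -/

theorem HasFiniteJ.integrable_potential_mul (hQ : Admissible Q) (hf : HasFiniteJ Q f)
    (hg : HasFiniteJ Q g) : Integrable (fun z : Phase => potential f z.1 * g z) :=
  (integrable_mul_potential hf.toIsSymmDensity hg.toIsSymmDensity
    (hf.integrableOn_massIn_mul hQ hg)).1

theorem HasFiniteJ.integral_potential_mul (hQ : Admissible Q) (hf : HasFiniteJ Q f)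
    (hg : HasFiniteJ Q g) : ∫ z : Phase, potential f z.1 * g z =
      -∫ r in Ioi (0 : ℝ), massIn f r * massIn g r / r ^ 2 :=
  (integrable_mul_potential hf.toIsSymmDensity hg.toIsSymmDensity
    (hf.integrableOn_massIn_mul hQ hg)).2

theorem HasFiniteJ.integrable_energy_mul (hQ : Admissible Q) (hf : HasFiniteJ Q f)
    (hg : HasFiniteJ Q g) : Integrable (fun z : Phase => energy f z * g z) := by
  refine ((hg.integrable_kinetic.const_mul (1 / 2)).add
    (hf.integrable_potential_mul hQ hg)).congr (Eventually.of_forall fun z => ?_)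
  simp only [energy, Pi.add_apply]
  ring

theorem HasFiniteJ.integral_energy_mul (hQ : Admissible Q) (hf : HasFiniteJ Q f)
    (hg : HasFiniteJ Q g) : ∫ z : Phase, energy f z * g z =
      1 / 2 * (∫ z : Phase, ‖z.2‖ ^ 2 * g z) -
        ∫ r in Ioi (0 : ℝ), massIn f r * massIn g r / r ^ 2 := by
  rw [sub_eq_add_neg, ← hf.integral_potential_mul hQ hg, ← integral_const_mul,
    ← integral_add (hg.integrable_kinetic.const_mul (1 / 2)) (hf.integrable_potential_mul hQ hg)]
  refine integral_congr_ae (Eventually.of_forall fun z => ?_)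
  simp only [energy]
  ring

theorem HasFiniteJ.integrable_casimirDist (hQ : Admissible Q) (M : ℝ) (hf : HasFiniteJ Q f)
    (hg : HasFiniteJ Q g) : Integrable (fun z : Phase =>
      Q (g z) (angMom z) - Q (f z) (angMom z) + (energy f z - cutoffEnergy Q M f) * (g z - f z)) := by
  refine (((hg.integrable_Q hQ).sub (hf.integrable_Q hQ)).add
    (((hf.integrable_energy_mul hQ hg).sub (hf.integrable_energy_mul hQ hf)).sub
      ((hg.integrable.sub hf.integrable).const_mul (cutoffEnergy Q M f)))).congr
    (Eventually.of_forall fun z => ?_)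
  simp only [Pi.add_apply, Pi.sub_apply]
  ring

theorem integral_sq_sub (hQ : Admissible Q) (hf : HasFiniteJ Q f) (hg : HasFiniteJ Q g) :
    potEnergy (fun r => massIn g r - massIn f r) = potEnergy (massIn g) + potEnergy (massIn f)
      - ∫ r in Ioi (0 : ℝ), massIn f r * massIn g r / r ^ 2 := by
  have h1 := hf.integrableOn_massIn_mul hQ hf
  have h2 := hf.integrableOn_massIn_mul hQ hg
  have h3 := hg.integrableOn_massIn_mul hQ hg
  have e : ∫ r in Ioi (0 : ℝ), (massIn g r - massIn f r) ^ 2 / r ^ 2 =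
      ∫ r in Ioi (0 : ℝ), (massIn g r * massIn g r / r ^ 2 + massIn f r * massIn f r / r ^ 2
        - 2 * (massIn f r * massIn g r / r ^ 2)) := by
    congr 1
    ext r
    ring
  have e2 := integral_sub (h3.add h1) (h2.const_mul 2)
  have e3 := integral_add h3 h1
  simp only [Pi.add_apply] at e2
  rw [e3, integral_const_mul] at e2
  simp only [potEnergy]
  rw [e, e2]
  simp only [sq]
  ring

/-- The kinetic and Casimir parts subtract exactly, and the potential energy is quadratic: its
linear part at `f` is the `U_f` inside `E`, and the rest is minus the energy of the field
difference. The constant `E₀` drops out because the masses agree. -/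
theorem energyCasimir_sub (hQ : Admissible Q) {M : ℝ} (hf : HasFiniteJ Q f)
    (hg : HasFiniteJ Q g) (hfM : ∫ z, f z = M) (hgM : ∫ z, g z = M) :
    energyCasimir Q g - energyCasimir Q f =
      casimirDist Q M f g - potEnergy (fun r => massIn g r - massIn f r) := by
  have i1 := (hg.integrable_Q hQ).sub (hf.integrable_Q hQ)
  have i2 := (hf.integrable_energy_mul hQ hg).sub (hf.integrable_energy_mul hQ hf)
  have i3 := (hg.integrable.sub hf.integrable).const_mul (cutoffEnergy Q M f)
  have e : casimirDist Q M f g = (∫ z, Q (g z) (angMom z)) - (∫ z, Q (f z) (angMom z)) +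
      ((∫ z, energy f z * g z) - ∫ z, energy f z * f z) := by
    have e1 := integral_add i1 (i2.sub i3)
    have e2 := integral_sub i2 i3
    have e3 := integral_sub (hg.integrable_Q hQ) (hf.integrable_Q hQ)
    have e4 := integral_sub (hf.integrable_energy_mul hQ hg) (hf.integrable_energy_mul hQ hf)
    have e5 := integral_sub hg.integrable hf.integrable
    simp only [Pi.sub_apply] at e1 e2 e3 e4
    rw [integral_const_mul] at e2
    rw [e5, hfM, hgM, sub_self, mul_zero, sub_zero, e4] at e2
    rw [e2, e3] at e1
    rw [← e1, casimirDist]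
    refine integral_congr_ae (Eventually.of_forall fun z => ?_)
    simp only
    ring
  rw [e, hf.integral_energy_mul hQ hg, hf.integral_energy_mul hQ hf,
    energyCasimir_eq hf.toIsSymmDensity, energyCasimir_eq hg.toIsSymmDensity,
    hf.Jreal_eq hQ, hg.Jreal_eq hQ, integral_sq_sub hQ hf hg]
  simp only [potEnergy, sq]
  ring

end VlasovPoisson
end

noncomputable section

namespace VlasovPoisson

variable {Q : ℝ → ℝ → ℝ} {f g : Phase → ℝ}

/-! ### Scaling -/

/-- The dilation `(x, v) ↦ (a x, b v)` of phase space. -/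
def dilation (a b : ℝ) (z : Phase) : Phase := (a • z.1, b • z.2)

theorem measurableEmbedding_dilation {a b : ℝ} (ha : 0 < a) (hb : 0 < b) :
    MeasurableEmbedding (dilation a b) :=
  ((Homeomorph.smulOfNeZero a ha.ne').prodCongr
    (Homeomorph.smulOfNeZero b hb.ne')).measurableEmbedding

theorem map_dilation {a b : ℝ} (ha : 0 < a) (hb : 0 < b) :
    Measure.map (dilation a b) volume = ENNReal.ofReal (((a * b) ^ 3)⁻¹) • (volume : Measure Phase) := by
  have h : ∀ {a : ℝ}, 0 < a → Measure.map (a • ·) (volume : Measure Space) =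
      ENNReal.ofReal ((a ^ 3)⁻¹) • volume := by
    intro a ha
    rw [Measure.map_addHaar_smul _ ha.ne']
    simp only [finrank_euclideanSpace, Fintype.card_fin]
    rw [abs_of_pos (by positivity)]
  have e := Measure.map_prod_map (volume : Measure Space) (volume : Measure Space)
    (measurable_const_smul a) (measurable_const_smul b)
  rw [h ha, h hb, Measure.prod_smul_left, Measure.prod_smul_right, smul_smul,
    ← ENNReal.ofReal_mul (by positivity)] at e
  rw [mul_pow, mul_inv]
  exact e.symm

theorem integral_comp_dilation {a b : ℝ} (ha : 0 < a) (hb : 0 < b) (h : Phase → ℝ) :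
    ∫ z, h (dilation a b z) = ((a * b) ^ 3)⁻¹ * ∫ z, h z := by
  rw [← (measurableEmbedding_dilation ha hb).integral_map, map_dilation ha hb,
    integral_smul_measure, ENNReal.toReal_ofReal (by positivity), smul_eq_mul]

theorem integrable_comp_dilation {a b : ℝ} (ha : 0 < a) (hb : 0 < b) {h : Phase → ℝ}
    (hh : Integrable h) : Integrable (fun z => h (dilation a b z)) := by
  have := (measurableEmbedding_dilation ha hb).integrable_map_iff (g := h) (μ := volume)
  rw [map_dilation ha hb] at this
  exact this.1 (hh.smul_measure ENNReal.ofReal_ne_top)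

theorem quasiMeasurePreserving_dilation {a b : ℝ} (ha : 0 < a) (hb : 0 < b) :
    Measure.QuasiMeasurePreserving (dilation a b) := by
  refine ⟨(measurableEmbedding_dilation ha hb).measurable, ?_⟩
  rw [map_dilation ha hb]
  exact Measure.smul_absolutelyContinuous

theorem angMom_dilation (a b : ℝ) (z : Phase) :
    angMom (dilation a b z) = (a * b) ^ 2 * angMom z := by
  simp only [angMom, dilation, norm_smul, inner_smul_left, inner_smul_right, mul_pow,
    Real.norm_eq_abs, sq_abs]
  simp
  ring

/-- The rescaled density `l f(a x, b v)`. -/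
def rescale (l a b : ℝ) (f : Phase → ℝ) (z : Phase) : ℝ := l * f (dilation a b z)

theorem IsSymmDensity.rescale (hf : IsSymmDensity f) {l a b : ℝ} (hl : 0 ≤ l) (ha : 0 < a)
    (hb : 0 < b) : IsSymmDensity (rescale l a b f) := by
  have hq := quasiMeasurePreserving_dilation ha hb
  refine ⟨(integrable_comp_dilation ha hb hf.integrable).const_mul l, ?_, fun A hA => ?_⟩
  · filter_upwards [hq.ae hf.nonneg] with z hz
    exact mul_nonneg hl hz
  · filter_upwards [hq.ae (hf.symm A hA)] with z hz
    simp only [VlasovPoisson.rescale, dilation] at hz ⊢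
    rw [← map_smul, ← map_smul, hz]

theorem massIn_rescale {l a b : ℝ} (ha : 0 < a) (hb : 0 < b) (r : ℝ) :
    massIn (rescale l a b f) r = l * ((a * b) ^ 3)⁻¹ * massIn f (a * r) := by
  rw [massIn, massIn, ← integral_indicator (measurableSet_norm_fst_lt r),
    ← integral_indicator (measurableSet_norm_fst_lt _), mul_assoc, ← integral_comp_dilation ha hb,
    ← integral_const_mul]
  congr 1
  ext z
  have : ‖(dilation a b z).1‖ < a * r ↔ ‖z.1‖ < r := by
    simp [dilation, norm_smul, abs_of_pos ha, ha]
  by_cases h : ‖z.1‖ < r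
  · rw [indicator_of_mem (by exact h), indicator_of_mem (by exact this.2 h)]; rfl
  · rw [indicator_of_notMem (by exact h), indicator_of_notMem (by exact fun h' => h (this.1 h')),
      mul_zero]

theorem potEnergy_massIn_rescale {l a b : ℝ} (ha : 0 < a) (hb : 0 < b) :
    potEnergy (massIn (rescale l a b f)) =
      (l * ((a * b) ^ 3)⁻¹) ^ 2 * a * potEnergy (massIn f) := by
  have e : (fun r => massIn (rescale l a b f) r ^ 2 / r ^ 2) = fun r =>
      (l * ((a * b) ^ 3)⁻¹) ^ 2 * a ^ 2 * (fun r => massIn f r ^ 2 / r ^ 2) (a * r) := by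
    ext r
    rw [massIn_rescale ha hb]
    simp only
    field_simp
  rw [potEnergy, potEnergy, e, integral_const_mul,
    integral_comp_mul_left_Ioi (fun r => massIn f r ^ 2 / r ^ 2) 0 ha, mul_zero, smul_eq_mul]
  field_simp

theorem HasFiniteJ.of_bounds (hQ : Admissible Q) (hf : IsSymmDensity f) {q : Phase → ℝ}
    (hq : Integrable q) (hle : ∀ᵐ z, Q (f z) (angMom z) ≤ q z)
    (hk : Integrable fun z : Phase => ‖z.2‖ ^ 2 * f z) : HasFiniteJ Q f := by
  refine ⟨hf, ENNReal.add_lt_top.2 ⟨?_, ENNReal.mul_lt_top (by norm_num) ?_⟩⟩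
  · have hI : Integrable fun z => Q (f z) (angMom z) := by
      refine hq.mono' (hQ.regular.aestronglyMeasurable hf.integrable.1 hf.nonneg) ?_
      filter_upwards [hle, hf.nonneg] with z h1 h2
      rwa [Real.norm_of_nonneg (hQ.nonneg h2 (angMom_nonneg z))]
    exact hI.lintegral_lt_top
  · exact hk.lintegral_lt_top

/-- Under `l f(ax, bv)` every term of the energy scales by a power, except that `L` becomes `(ab)²L`
inside `Q`. The hypothesis on `q` isolates the inequality for `Q` that each particular scaling must
supply. -/
theorem HasFiniteJ.rescale (hQ : Admissible Q) (hf : HasFiniteJ Q f) {l a b q : ℝ} (hl : 0 ≤ l)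
    (ha : 0 < a) (hb : 0 < b)
    (hq : ∀ s L, 0 ≤ s → 0 ≤ L → Q (l * s) L ≤ q * Q s ((a * b) ^ 2 * L)) :
    HasFiniteJ Q (rescale l a b f) ∧
      ∫ z, rescale l a b f z = l * ((a * b) ^ 3)⁻¹ * ∫ z, f z ∧
      energyCasimir Q (rescale l a b f) ≤ q * ((a * b) ^ 3)⁻¹ * (∫ z, Q (f z) (angMom z)) +
        l * ((a * b) ^ 3)⁻¹ * (b ^ 2)⁻¹ * (1 / 2 * ∫ z : Phase, ‖z.2‖ ^ 2 * f z) -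
        (l * ((a * b) ^ 3)⁻¹) ^ 2 * a * potEnergy (massIn f) := by
  have hs := hf.toIsSymmDensity.rescale hl ha hb
  have hI := (integrable_comp_dilation ha hb (hf.integrable_Q hQ)).const_mul q
  have hle : ∀ᵐ z, Q (VlasovPoisson.rescale l a b f z) (angMom z) ≤
      q * Q (f (dilation a b z)) (angMom (dilation a b z)) := by
    filter_upwards [(quasiMeasurePreserving_dilation ha hb).ae hf.nonneg] with z hz
    rw [angMom_dilation]
    exact hq _ _ hz (angMom_nonneg z)
  have ek : (fun z : Phase => ‖z.2‖ ^ 2 * VlasovPoisson.rescale l a b f z) = fun z =>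
      l * (b ^ 2)⁻¹ * (fun z : Phase => ‖z.2‖ ^ 2 * f z) (dilation a b z) := by
    ext z
    simp only [VlasovPoisson.rescale, dilation, norm_smul, mul_pow, Real.norm_eq_abs, sq_abs]
    field_simp
  have hk : Integrable fun z : Phase => ‖z.2‖ ^ 2 * VlasovPoisson.rescale l a b f z := by
    rw [ek]
    exact (integrable_comp_dilation ha hb hf.integrable_kinetic).const_mul _
  have hF := HasFiniteJ.of_bounds hQ hs hI hle hk
  refine ⟨hF, ?_, ?_⟩
  · simp only [VlasovPoisson.rescale]
    rw [integral_const_mul, integral_comp_dilation ha hb f, mul_assoc]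
  · have h1 := integral_mono_ae (hF.integrable_Q hQ) hI hle
    rw [integral_const_mul, integral_comp_dilation ha hb (fun z => Q (f z) (angMom z))] at h1
    rw [energyCasimir_eq hs, hF.Jreal_eq hQ, ek, integral_const_mul,
      integral_comp_dilation ha hb (fun z : Phase => ‖z.2‖ ^ 2 * f z),
      potEnergy_massIn_rescale ha hb]
    linarith

/-- A density with too small a mass can be rescaled to have mass `M`, which multiplies its energy
by a factor greater than one, up to a nonnegative error. -/
theorem exists_rescale_energyCasimir_le (hQ : Admissible Q) (hf : HasFiniteJ Q f) {M : ℝ}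
    (h0 : 0 < ∫ z, f z) (hM : ∫ z, f z < M) :
    ∃ g, HasFiniteJ Q g ∧ ∫ z, g z = M ∧
      ∃ s : ℝ, 1 < s ∧ energyCasimir Q g ≤ s * energyCasimir Q f := by
  obtain ⟨-, -, c, c₂, c₃, c₄, F, μ, μ₂, μ₃, -, -, -, -, -, -, -, hμ, -, -, h3, hanti, -⟩ := id hQ
  have hμ0 : 0 < μ₃ := hμ.1
  set m := ∫ z, f z with hm
  have hσ : 1 < M / m := (one_lt_div h0).2 hM
  set σ := M / m with hσd
  have hσ0 : 0 < σ := by linarith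
  have hQ0 := hf.integral_Q_nonneg hQ
  have hE := hf.Jreal_eq hQ
  have hD := energyCasimir_eq (Q := Q) hf.toIsSymmDensity
  by_cases hc : μ₃ < 1 / 2
  -- With `l = 1`, `a = t`, `b = t⁻²` the mass scales by `t³ = σ` and the kinetic and potential
  -- energies both by `t⁷`. The Casimir part gains at most `t³ ≤ t⁷`, because `(ab)²L = t⁻²L ≤ L`
  -- and `Q` is decreasing in `L`.
  · set t := σ ^ (1 / 3 : ℝ) with ht
    have ht1 : 1 < t := Real.one_lt_rpow hσ (by norm_num)
    have ht0 : 0 < t := by linarith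
    have ht3 : t ^ 3 = σ := by
      rw [ht, ← Real.rpow_natCast, ← Real.rpow_mul hσ0.le]; norm_num
    have hab : t * (t ^ 2)⁻¹ = t⁻¹ := by field_simp
    have key := hf.rescale hQ (l := 1) (a := t) (b := (t ^ 2)⁻¹) (q := 1) zero_le_one ht0
      (by positivity) ?_
    · obtain ⟨k1, k2, k3⟩ := key
      refine ⟨_, k1, ?_, t ^ 7, one_lt_pow₀ ht1 (by norm_num), k3.trans ?_⟩
      · rw [k2, hab, ← hm]
        have : ((t⁻¹) ^ 3)⁻¹ = σ := by rw [← ht3]; field_simp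
        rw [this, hσd]; field_simp
      · rw [hab, hD, hE]
        have e1 : ((t⁻¹) ^ 3)⁻¹ = t ^ 3 := by field_simp
        have e2 : (((t ^ 2)⁻¹) ^ 2)⁻¹ = t ^ 4 := by field_simp
        rw [e1, e2]
        have : t ^ 3 ≤ t ^ 7 := pow_le_pow_right₀ ht1.le (by norm_num)
        nlinarith [mul_le_mul_of_nonneg_right this hQ0]
    · intro s L hs hL
      rw [one_mul, one_mul, hab]
      refine hanti hc s hs (mem_Ici.2 (by positivity)) hL ?_
      have : (t⁻¹) ^ 2 ≤ 1 := pow_le_one₀ (by positivity) (inv_le_one_of_one_le₀ ht1.le)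
      nlinarith
  · rw [not_lt] at hc
    -- Here `ab = 1`, so `L` is unchanged and no monotonicity in `L` is needed. Kinetic and
    -- potential energies scale by `σ³`; by (Q3) the Casimir part gains at most `σ^{1+1/μ₃} ≤ σ³`,
    -- as `μ₃ ≥ 1/2`.
    have key := hf.rescale hQ (l := σ) (a := σ) (b := σ⁻¹) (q := σ ^ 3) hσ0.le hσ0
      (by positivity) ?_
    · obtain ⟨k1, k2, k3⟩ := key
      refine ⟨_, k1, ?_, σ ^ 3, one_lt_pow₀ hσ (by norm_num), k3.trans ?_⟩
      · rw [k2, mul_inv_cancel₀ hσ0.ne', ← hm, hσd]; field_simp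
      · rw [mul_inv_cancel₀ hσ0.ne', hD, hE]
        have e2 : ((σ⁻¹) ^ 2)⁻¹ = σ ^ 2 := by field_simp
        rw [e2]
        apply le_of_eq
        ring
    · intro s L hs hL
      rw [mul_inv_cancel₀ hσ0.ne', one_pow, one_mul]
      have h4 := h3 (σ * s) σ⁻¹ L (by positivity) (by positivity)
        (inv_le_one_of_one_le₀ hσ.le) hL
      rw [inv_mul_cancel_left₀ hσ0.ne', Real.inv_rpow hσ0.le] at h4
      have hp : 0 < σ ^ (1 + 1 / μ₃) := by positivity
      rw [inv_mul_le_iff₀ hp] at h4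
      refine h4.trans (mul_le_mul_of_nonneg_right ?_ (hQ.nonneg hs hL))
      rw [← Real.rpow_natCast]
      refine Real.rpow_le_rpow_of_exponent_le hσ.le ?_
      have : 1 / μ₃ ≤ 2 := by rw [div_le_iff₀ hμ0]; linarith
      push_cast
      linarith

/-! ### Negative energies -/

theorem unitVol_pos : 0 < unitVol := by
  have : 0 < (volume (Metric.ball (0 : Space) 1)).toReal :=
    ENNReal.toReal_pos (Metric.measure_ball_pos volume _ one_pos).ne' measure_ball_lt_top.ne
  unfold unitVol
  positivity

theorem isSymmDensity_indicator {S : Set Phase} (hS : MeasurableSet S) (hfin : volume S ≠ ⊤)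
    (hsym : ∀ A : Space ≃ₗᵢ[ℝ] Space, IsRotation A → ∀ᵐ z : Phase, (A z.1, A z.2) ∈ S ↔ z ∈ S)
    {N : ℝ} (hN : 0 ≤ N) : IsSymmDensity (S.indicator fun _ => N) := by
  refine ⟨(integrable_indicator_iff hS).2 (integrableOn_const hfin),
    Eventually.of_forall fun z => indicator_nonneg (fun _ _ => hN) z, fun A hA => ?_⟩
  filter_upwards [hsym A hA] with z hz
  by_cases h : z ∈ S
  · rw [indicator_of_mem h, indicator_of_mem (hz.2 h)]
  · rw [indicator_of_notMem h, indicator_of_notMem (fun h' => h (hz.1 h'))]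

/-- Spread the mass `M` uniformly over `|x| < r`, `|v| < R` with `R² = M/(2r)`. The kinetic energy
is at most `M²/(4r)` and the potential energy at least `M²/(2r)`, from the region outside radius `r`
alone. By (Q2) the Casimir part is of order `r^{-3/(2μ₂)}`, which is `o(1/r)` as `r → ∞` because `μ₂
< 3/2`. -/
theorem exists_energyCasimir_neg (hQ : Admissible Q) {M : ℝ} (hM : 0 < M) :
    ∃ f, HasFiniteJ Q f ∧ ∫ z, f z = M ∧ energyCasimir Q f < 0 := by
  obtain ⟨-, -, c, c₂, c₃, c₄, F, μ, μ₂, μ₃, -, hc₂, -, -, hF, -, hμ, -, -, h2, -⟩ := id hQ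
  have hμ0 : 0 < μ₂ := hμ.1
  have hμ1 : μ₂ < 3 / 2 := hμ.2
  have hu := unitVol_pos
  set A : ℝ := M / (unitVol * (M / 2) ^ (3 / 2 : ℝ)) with hA
  have hA0 : 0 < A := by positivity
  have ht1 : Tendsto (fun r : ℝ => A * r ^ (-(3 / 2 : ℝ))) atTop (𝓝 (A * 0)) :=
    (tendsto_rpow_neg_atTop (by norm_num)).const_mul A
  have ht2 : Tendsto (fun r : ℝ => c₂ * M * A ^ (1 / μ₂) * r ^ (-(3 / 2 / μ₂ - 1))) atTop
      (𝓝 (c₂ * M * A ^ (1 / μ₂) * 0)) :=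
    (tendsto_rpow_neg_atTop (by rw [sub_pos, lt_div_iff₀ hμ0]; linarith)).const_mul _
  rw [mul_zero] at ht1 ht2
  -- The radius is taken so large that the height of the density lies below `F`, where (Q2) applies,
  -- and the Casimir part is less than `M²/(4r)`.
  obtain ⟨r, hr0, hr1, hr2⟩ := ((eventually_gt_atTop (0 : ℝ)).and
    ((ht1.eventually (gt_mem_nhds hF)).and
      (ht2.eventually (gt_mem_nhds (by positivity : 0 < M ^ 2 / 4))))).exists
  set R : ℝ := √(M / 2 / r) with hR
  have hR0 : 0 < R := Real.sqrt_pos.2 (by positivity)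
  have hR2 : R ^ 2 = M / 2 / r := Real.sq_sqrt (by positivity)
  have hR3 : R ^ 3 = (M / 2) ^ (3 / 2 : ℝ) * r ^ (-(3 / 2 : ℝ)) := by
    rw [hR, Real.sqrt_eq_rpow, ← Real.rpow_natCast, ← Real.rpow_mul (by positivity),
      Real.div_rpow (by positivity) hr0.le, Real.rpow_neg hr0.le, div_eq_mul_inv]
    norm_num
  set N : ℝ := A * r ^ (-(3 / 2 : ℝ)) with hN
  have hN0 : 0 < N := by positivity
  -- Both `N` and `R³` carry a factor `r^{-3/2}`, which cancels the `r³` of the ball: the mass does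
  -- not depend on `r`.
  have hr3 : r ^ (-(3 / 2 : ℝ)) * r ^ (-(3 / 2 : ℝ)) * r ^ 3 = 1 := by
    rw [← Real.rpow_add hr0, ← Real.rpow_natCast, ← Real.rpow_add hr0]
    norm_num
  have hmassN : N * (unitVol * r ^ 3 * R ^ 3) = M := by
    rw [hN, hR3, hA]
    calc _ = M * (r ^ (-(3 / 2 : ℝ)) * r ^ (-(3 / 2 : ℝ)) * r ^ 3) := by field_simp
      _ = M := by rw [hr3, mul_one]
  set S : Set Phase := Metric.ball (0 : Space) r ×ˢ Metric.ball (0 : Space) R with hS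
  have hSm : MeasurableSet S := measurableSet_ball.prod measurableSet_ball
  have hSv : volume S = ENNReal.ofReal (unitVol * r ^ 3 * R ^ 3) := volume_prod_ball hr0.le hR0.le
  have hSr : volume.real S = unitVol * r ^ 3 * R ^ 3 := by
    rw [Measure.real, hSv, ENNReal.toReal_ofReal (by positivity)]
  have hs : IsSymmDensity (S.indicator fun _ => N) :=
    isSymmDensity_indicator hSm (by rw [hSv]; exact ENNReal.ofReal_ne_top)
      (fun A _ => Eventually.of_forall fun z => by simp [hS]) hN0.le
  have hconst : ∀ k : ℝ, Integrable (S.indicator fun _ => k) ∧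
      ∫ z, S.indicator (fun _ => k) z = k * (unitVol * r ^ 3 * R ^ 3) := fun k =>
    ⟨(integrable_indicator_iff hSm).2 (integrableOn_const (by rw [hSv]; exact ENNReal.ofReal_ne_top)),
      by rw [integral_indicator hSm, setIntegral_const, hSr, smul_eq_mul, mul_comm]⟩
  have hle : ∀ z, Q (S.indicator (fun _ => N) z) (angMom z) ≤
      S.indicator (fun _ => c₂ * N ^ (1 + 1 / μ₂)) z := by
    intro z
    by_cases h : z ∈ S
    · rw [indicator_of_mem h, indicator_of_mem h]
      exact h2 N _ hN0.le hr1.le (angMom_nonneg z)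
    · rw [indicator_of_notMem h, indicator_of_notMem h, hQ.zero (angMom_nonneg z)]
  have hkle : ∀ z : Phase, ‖z.2‖ ^ 2 * S.indicator (fun _ => N) z ≤
      S.indicator (fun _ => R ^ 2 * N) z := by
    intro z
    by_cases h : z ∈ S
    · rw [indicator_of_mem h, indicator_of_mem h]
      have : ‖z.2‖ < R := by simpa using h.2
      gcongr
    · rw [indicator_of_notMem h, indicator_of_notMem h, mul_zero]
  have hk : Integrable fun z : Phase => ‖z.2‖ ^ 2 * S.indicator (fun _ => N) z := by
    refine (hconst (R ^ 2 * N)).1.mono' ?_ (Eventually.of_forall fun z => ?_)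
    · exact (by fun_prop : Continuous fun z : Phase => ‖z.2‖ ^ 2).aestronglyMeasurable.mul
        hs.integrable.1
    · rw [Real.norm_of_nonneg (mul_nonneg (sq_nonneg _) (indicator_nonneg (fun _ _ => hN0.le) z))]
      exact hkle z
  have hf := HasFiniteJ.of_bounds hQ hs (hconst _).1 (Eventually.of_forall hle) hk
  refine ⟨_, hf, by rw [(hconst N).2, hmassN], ?_⟩
  have i1 := integral_mono (hf.integrable_Q hQ) (hconst _).1 hle
  have i2 := integral_mono hf.integrable_kinetic (hconst _).1 hkle
  rw [(hconst _).2] at i1 i2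
  have i3 : M ^ 2 / r ≤ ∫ s in Ioi (0 : ℝ), massIn (S.indicator fun _ => N) s ^ 2 / s ^ 2 := by
    have e : ∫ s in Ioi r, M ^ 2 * s ^ (-2 : ℝ) = M ^ 2 / r := by
      rw [integral_const_mul, integral_Ioi_rpow_of_lt (by norm_num) hr0]
      norm_num [Real.rpow_neg_one, div_eq_mul_inv]
    rw [← e]
    have hint : IntegrableOn (fun s => massIn (S.indicator fun _ => N) s ^ 2 / s ^ 2) (Ioi 0) := by
      simpa only [sq] using hf.integrableOn_massIn_mul hQ hf
    refine le_trans ?_ (setIntegral_mono_set hint (Eventually.of_forall fun s => by positivity)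
      (Eventually.of_forall (Ioi_subset_Ioi hr0.le)))
    refine setIntegral_mono_on ((integrableOn_Ioi_rpow_of_lt (by norm_num) hr0).const_mul _)
      (hint.mono_set (Ioi_subset_Ioi hr0.le)) measurableSet_Ioi fun s hs' => ?_
    have hs0 : 0 < s := hr0.trans hs'
    have em : massIn (S.indicator fun _ => N) s = M := by
      rw [← hmassN, ← (hconst N).2, massIn]
      refine setIntegral_eq_integral_of_forall_compl_eq_zero fun z hz => ?_
      refine indicator_of_notMem (fun h => hz ?_) _
      have : ‖z.1‖ < r := by simpa using h.1
      exact this.trans hs'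
    rw [em, Real.rpow_neg hs0.le, div_eq_mul_inv]
    norm_num
  rw [energyCasimir_eq hs, hf.Jreal_eq hQ, potEnergy]
  have e1 : c₂ * N ^ (1 + 1 / μ₂) * (unitVol * r ^ 3 * R ^ 3) = c₂ * M * N ^ (1 / μ₂) := by
    rw [Real.rpow_add hN0, Real.rpow_one, ← hmassN]; ring
  have e2 : R ^ 2 * N * (unitVol * r ^ 3 * R ^ 3) = M / 2 / r * M := by
    rw [hR2, mul_assoc, hmassN]
  have e3 : c₂ * M * N ^ (1 / μ₂) = c₂ * M * A ^ (1 / μ₂) * r ^ (-(3 / 2 / μ₂ - 1)) / r := by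
    rw [hN, Real.mul_rpow hA0.le (by positivity), ← Real.rpow_mul hr0.le, ← mul_assoc, mul_div_assoc]
    congr 1
    rw [eq_div_iff hr0.ne']
    nth_rewrite 2 [← Real.rpow_one r]
    rw [← Real.rpow_add hr0]
    congr 1
    ring
  rw [e1, e3] at i1
  rw [e2] at i2
  have e4 : c₂ * M * A ^ (1 / μ₂) * r ^ (-(3 / 2 / μ₂ - 1)) / r < M ^ 2 / 4 / r := by gcongr
  have e5 : M / 2 / r * M = 2 * (M ^ 2 / 4 / r) := by ring
  have e6 : M ^ 2 / r = 4 * (M ^ 2 / 4 / r) := by ring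
  linarith

end VlasovPoisson
end

noncomputable section

namespace VlasovPoisson

/-! ### Two compactness principles -/

/-- Helly's selection theorem. -/
theorem exists_subseq_tendsto_of_monotone {m : ℕ → ℝ → ℝ} (hm : ∀ n, Monotone (m n)) {M : ℝ}
    (hM : ∀ n r, m n r ∈ Icc 0 M) :
    ∃ φ : ℕ → ℕ, StrictMono φ ∧ ∀ᵐ r : ℝ, ∃ l, Tendsto (fun n => m (φ n) r) atTop (𝓝 l) := by
  have hK : IsCompact (univ.pi fun _ : ℚ => Icc (0 : ℝ) M) :=
    isCompact_univ_pi fun _ => isCompact_Icc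
  obtain ⟨l, hl, φ, hφ, hlim⟩ := hK.tendsto_subseq
    (x := fun n (q : ℚ) => m n q) (fun n => fun q _ => hM n q)
  refine ⟨φ, hφ, ?_⟩
  have hlq : ∀ q : ℚ, Tendsto (fun n => m (φ n) q) atTop (𝓝 (l q)) := fun q =>
    (tendsto_pi_nhds.1 hlim) q
  have hlM : ∀ q, l q ≤ M := fun q => (hl q (mem_univ q)).2
  -- The limits along rationals extend to a monotone function. At each of its continuity points,
  -- hence off a countable set, monotonicity squeezes the original sequence to its value.
  set G : ℝ → ℝ := fun r => ⨆ q : {q : ℚ // (q : ℝ) < r}, l q with hG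
  have hne : ∀ r : ℝ, Nonempty {q : ℚ // (q : ℝ) < r} := fun r =>
    let ⟨q, hq⟩ := exists_rat_lt r; ⟨⟨q, hq⟩⟩
  have hbdd : ∀ r : ℝ, BddAbove (range fun q : {q : ℚ // (q : ℝ) < r} => l q) := fun r =>
    ⟨M, by rintro _ ⟨q, rfl⟩; exact hlM q⟩
  have hGmono : Monotone G := by
    intro r s hrs
    have := hne r
    exact ciSup_le fun q => le_ciSup (hbdd s) ⟨q.1, q.2.trans_le hrs⟩
  have hcount : (volume : Measure ℝ) {r | ¬ ContinuousAt G r} = 0 :=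
    hGmono.countable_not_continuousAt.measure_zero volume
  have hae : ∀ᵐ r : ℝ, ContinuousAt G r := hcount
  filter_upwards [hae] with r hr
  refine ⟨G r, tendsto_order.2 ⟨fun a ha => ?_, fun b hb => ?_⟩⟩
  · have := hne r
    obtain ⟨q, hq⟩ := exists_lt_of_lt_ciSup ha
    filter_upwards [(hlq q).eventually (lt_mem_nhds hq)] with n hn
    exact hn.trans_le (hm _ q.2.le)
  · have h1 : ∀ᶠ s in 𝓝[>] r, G s < b := (hr.eventually (gt_mem_nhds hb)).filter_mono nhdsWithin_le_nhds
    obtain ⟨s, hs, hrs⟩ := (h1.and self_mem_nhdsWithin).exists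
    obtain ⟨q, hq1, hq2⟩ := exists_rat_btwn (show r < s from hrs)
    have h2 : l q < b := (le_ciSup (hbdd s) ⟨q, hq2⟩).trans_lt hs
    filter_upwards [(hlq q).eventually (gt_mem_nhds h2)] with n hn
    exact (hm _ hq1.le).trans_lt hn

/-- The midpoint defect in the convexity of `exp(-·)` is a perfect square, so near-minimizers of `∫
exp(-g)` over a convex set are close to each other. -/
theorem sq_exp_sub (a b : ℝ) : (Real.exp (-a / 2) - Real.exp (-b / 2)) ^ 2 =
    Real.exp (-a) + Real.exp (-b) - 2 * Real.exp (-((a + b) / 2)) := by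
  have h1 : Real.exp (-a) = Real.exp (-a / 2) ^ 2 := by rw [← Real.exp_nat_mul]; congr 1; push_cast; ring
  have h2 : Real.exp (-b) = Real.exp (-b / 2) ^ 2 := by rw [← Real.exp_nat_mul]; congr 1; push_cast; ring
  have h3 : Real.exp (-((a + b) / 2)) = Real.exp (-a / 2) * Real.exp (-b / 2) := by
    rw [← Real.exp_add]; congr 1; ring
  rw [h1, h2, h3]
  ring

/-- A decreasing sequence of nonempty midpoint convex sets of nonnegative functions with bounded
integrals contains an almost everywhere convergent selection. -/
theorem exists_selection_tendsto_ae {α : Type*} [MeasurableSpace α] {μ : Measure α} [SFinite μ]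
    {C : ℕ → Set (α → ℝ)}
    (hanti : Antitone C) (hne : ∀ n, (C n).Nonempty)
    (hmid : ∀ n, ∀ g ∈ C n, ∀ h ∈ C n, (fun z => (g z + h z) / 2) ∈ C n)
    (hmeas : ∀ n, ∀ g ∈ C n, AEStronglyMeasurable g μ) (hnn : ∀ n, ∀ g ∈ C n, ∀ᵐ z ∂μ, 0 ≤ g z)
    {M : ENNReal} (hM : M ≠ ⊤) (hint : ∀ n, ∀ g ∈ C n, ∫⁻ z, ENNReal.ofReal (g z) ∂μ ≤ M) :
    ∃ (h : ℕ → α → ℝ) (φ : ℕ → ℕ) (F : α → ℝ), StrictMono φ ∧ (∀ n, h n ∈ C (φ n)) ∧ Measurable F ∧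
      ∀ᵐ z ∂μ, Tendsto (fun n => h n z) atTop (𝓝 (F z)) := by
  -- Passing to a finite measure with the same null sets makes `exp(-g)` integrable.
  set ν := μ.toFinite with hν
  have haeν : ae ν = ae μ := ae_toFinite
  have hac : ν ≪ μ := toFinite_absolutelyContinuous μ
  have hbd : ∀ n, ∀ g ∈ C n, Integrable (fun z => Real.exp (-g z)) ν ∧
      (∀ᵐ z ∂ν, 0 ≤ g z) := by
    intro n g hg
    have hnn' : ∀ᵐ z ∂ν, 0 ≤ g z := hac.ae_le (hnn n g hg)
    refine ⟨Integrable.of_bound (C := 1) ?_ ?_, hnn'⟩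
    · exact Real.continuous_exp.comp_aestronglyMeasurable ((hmeas n g hg).mono_ac hac).neg
    · filter_upwards [hnn'] with z hz
      rw [Real.norm_of_nonneg (Real.exp_pos _).le]
      exact Real.exp_le_one_iff.2 (by linarith)
  set I : (α → ℝ) → ℝ := fun g => ∫ z, Real.exp (-g z) ∂ν with hI
  have hI0 : ∀ g, 0 ≤ I g := fun g => integral_nonneg fun z => (Real.exp_pos _).le
  have hI1 : ∀ n, ∀ g ∈ C n, I g ≤ ν.real univ := by
    intro n g hg
    have : I g ≤ ∫ _, (1 : ℝ) ∂ν := by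
      refine integral_mono_ae (hbd n g hg).1 (integrable_const 1) ?_
      filter_upwards [(hbd n g hg).2] with z hz
      exact Real.exp_le_one_iff.2 (by linarith)
    simpa using this
  have hbdd : ∀ n, BddBelow (I '' C n) := fun n => ⟨0, by rintro _ ⟨g, -, rfl⟩; exact hI0 g⟩
  -- The sets shrink, so the infima increase; they are bounded, and the selection consists of
  -- near-minimizers.
  set v : ℕ → ℝ := fun n => sInf (I '' C n) with hv
  have hvmono : Monotone v := fun n k hnk =>
    csInf_le_csInf (hbdd n) ((hne k).image I) (image_mono (hanti hnk))
  have hvbdd : BddAbove (range v) := by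
    refine ⟨ν.real univ, ?_⟩
    rintro _ ⟨n, rfl⟩
    obtain ⟨g, hg⟩ := hne n
    exact (csInf_le (hbdd n) ⟨g, hg, rfl⟩).trans (hI1 n g hg)
  have hvlim := tendsto_atTop_ciSup hvmono hvbdd
  set V := ⨆ n, v n with hV
  have hvV : ∀ n, v n ≤ V := fun n => le_ciSup hvbdd n
  have hchoose : ∀ n : ℕ, ∃ g ∈ C n, I g ≤ v n + 1 / (n + 1 : ℝ) := by
    intro n
    obtain ⟨_, ⟨g, hg, rfl⟩, hlt⟩ := exists_lt_of_csInf_lt ((hne n).image I)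
      (lt_add_of_pos_right (v n) (Nat.one_div_pos_of_nat (n := n)))
    exact ⟨g, hg, hlt.le⟩
  choose g hgC hgI using hchoose
  -- The midpoint of `g n` and `g k` lies in `C n`, so its functional is at least `v n`; the
  -- convexity defect then bounds the squared distance of `exp(-g n/2)` and `exp(-g k/2)`.
  have hcau : ∀ n k, n ≤ k → ∫ z, (Real.exp (-g n z / 2) - Real.exp (-g k z / 2)) ^ 2 ∂ν ≤
      (V - v n) + 2 / (n + 1 : ℝ) := by
    intro n k hnk
    have hgk : g k ∈ C n := hanti hnk (hgC k)
    have hmidC := hmid n _ (hgC n) _ hgk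
    have e : ∫ z, (Real.exp (-g n z / 2) - Real.exp (-g k z / 2)) ^ 2 ∂ν =
        I (g n) + I (g k) - 2 * I (fun z => (g n z + g k z) / 2) := by
      simp only [hI, sq_exp_sub]
      have i1 := (hbd n _ (hgC n)).1
      have i2 := (hbd n _ hgk).1
      have i3 := (hbd n _ hmidC).1
      have j1 := integral_sub (i1.add i2) (i3.const_mul 2)
      have j2 := integral_add i1 i2
      simp only [Pi.add_apply] at j1 j2
      rw [integral_const_mul, j2] at j1
      exact j1
    have h1 : v n ≤ I (fun z => (g n z + g k z) / 2) := csInf_le (hbdd n) ⟨_, hmidC, rfl⟩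
    have h2 := hgI n
    have h3 := hgI k
    have h4 := hvV k
    have h5 : 1 / (k + 1 : ℝ) ≤ 1 / (n + 1 : ℝ) := by gcongr
    have h6 : 2 / (n + 1 : ℝ) = 1 / (n + 1 : ℝ) + 1 / (n + 1 : ℝ) := by ring
    rw [e]
    linarith
  have hsmall : Tendsto (fun n : ℕ => (V - v n) + 2 / (n + 1 : ℝ)) atTop (𝓝 0) := by
    have h1 : Tendsto (fun n : ℕ => V - v n) atTop (𝓝 (V - V)) := hvlim.const_sub V
    have h2 : Tendsto (fun n : ℕ => 2 * (1 / ((n : ℝ) + 1))) atTop (𝓝 (2 * 0)) :=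
      tendsto_one_div_add_atTop_nhds_zero_nat.const_mul 2
    have h3 := h1.add h2
    simp only [sub_self, mul_zero, add_zero] at h3
    refine h3.congr fun n => ?_
    ring
  -- Cauchy in `L²` at a summable rate gives convergence almost everywhere.
  set B : ℕ → ℝ := fun N => (1 / 2) ^ N with hB
  have hBpos : ∀ N, 0 < B N := fun N => by positivity
  obtain ⟨φ, hφ, hφB⟩ := extraction_forall_of_eventually
    (P := fun N n => (V - v n) + 2 / (n + 1 : ℝ) < B N ^ 2) fun N => by
      obtain ⟨n₀, h⟩ := eventually_atTop.1
        (hsmall.eventually (gt_mem_nhds (pow_pos (hBpos N) 2)))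
      exact eventually_atTop.2 ⟨n₀, h⟩
  have hae1 : ∀ᵐ z ∂ν, ∃ l, Tendsto (fun n => Real.exp (-g (φ n) z / 2)) atTop (𝓝 l) := by
    have hm : ∀ n, AEStronglyMeasurable (fun z => Real.exp (-g (φ n) z / 2)) ν := fun n =>
      (Real.continuous_exp.comp (by fun_prop : Continuous fun x : ℝ => -x / 2)).comp_aestronglyMeasurable
        ((hmeas _ _ (hgC (φ n))).mono_ac hac)
    refine Lp.ae_tendsto_of_cauchy_eLpNorm (p := 2) hm (by norm_num)
      (B := fun N => ENNReal.ofReal (B N)) ?_ ?_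
    · have hs : Summable B := summable_geometric_two
      exact hs.tsum_ofReal_ne_top
    · have key : ∀ N n k : ℕ, N ≤ n → n ≤ k → eLpNorm ((fun z => Real.exp (-g (φ n) z / 2)) -
          fun z => Real.exp (-g (φ k) z / 2)) 2 ν < ENNReal.ofReal (B N) := by
        intro N n k hNn hnk
        have hmem : MemLp ((fun z => Real.exp (-g (φ n) z / 2)) -
            fun z => Real.exp (-g (φ k) z / 2)) 2 ν := by
          refine MemLp.of_bound ((hm n).sub (hm k)) 2 ?_
          filter_upwards [(hbd _ _ (hgC (φ n))).2, (hbd _ _ (hgC (φ k))).2] with z h1 h2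
          have e1 : Real.exp (-g (φ n) z / 2) ≤ 1 := Real.exp_le_one_iff.2 (by linarith)
          have e2 : Real.exp (-g (φ k) z / 2) ≤ 1 := Real.exp_le_one_iff.2 (by linarith)
          have e3 := Real.exp_pos (-g (φ n) z / 2)
          have e4 := Real.exp_pos (-g (φ k) z / 2)
          rw [Real.norm_eq_abs, abs_le]
          simp only [Pi.sub_apply]
          constructor <;> linarith
        rw [hmem.eLpNorm_eq_integral_rpow_norm (by norm_num) (by norm_num)]
        refine (ENNReal.ofReal_lt_ofReal_iff (hBpos N)).2 ?_
        have h1 := (hcau (φ n) (φ k) (hφ.monotone hnk)).trans_lt (hφB n)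
        have h2 : B n ≤ B N := pow_le_pow_of_le_one (by norm_num) (by norm_num) hNn
        simp only [Pi.sub_apply, Real.norm_eq_abs]
        norm_num
        rw [← Real.sqrt_eq_rpow, Real.sqrt_lt' (hBpos N)]
        refine lt_of_lt_of_le ?_ (pow_le_pow_left₀ (hBpos n).le h2 2)
        simpa only [neg_div] using h1
      intro N n k hn hk
      rcases le_total n k with h | h
      · exact key N n k hn h
      · rw [eLpNorm_sub_comm]
        exact key N k n hk h
  rw [haeν] at hae1
  -- Convergence of `exp(-g/2)` to `0` would mean that `g` diverges to infinity. Fatou and the bound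
  -- on the integrals exclude this almost everywhere.
  have hfin : ∀ᵐ z ∂μ, liminf (fun n => ENNReal.ofReal (g (φ n) z)) atTop < ⊤ := by
    have hm : ∀ n, AEMeasurable (fun z => ENNReal.ofReal (g (φ n) z)) μ := fun n =>
      (hmeas _ _ (hgC (φ n))).aemeasurable.ennreal_ofReal
    have hmk : AEMeasurable (fun z => liminf (fun n => ENNReal.ofReal (g (φ n) z)) atTop) μ := by
      refine ⟨_, Measurable.liminf fun n => (hm n).measurable_mk, ?_⟩
      filter_upwards [ae_all_iff.2 fun n => (hm n).ae_eq_mk] with z hz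
      simp only [hz]
    refine ae_lt_top' hmk ?_
    refine ne_top_of_le_ne_top hM ((lintegral_liminf_le' hm).trans ?_)
    exact liminf_le_of_le (by isBoundedDefault) fun b hb =>
      let ⟨n, hn⟩ := hb.exists; hn.trans (hint _ _ (hgC (φ n)))
  have hlim : ∀ᵐ z ∂μ, ∃ l, Tendsto (fun n => g (φ n) z) atTop (𝓝 l) := by
    filter_upwards [hae1, hfin] with z hz1 hz2
    obtain ⟨l, hl⟩ := hz1
    have hl0 : 0 ≤ l := ge_of_tendsto' hl fun n => (Real.exp_pos _).le
    rcases hl0.eq_or_lt with rfl | hlpos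
    · exfalso
      have h1 : Tendsto (fun n => Real.log (Real.exp (-g (φ n) z / 2))) atTop atBot :=
        Real.tendsto_log_nhdsGT_zero.comp (tendsto_nhdsWithin_iff.2
          ⟨hl, Eventually.of_forall fun n => Real.exp_pos _⟩)
      simp only [Real.log_exp] at h1
      have h2 : Tendsto (fun n => g (φ n) z) atTop atTop := by
        have h3 := h1.const_mul_atBot_of_neg (by norm_num : (-2 : ℝ) < 0)
        refine h3.congr fun n => ?_
        ring
      have h4 := (ENNReal.tendsto_ofReal_atTop.comp h2).liminf_eq
      simp only [Function.comp_def] at h4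
      rw [h4] at hz2
      exact lt_irrefl _ hz2
    · refine ⟨-2 * Real.log l, ?_⟩
      have h1 := (hl.log hlpos.ne').const_mul (-2)
      simp only [Real.log_exp] at h1
      refine h1.congr fun n => ?_
      ring
  obtain ⟨F, hF, hFlim⟩ := measurable_limit_of_tendsto_metrizable_ae
    (fun n => (hmeas _ _ (hgC (φ n))).aemeasurable) hlim
  exact ⟨fun n => g (φ n), φ, F, hφ, fun n => hgC (φ n), hF, hFlim⟩

end VlasovPoisson
end

noncomputable section

namespace VlasovPoisson

variable {Q : ℝ → ℝ → ℝ} {f g : Phase → ℝ}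

/-! ### Convex combinations -/

theorem IsSymmDensity.convexCombo (hf : IsSymmDensity f) (hg : IsSymmDensity g) {t : ℝ} (ht0 : 0 ≤ t)
    (ht1 : t ≤ 1) : IsSymmDensity (fun z => (1 - t) * f z + t * g z) := by
  refine ⟨(hf.integrable.const_mul _).add (hg.integrable.const_mul _), ?_, fun A hA => ?_⟩
  · filter_upwards [hf.nonneg, hg.nonneg] with z h1 h2
    exact add_nonneg (mul_nonneg (by linarith) h1) (mul_nonneg ht0 h2)
  · filter_upwards [hf.symm A hA, hg.symm A hA] with z h1 h2
    rw [h1, h2]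

theorem massIn_convexCombo (hf : Integrable f) (hg : Integrable g) (t r : ℝ) :
    massIn (fun z => (1 - t) * f z + t * g z) r = (1 - t) * massIn f r + t * massIn g r := by
  rw [massIn_add (hf.const_mul _) (hg.const_mul _), massIn_const_mul, massIn_const_mul]

theorem integral_convexCombo (hf : Integrable f) (hg : Integrable g) (t : ℝ) :
    ∫ z, ((1 - t) * f z + t * g z) = (1 - t) * (∫ z, f z) + t * ∫ z, g z := by
  rw [integral_add (hf.const_mul _) (hg.const_mul _), integral_const_mul, integral_const_mul]

theorem HasFiniteJ.convexCombo (hQ : Admissible Q) (hf : HasFiniteJ Q f) (hg : HasFiniteJ Q g)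
    {t : ℝ} (ht0 : 0 ≤ t) (ht1 : t ≤ 1) :
    HasFiniteJ Q (fun z => (1 - t) * f z + t * g z) ∧
      Jreal Q (fun z => (1 - t) * f z + t * g z) ≤ (1 - t) * Jreal Q f + t * Jreal Q g := by
  have hs := hf.toIsSymmDensity.convexCombo hg.toIsSymmDensity ht0 ht1
  have hI : Integrable fun z => (1 - t) * Q (f z) (angMom z) + t * Q (g z) (angMom z) :=
    ((hf.integrable_Q hQ).const_mul _).add ((hg.integrable_Q hQ).const_mul _)
  have hle : ∀ᵐ z, Q ((1 - t) * f z + t * g z) (angMom z) ≤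
      (1 - t) * Q (f z) (angMom z) + t * Q (g z) (angMom z) := by
    filter_upwards [hf.nonneg, hg.nonneg] with z h1 h2
    exact hQ.convex h1 h2 ht0 ht1 (angMom_nonneg z)
  have ek : (fun z : Phase => ‖z.2‖ ^ 2 * ((1 - t) * f z + t * g z)) =
      fun z => (1 - t) * (‖z.2‖ ^ 2 * f z) + t * (‖z.2‖ ^ 2 * g z) := by
    ext z; ring
  have hk : Integrable fun z : Phase => ‖z.2‖ ^ 2 * ((1 - t) * f z + t * g z) := by
    rw [ek]
    exact (hf.integrable_kinetic.const_mul _).add (hg.integrable_kinetic.const_mul _)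
  have hF := HasFiniteJ.of_bounds hQ hs hI hle hk
  refine ⟨hF, ?_⟩
  have h1 := integral_mono_ae (hF.integrable_Q hQ) hI hle
  rw [integral_add ((hf.integrable_Q hQ).const_mul _) ((hg.integrable_Q hQ).const_mul _),
    integral_const_mul, integral_const_mul] at h1
  rw [hF.Jreal_eq hQ, hf.Jreal_eq hQ, hg.Jreal_eq hQ, ek,
    integral_add (hf.integrable_kinetic.const_mul _) (hg.integrable_kinetic.const_mul _),
    integral_const_mul, integral_const_mul]
  linarith

/-! ### Limits of densities -/

theorem J_eq_lintegral (hQ : Admissible Q) (hf : AEStronglyMeasurable f) (hnn : ∀ᵐ z, 0 ≤ f z) :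
    J Q f = ∫⁻ z : Phase, (ENNReal.ofReal (Q (f z) (angMom z)) +
      ENNReal.ofReal (1 / 2) * ENNReal.ofReal (‖z.2‖ ^ 2 * f z)) := by
  have hk : AEMeasurable (fun z : Phase => ‖z.2‖ ^ 2 * f z) :=
    ((by fun_prop : Continuous fun z : Phase => ‖z.2‖ ^ 2).aestronglyMeasurable.mul hf).aemeasurable
  rw [lintegral_add_left'
    (hQ.regular.aestronglyMeasurable hf hnn).aemeasurable.ennreal_ofReal,
    lintegral_const_mul'' _ hk.ennreal_ofReal, J]

/-- Fatou's lemma, with `Q(·,L)` continuous up to `0`. -/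
theorem J_le_of_tendsto (hQ : Admissible Q) {h : ℕ → Phase → ℝ}
    (hm : ∀ n, AEStronglyMeasurable (h n)) (hnn : ∀ n, ∀ᵐ z, 0 ≤ h n z)
    (hf : AEStronglyMeasurable f)
    (hlim : ∀ᵐ z, Tendsto (fun n => h n z) atTop (𝓝 (f z))) {c : ENNReal}
    (hc : ∀ᶠ n in atTop, J Q (h n) ≤ c) : J Q f ≤ c := by
  have hfnn : ∀ᵐ z, 0 ≤ f z := by
    filter_upwards [hlim, ae_all_iff.2 hnn] with z h1 h2
    exact ge_of_tendsto' h1 h2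
  rw [J_eq_lintegral hQ hf hfnn]
  have hme : ∀ n, AEMeasurable (fun z : Phase => ENNReal.ofReal (Q (h n z) (angMom z)) +
      ENNReal.ofReal (1 / 2) * ENNReal.ofReal (‖z.2‖ ^ 2 * h n z)) := fun n =>
    (hQ.regular.aestronglyMeasurable (hm n) (hnn n)).aemeasurable.ennreal_ofReal.add
      (((by fun_prop : Continuous fun z : Phase => ‖z.2‖ ^ 2).aestronglyMeasurable.mul
        (hm n)).aemeasurable.ennreal_ofReal.const_mul _)
  have hpt : ∀ᵐ z : Phase, ENNReal.ofReal (Q (f z) (angMom z)) +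
      ENNReal.ofReal (1 / 2) * ENNReal.ofReal (‖z.2‖ ^ 2 * f z) =
      liminf (fun n => ENNReal.ofReal (Q (h n z) (angMom z)) +
        ENNReal.ofReal (1 / 2) * ENNReal.ofReal (‖z.2‖ ^ 2 * h n z)) atTop := by
    filter_upwards [hlim, ae_all_iff.2 hnn, hfnn] with z h1 h2 h3
    refine (Tendsto.liminf_eq ?_).symm
    refine Tendsto.add ?_ (ENNReal.Tendsto.const_mul ?_ (Or.inr ENNReal.ofReal_ne_top))
    · refine ENNReal.tendsto_ofReal ?_
      have hcw : ContinuousWithinAt (fun s => Q s (angMom z)) (Ici 0) (f z) :=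
        hQ.regular.continuousOn_Q (angMom_nonneg z) _ h3
      exact hcw.tendsto.comp (tendsto_nhdsWithin_iff.2 ⟨h1, Eventually.of_forall h2⟩)
    · exact ENNReal.tendsto_ofReal (h1.const_mul _)
  rw [lintegral_congr_ae hpt]
  refine (lintegral_liminf_le' hme).trans ?_
  refine liminf_le_of_le (by isBoundedDefault) fun b hb => ?_
  obtain ⟨n, hn1, hn2⟩ := (hb.and hc).exists
  refine hn1.trans ?_
  rw [← J_eq_lintegral hQ (hm n) (hnn n)]
  exact hn2

/-- Fatou gives one inequality. For the other, the bound on `J` makes the mass at high velocity or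
great height uniformly small, while the truncated densities converge by dominated convergence on a
set of finite volume. Over a bounded ball in space nothing else can be lost. -/
theorem massIn_eq_of_tendsto (hQ : Admissible Q) {h : ℕ → Phase → ℝ} (hh : ∀ n, HasFiniteJ Q (h n))
    {j : ℝ} (hj : ∀ n, Jreal Q (h n) ≤ j) (hf : Integrable f) (hnn : ∀ᵐ z, 0 ≤ f z)
    (hlim : ∀ᵐ z, Tendsto (fun n => h n z) atTop (𝓝 (f z))) {r l : ℝ}
    (hr : 0 < r) (hl : Tendsto (fun n => massIn (h n) r) atTop (𝓝 l)) : massIn f r = l := by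
  have hl0 : 0 ≤ l := ge_of_tendsto' hl fun n => massIn_nonneg (hh n).nonneg r
  refine le_antisymm ?_ ?_
  · rw [← ENNReal.ofReal_le_ofReal_iff hl0, ofReal_massIn hf hnn]
    have hpt : ∀ᵐ z : Phase, ENNReal.ofReal (f z) =
        liminf (fun n => ENNReal.ofReal (h n z)) atTop := by
      filter_upwards [hlim] with z hz
      exact (ENNReal.tendsto_ofReal hz).liminf_eq.symm
    rw [lintegral_congr_ae (ae_restrict_of_ae hpt)]
    refine (lintegral_liminf_le' fun n =>
      (hh n).integrable.1.aemeasurable.ennreal_ofReal.restrict).trans ?_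
    have h1 := (ENNReal.tendsto_ofReal hl).liminf_eq
    rw [← h1]
    refine le_of_eq ?_
    congr 1
    ext n
    rw [ofReal_massIn (hh n).integrable (hh n).nonneg]
  · obtain ⟨-, -, c, c₂, c₃, c₄, F, μ, μ₂, μ₃, hc, -, -, -, hF, hμ, -, -, h1, -⟩ := id hQ
    have hμ0 : 0 < μ := hμ.1
    -- A single cutoff `k` serves for both the velocity and the height.
    have key : ∀ k : ℝ, 1 ≤ k → F ≤ k →
        l ≤ 2 * j / k ^ 2 + j / (c * k ^ (1 / μ)) + massIn f r := by
      intro k hk hFk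
      have hk0 : 0 < k := by linarith
      set B := Metric.ball (0 : Space) r ×ˢ Metric.ball (0 : Space) k with hB
      have hBm : MeasurableSet B := measurableSet_ball.prod measurableSet_ball
      have hBfin : volume B ≠ ⊤ := by
        rw [hB, volume_prod_ball hr.le hk0.le]; exact ENNReal.ofReal_ne_top
      have hdom : Tendsto (fun n => ∫ z in B, min (h n z) k) atTop (𝓝 (∫ z in B, min (f z) k)) := by
        refine tendsto_integral_of_dominated_convergence (fun _ => k)
          (fun n => ((hh n).integrable.1.inf aestronglyMeasurable_const).restrict)
          (integrableOn_const hBfin) (fun n => ?_) ?_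
        · filter_upwards [ae_restrict_of_ae (hh n).nonneg] with z hz
          rw [Real.norm_of_nonneg (le_min hz hk0.le)]
          exact min_le_right _ _
        · filter_upwards [ae_restrict_of_ae hlim] with z hz
          exact hz.min tendsto_const_nhds
      have hle : ∫ z in B, min (f z) k ≤ massIn f r := by
        have hmin : Integrable fun z => min (f z) k := by
          refine hf.mono (hf.1.inf aestronglyMeasurable_const) ?_
          filter_upwards [hnn] with z hz
          rw [Real.norm_of_nonneg hz, Real.norm_of_nonneg (le_min hz hk0.le)]
          exact min_le_left _ _
        calc ∫ z in B, min (f z) k ≤ ∫ z in B, f z :=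
              setIntegral_mono hmin.integrableOn hf.integrableOn fun z => min_le_left _ _
          _ ≤ massIn f r := by
              refine setIntegral_mono_set hf.integrableOn (ae_restrict_of_ae hnn) ?_
              refine Eventually.of_forall fun z hz => ?_
              have : ‖z.1‖ < r := by simpa using hz.1
              exact this
      have hlim2 := hdom.const_add (2 * j / k ^ 2 + j / (c * k ^ (1 / μ)))
      refine (le_of_tendsto_of_tendsto' hl hlim2 fun n => ?_).trans (by linarith)
      refine (massIn_le_truncated hQ hc hμ0 hF h1 (hh n) hk0 hFk).trans ?_
      have := hj n
      gcongr
    have t1 : Tendsto (fun k : ℝ => 2 * j / k ^ 2) atTop (𝓝 0) :=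
      tendsto_const_nhds.div_atTop (tendsto_pow_atTop (by norm_num))
    have t2 : Tendsto (fun k : ℝ => j / (c * k ^ (1 / μ))) atTop (𝓝 0) :=
      tendsto_const_nhds.div_atTop ((tendsto_rpow_atTop (by positivity)).const_mul_atTop hc)
    have t3 := (t1.add t2).add_const (massIn f r)
    rw [add_zero, zero_add] at t3
    refine ge_of_tendsto t3 ?_
    filter_upwards [eventually_ge_atTop 1, eventually_ge_atTop F] with k h1 h2
    exact key k h1 h2

theorem tendsto_potEnergy {u : ℕ → ℝ → ℝ} {v : ℝ → ℝ} (hu : ∀ n, Measurable (u n)) {A b : ℝ}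
    (hb : 0 < b) (hbound : ∀ n r, 0 < r → |u n r| ≤ A * profile b r)
    (hlim : ∀ᵐ r : ℝ, 0 < r → Tendsto (fun n => u n r) atTop (𝓝 (v r))) :
    Tendsto (fun n => potEnergy (u n)) atTop (𝓝 (potEnergy v)) := by
  refine Tendsto.const_mul _ ?_
  refine tendsto_integral_of_dominated_convergence (fun r => A ^ 2 * (profile b r ^ 2 / r ^ 2))
    (fun n => ((hu n).pow_const 2 |>.div (by fun_prop)).aestronglyMeasurable)
    ((integrableOn_profile_sq hb).1.const_mul _) (fun n => ?_) ?_
  · filter_upwards [ae_restrict_mem measurableSet_Ioi] with r hr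
    have hr : 0 < r := hr
    rw [Real.norm_of_nonneg (by positivity), ← mul_div_assoc, ← mul_pow, ← sq_abs (u n r)]
    gcongr
    exact hbound n r hr
  · filter_upwards [ae_restrict_mem measurableSet_Ioi, ae_restrict_of_ae hlim] with r hr h
    exact ((h hr).pow 2).div_const _

/-! ### Compactness of minimizing sequences. -/

/-- Compactness of sequences of densities with convergent energies. -/
theorem exists_limit_of_tendsto_energy (hQ : Admissible Q) {M : ℝ} (hM : 0 < M)
    {f : ℕ → Phase → ℝ} (hf : ∀ n, HasFiniteJ Q (f n)) (hfM : ∀ n, ∫ z, f n z = M) {d : ℝ}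
    (hd : Tendsto (fun n => energyCasimir Q (f n)) atTop (𝓝 d)) :
    ∃ φ : ℕ → ℕ, StrictMono φ ∧ ∃ F, HasFiniteJ Q F ∧ ∫ z, F z ≤ M ∧ energyCasimir Q F ≤ d ∧
      Tendsto (fun n => potEnergy fun r => massIn (f (φ n)) r - massIn F r) atTop (𝓝 0) := by
  obtain ⟨CJ, hCJ⟩ := exists_Jreal_le hQ hM
  obtain ⟨D, hD⟩ := hd.bddAbove_range
  have hJ0 : ∀ n, Jreal Q (f n) ∈ Icc 0 (max 1 (2 * D + CJ)) := fun n =>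
    ⟨Jreal_nonneg, le_max_of_le_right ((hCJ _ (hf n) (hfM n).le).trans
      (by linarith [hD ⟨n, rfl⟩]))⟩
  set j := max 1 (2 * D + CJ) with hj
  have hj1 : 1 ≤ j := le_max_left _ _
  obtain ⟨Js, -, φ₁, hφ₁, hJlim⟩ := isCompact_Icc.tendsto_subseq hJ0
  obtain ⟨φ₂, hφ₂, hmlim⟩ := exists_subseq_tendsto_of_monotone
    (m := fun n => massIn (f (φ₁ n))) (fun n => massIn_mono (hf _).integrable (hf _).nonneg) (M := M)
    (fun n r => ⟨massIn_nonneg (hf _).nonneg r,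
      (massIn_le (hf _).integrable (hf _).nonneg r).trans (hfM _).le⟩)
  set φ := φ₁ ∘ φ₂ with hφ
  have hφm : StrictMono φ := hφ₁.comp hφ₂
  have hJlim' : Tendsto (fun n => Jreal Q (f (φ n))) atTop (𝓝 Js) := hJlim.comp hφ₂.tendsto_atTop
  -- These are the densities obeying every upper bound on `J` and every two-sided bound on the mass
  -- function that holds along the whole tail from `n`. As `J` is convex and the mass function
  -- linear, such sets are convex, and a selection from them inherits the limits of the tail.
  set C : ℕ → Set (Phase → ℝ) := fun n => {g | HasFiniteJ Q g ∧ ∫ z, g z = M ∧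
    (∀ c, (∀ k, n ≤ k → Jreal Q (f (φ k)) ≤ c) → Jreal Q g ≤ c) ∧
    (∀ r c, (∀ k, n ≤ k → massIn (f (φ k)) r ≤ c) → massIn g r ≤ c) ∧
    (∀ r c, (∀ k, n ≤ k → c ≤ massIn (f (φ k)) r) → c ≤ massIn g r)} with hC
  have hC1 : Antitone C := by
    intro n k hnk g hg
    exact ⟨hg.1, hg.2.1, fun c hc => hg.2.2.1 c fun i hi => hc i (hnk.trans hi),
      fun r c hc => hg.2.2.2.1 r c fun i hi => hc i (hnk.trans hi),
      fun r c hc => hg.2.2.2.2 r c fun i hi => hc i (hnk.trans hi)⟩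
  have hC2 : ∀ n, (C n).Nonempty := by
    exact fun n => ⟨f (φ n), hf _, hfM _, fun c hc => hc n le_rfl, fun r c hc => hc n le_rfl,
      fun r c hc => hc n le_rfl⟩
  have hC3 : ∀ n, ∀ g ∈ C n, ∀ h ∈ C n, (fun z => (g z + h z) / 2) ∈ C n := by
    rintro n g₁ ⟨hg1, hg2, hg3, hg4, hg5⟩ g₂ ⟨hk1, hk2, hk3, hk4, hk5⟩
    have e : (fun z => (g₁ z + g₂ z) / 2) = fun z => (1 - 1 / 2) * g₁ z + 1 / 2 * g₂ z := by
      ext z; ring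
    have hc := hg1.convexCombo hQ hk1 (t := 1 / 2) (by norm_num) (by norm_num)
    rw [e]
    refine ⟨hc.1, ?_, fun c h => hc.2.trans ?_, fun r c h => ?_, fun r c h => ?_⟩
    · rw [integral_convexCombo hg1.integrable hk1.integrable, hg2, hk2]; ring
    · linarith [hg3 c h, hk3 c h]
    · rw [massIn_convexCombo hg1.integrable hk1.integrable]
      linarith [hg4 r c h, hk4 r c h]
    · rw [massIn_convexCombo hg1.integrable hk1.integrable]
      linarith [hg5 r c h, hk5 r c h]
  have hC4 : ∀ n, ∀ g ∈ C n, ∫⁻ z, ENNReal.ofReal (g z) ≤ ENNReal.ofReal M := by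
    intro n g hg
    rw [← ofReal_integral_eq_lintegral_ofReal hg.1.integrable hg.1.nonneg, hg.2.1]
  obtain ⟨h, ψ, F, hψ, hhC, hFm, hhlim⟩ := exists_selection_tendsto_ae (μ := volume) (C := C)
    (M := ENNReal.ofReal M) hC1 hC2 hC3 (fun n g hg => hg.1.integrable.1)
    (fun n g hg => hg.1.nonneg) ENNReal.ofReal_ne_top hC4
  have hψt := hψ.tendsto_atTop
  have hhJ : ∀ n, HasFiniteJ Q (h n) := fun n => (hhC n).1
  have hFnn : ∀ᵐ z, 0 ≤ F z := by
    filter_upwards [hhlim, ae_all_iff.2 fun n => (hhJ n).nonneg] with z h1 h2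
    exact ge_of_tendsto' h1 h2
  have hFle : ∫⁻ z, ENNReal.ofReal (F z) ≤ ENNReal.ofReal M := by
    have hpt : ∀ᵐ z : Phase, ENNReal.ofReal (F z) =
        liminf (fun n => ENNReal.ofReal (h n z)) atTop := by
      filter_upwards [hhlim] with z hz
      exact (ENNReal.tendsto_ofReal hz).liminf_eq.symm
    rw [lintegral_congr_ae hpt]
    refine (lintegral_liminf_le' fun n => (hhJ n).integrable.1.aemeasurable.ennreal_ofReal).trans ?_
    refine liminf_le_of_le (by isBoundedDefault) fun b hb => ?_
    obtain ⟨n, hn⟩ := hb.exists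
    refine hn.trans ?_
    rw [← ofReal_integral_eq_lintegral_ofReal (hhJ n).integrable (hhJ n).nonneg, (hhC n).2.1]
  have hFint : Integrable F := by
    refine ⟨hFm.aestronglyMeasurable, ?_⟩
    rw [hasFiniteIntegral_iff_ofReal hFnn]
    exact hFle.trans_lt ENNReal.ofReal_lt_top
  have hFM : ∫ z, F z ≤ M := by
    rw [← ENNReal.ofReal_le_ofReal_iff hM.le, ofReal_integral_eq_lintegral_ofReal hFint hFnn]
    exact hFle
  have hFsymm : SphericallySymmetric F := by
    intro A hA
    have hq := (measurePreserving_isometry A).quasiMeasurePreserving.ae hhlim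
    filter_upwards [hhlim, hq, ae_all_iff.2 fun n => (hhJ n).symm A hA] with z h1 h2 h3
    refine tendsto_nhds_unique h2 (h1.congr fun n => (h3 n).symm)
  have hJle : ∀ c, Js < c → J Q F ≤ ENNReal.ofReal c := by
    intro c hc
    obtain ⟨n₀, hn₀⟩ := eventually_atTop.1 (hJlim'.eventually (gt_mem_nhds hc))
    refine J_le_of_tendsto hQ (fun n => (hhJ n).integrable.1) (fun n => (hhJ n).nonneg)
      hFm.aestronglyMeasurable hhlim ?_
    filter_upwards [hψt.eventually_ge_atTop n₀] with n hn
    have h1 := (hhC n).2.2.1 c fun k hk => (hn₀ k (hn.trans hk)).le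
    rw [← ENNReal.ofReal_toReal (hhJ n).J_lt_top.ne]
    exact ENNReal.ofReal_le_ofReal h1
  have hJs0 : 0 ≤ Js := ge_of_tendsto' hJlim' fun n => Jreal_nonneg
  have hFJ : HasFiniteJ Q F :=
    ⟨⟨hFint, hFnn, hFsymm⟩, (hJle (Js + 1) (by linarith)).trans_lt ENNReal.ofReal_lt_top⟩
  have hJF : Jreal Q F ≤ Js := by
    refine le_of_forall_gt_imp_ge_of_dense fun c hc => ?_
    exact ENNReal.toReal_le_of_le_ofReal (hJs0.trans hc.le) (hJle c hc)
  have hJsj : Js ≤ j := le_of_tendsto' hJlim' fun n => (hJ0 _).2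
  have hhj : ∀ n, Jreal Q (h n) ≤ j := fun n => (hhC n).2.2.1 j fun k _ => (hJ0 _).2
  -- The mass functions of the selected densities are pinched between bounds for tails of the
  -- original sequence, hence have the same limit; that limit is the mass function of `F`.
  have hmF : ∀ᵐ r : ℝ, 0 < r → Tendsto (fun n => massIn (f (φ n)) r) atTop (𝓝 (massIn F r)) := by
    filter_upwards [hmlim] with r hr hr0
    obtain ⟨l, hl⟩ := hr
    have hl : Tendsto (fun n => massIn (f (φ n)) r) atTop (𝓝 l) := hl
    have hhl : Tendsto (fun n => massIn (h n) r) atTop (𝓝 l) := by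
      refine tendsto_order.2 ⟨fun a ha => ?_, fun b hb => ?_⟩
      · obtain ⟨a', ha1, ha2⟩ := exists_between ha
        obtain ⟨n₀, hn₀⟩ := eventually_atTop.1 (hl.eventually (lt_mem_nhds ha2))
        filter_upwards [hψt.eventually_ge_atTop n₀] with n hn
        exact ha1.trans_le ((hhC n).2.2.2.2 r a' fun k hk => (hn₀ k (hn.trans hk)).le)
      · obtain ⟨b', hb1, hb2⟩ := exists_between hb
        obtain ⟨n₀, hn₀⟩ := eventually_atTop.1 (hl.eventually (gt_mem_nhds hb1))
        filter_upwards [hψt.eventually_ge_atTop n₀] with n hn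
        exact ((hhC n).2.2.2.1 r b' fun k hk => (hn₀ k (hn.trans hk)).le).trans_lt hb2
    rw [massIn_eq_of_tendsto hQ hhJ hhj hFint hFnn hhlim hr0 hhl]
    exact hl
  obtain ⟨κ, A, -, -, hA, hprof⟩ := exists_profile_bound hQ hM
  have hb : 0 < j ^ κ := by positivity
  have hpf : ∀ n r, 0 < r → massIn (f (φ n)) r ≤ A * profile (j ^ κ) r := fun n r hr =>
    hprof _ (hf _) (hfM _).le j hj1 (hJ0 _).2 r hr
  have hpF : ∀ r, 0 < r → massIn F r ≤ A * profile (j ^ κ) r := fun r hr =>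
    hprof _ hFJ hFM j hj1 (hJF.trans hJsj) r hr
  -- The potential energy sees only the mass function, so it converges along the original sequence
  -- although those densities themselves need not converge.
  have hpot1 : Tendsto (fun n => potEnergy (massIn (f (φ n)))) atTop (𝓝 (potEnergy (massIn F))) := by
    refine tendsto_potEnergy (A := A) (fun n => (continuous_massIn (hf _).integrable).measurable) hb
      (fun n r hr => ?_) hmF
    rw [abs_of_nonneg (massIn_nonneg (hf _).nonneg r)]
    exact hpf n r hr
  have hpot2 : Tendsto (fun n => potEnergy fun r => massIn (f (φ n)) r - massIn F r) atTop
      (𝓝 (potEnergy fun _ => 0)) := by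
    refine tendsto_potEnergy (A := A) (fun n => ((continuous_massIn (hf _).integrable).sub
      (continuous_massIn hFint)).measurable) hb (fun n r hr => ?_) ?_
    · have := massIn_nonneg (hf (φ n)).nonneg r
      have := massIn_nonneg hFnn r
      have := hpf n r hr
      have := hpF r hr
      rw [abs_le]
      constructor <;> linarith
    · filter_upwards [hmF] with r hr hr0
      have := (hr hr0).sub_const (massIn F r)
      rwa [sub_self] at this
  have hp0 : potEnergy (fun _ => 0) = 0 := by simp [potEnergy]
  rw [hp0] at hpot2
  refine ⟨φ, hφm, F, hFJ, hFM, ?_, hpot2⟩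
  -- In the limit `d` equals `Js` minus the potential energy of `F`, and `J(F) ≤ Js`.
  have hd1 := hJlim'.sub hpot1
  have hd2 : Tendsto (fun n => energyCasimir Q (f (φ n))) atTop (𝓝 d) := hd.comp hφm.tendsto_atTop
  have e : (fun n => Jreal Q (f (φ n)) - potEnergy (massIn (f (φ n)))) =
      fun n => energyCasimir Q (f (φ n)) := by
    ext n; rw [energyCasimir_eq (hf _).toIsSymmDensity]
  rw [e] at hd1
  have := tendsto_nhds_unique hd1 hd2
  rw [energyCasimir_eq hFJ.toIsSymmDensity]
  linarith

theorem massIn_eq_zero_of_integral_eq_zero (hf : Integrable f) (hnn : ∀ᵐ z, 0 ≤ f z)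
    (h : ∫ z, f z = 0) : massIn f = fun _ => 0 := by
  ext r
  exact le_antisymm ((massIn_le hf hnn r).trans h.le) (massIn_nonneg hnn r)

/-- Densities with almost minimal energy have a field close to that of the minimizer. -/
theorem exists_delta_potEnergy_lt (hQ : Admissible Q) {M : ℝ} (hM : 0 < M) {f₀ : Phase → ℝ}
    (hf₀ : IsUniqueMinimizer Q M f₀) {ε : ℝ} (hε : 0 < ε) :
    ∃ δ : ℝ, 0 < δ ∧ ∀ g, HasFiniteJ Q g → ∫ z, g z = M →
      energyCasimir Q g < energyCasimir Q f₀ + δ →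
      potEnergy (fun r => massIn g r - massIn f₀ r) < ε := by
  by_contra hcon
  push Not at hcon
  have h1 : ∀ n : ℕ, ∃ g, HasFiniteJ Q g ∧ ∫ z, g z = M ∧
      energyCasimir Q g < energyCasimir Q f₀ + 1 / (n + 1 : ℝ) ∧
      ε ≤ potEnergy (fun r => massIn g r - massIn f₀ r) := fun n =>
    hcon _ Nat.one_div_pos_of_nat
  choose g hg hgM hgD hgε using h1
  have hmin : ∀ g, HasFiniteJ Q g → ∫ z, g z = M → energyCasimir Q f₀ ≤ energyCasimir Q g :=
    fun g hg hgM => hf₀.1.2 (mem_admissibleSet_iff.2 ⟨hg, hgM⟩)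
  have hD : Tendsto (fun n => energyCasimir Q (g n)) atTop (𝓝 (energyCasimir Q f₀)) := by
    refine tendsto_of_tendsto_of_tendsto_of_le_of_le tendsto_const_nhds ?_
      (fun n => hmin _ (hg n) (hgM n)) (fun n => (hgD n).le)
    simpa using tendsto_one_div_add_atTop_nhds_zero_nat.const_add (energyCasimir Q f₀)
  obtain ⟨φ, -, F, hF, hFM, hFD, hlim⟩ := exists_limit_of_tendsto_energy hQ hM hg hgM hD
  obtain ⟨k, hk, hkM, hkneg⟩ := exists_energyCasimir_neg hQ hM
  have hneg : energyCasimir Q f₀ < 0 := (hmin k hk hkM).trans_lt hkneg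
  -- Mass could be lost only at spatial infinity. A zero limit has energy `J ≥ 0`, above the
  -- negative minimum. A limit of intermediate mass, rescaled to mass `M`, would have its negative
  -- energy multiplied by a factor above one and so lie below the minimum.
  have hFM' : ∫ z, F z = M := by
    by_contra hne
    have hlt : ∫ z, F z < M := lt_of_le_of_ne hFM hne
    rcases (integral_nonneg_of_ae hF.nonneg).eq_or_lt with h0 | h0
    · have h2 := massIn_eq_zero_of_integral_eq_zero hF.integrable hF.nonneg h0.symm
      have h3 : 0 ≤ Jreal Q F := Jreal_nonneg
      rw [energyCasimir_eq hF.toIsSymmDensity, h2] at hFD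
      have hp0 : potEnergy (fun _ => 0) = 0 := by simp [potEnergy]
      rw [hp0] at hFD
      linarith
    · obtain ⟨k, hk, hkM, s, hs, hks⟩ := exists_rescale_energyCasimir_le hQ hF h0 hlt
      have := hmin k hk hkM
      nlinarith
  have hFmin : IsMinimizer Q M F := by
    refine ⟨mem_admissibleSet_iff.2 ⟨hF, hFM'⟩, fun k hk => ?_⟩
    obtain ⟨hk1, hk2⟩ := mem_admissibleSet_iff.1 hk
    exact hFD.trans (hmin k hk1 hk2)
  have hFf₀ := hf₀.2 F hFmin
  rw [massIn_congr_ae hFf₀] at hlim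
  have := ge_of_tendsto' hlim fun n => hgε (φ n)
  linarith

end VlasovPoisson
end

noncomputable section

namespace VlasovPoisson

variable {Q : ℝ → ℝ → ℝ} {f g f₀ : Phase → ℝ}

/-! ### The Euler-Lagrange equation -/

/-- The first variation `∂_f Q(f₀, L) + E` of the energy-Casimir functional. -/
def firstVariation (Q : ℝ → ℝ → ℝ) (f₀ : Phase → ℝ) (z : Phase) : ℝ :=
  dQ Q (f₀ z) (angMom z) + energy f₀ z

theorem IsSymmDensity.aestronglyMeasurable_energy (hf : IsSymmDensity f) :
    AEStronglyMeasurable (energy f) :=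
  (by fun_prop : Continuous fun z : Phase => ‖z.2‖ ^ 2 / 2).aestronglyMeasurable.add
    (aestronglyMeasurable_potential hf)

theorem IsSymmDensity.aestronglyMeasurable_firstVariation (hQ : Admissible Q)
    (hf : IsSymmDensity f) : AEStronglyMeasurable (firstVariation Q f) :=
  (hQ.regular.aestronglyMeasurable_dQ hf.integrable.1 hf.nonneg).add hf.aestronglyMeasurable_energy

theorem IsSymmDensity.firstVariation_isometry (hf : IsSymmDensity f) {A : Space ≃ₗᵢ[ℝ] Space}
    (hA : IsRotation A) :
    ∀ᵐ z : Phase, firstVariation Q f (A z.1, A z.2) = firstVariation Q f z := by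
  filter_upwards [hf.symm A hA, ae_norm_fst_ne 0] with z h1 h2
  have h2 : z.1 ≠ 0 := norm_ne_zero_iff.1 h2
  have h3 : A z.1 ≠ 0 := by simpa using h2
  simp only [firstVariation, energy, angMom_isometry, h1, A.norm_map]
  rw [potential_eq hf h2, potential_eq hf h3, A.norm_map]

theorem HasFiniteJ.integrable_dQ_mul_self (hQ : Admissible Q) (hf : HasFiniteJ Q f) :
    Integrable fun z => dQ Q (f z) (angMom z) * f z := by
  obtain ⟨k, hk, h⟩ := hQ.exists_dQ_mul_le
  refine ((hf.integrable_Q hQ).const_mul k).mono'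
    ((hQ.regular.aestronglyMeasurable_dQ hf.integrable.1 hf.nonneg).mul hf.integrable.1) ?_
  filter_upwards [hf.nonneg] with z hz
  rw [Real.norm_of_nonneg (mul_nonneg (hQ.dQ_nonneg hz (angMom_nonneg z)) hz)]
  exact h _ _ hz (angMom_nonneg z)

theorem HasFiniteJ.integrable_firstVariation_mul_self (hQ : Admissible Q) (hf : HasFiniteJ Q f) :
    Integrable fun z => firstVariation Q f z * f z := by
  refine ((hf.integrable_dQ_mul_self hQ).add (hf.integrable_energy_mul hQ hf)).congr
    (Eventually.of_forall fun z => ?_)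
  simp only [firstVariation, Pi.add_apply]
  ring

/-- `E₀` is by definition the mean of the first variation with respect to `f`: it is the Lagrange
multiplier of the mass constraint. -/
theorem HasFiniteJ.integral_firstVariation_sub_mul (hQ : Admissible Q) {M : ℝ} (hM : 0 < M)
    (hf : HasFiniteJ Q f) (hfM : ∫ z, f z = M) :
    Integrable (fun z => (firstVariation Q f z - cutoffEnergy Q M f) * f z) ∧
      ∫ z, (firstVariation Q f z - cutoffEnergy Q M f) * f z = 0 := by
  have h1 := hf.integrable_firstVariation_mul_self hQ
  have h2 := hf.integrable.const_mul (cutoffEnergy Q M f)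
  have e : (fun z => (firstVariation Q f z - cutoffEnergy Q M f) * f z) =
      fun z => firstVariation Q f z * f z - cutoffEnergy Q M f * f z := by ext z; ring
  rw [e]
  refine ⟨h1.sub h2, ?_⟩
  rw [integral_sub h1 h2, integral_const_mul, hfM]
  have e2 : cutoffEnergy Q M f = 1 / M * ∫ z, firstVariation Q f z * f z := rfl
  rw [e2]
  field_simp
  ring

/-- `d` is the excess energy plus the field energy of the difference. Varying `d` instead of `𝓓`
yields the first variation without treating the quadratic potential term separately. -/
theorem IsMinimizer.casimirDist_nonneg (hQ : Admissible Q) {M : ℝ} (hf₀ : IsMinimizer Q M f₀)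
    (hg : HasFiniteJ Q g) (hgM : ∫ z, g z = M) : 0 ≤ casimirDist Q M f₀ g := by
  obtain ⟨h1, h2⟩ := mem_admissibleSet_iff.1 hf₀.1
  have h3 : energyCasimir Q f₀ ≤ energyCasimir Q g := hf₀.2 (mem_admissibleSet_iff.2 ⟨hg, hgM⟩)
  have h4 := energyCasimir_sub hQ h1 hg h2 hgM
  have h5 := potEnergy_nonneg (fun r => massIn g r - massIn f₀ r)
  linarith

theorem angMom_le_of_norm_le {z : Phase} {k : ℝ} (hz : ‖z‖ ≤ k) : angMom z ≤ k ^ 4 := by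
  have h1 : ‖z.1‖ ≤ k := (norm_fst_le z).trans hz
  have h2 : ‖z.2‖ ≤ k := (norm_snd_le z).trans hz
  have h3 : ‖z.2‖ ^ 2 * ‖z.1‖ ^ 2 ≤ k ^ 2 * k ^ 2 := by gcongr
  rw [angMom]
  nlinarith [sq_nonneg (inner ℝ z.1 z.2)]

theorem Admissible.exists_bounds (hQ : Admissible Q) (a b : ℝ) :
    ∃ B, 0 ≤ B ∧ ∀ s L, 0 ≤ s → s ≤ a → 0 ≤ L → L ≤ b → Q s L ≤ B ∧ dQ Q s L ≤ B := by
  have hK : IsCompact (Icc (0 : ℝ) a ×ˢ Icc (0 : ℝ) b) := isCompact_Icc.prod isCompact_Icc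
  have hsub : Icc (0 : ℝ) a ×ˢ Icc (0 : ℝ) b ⊆ Ici 0 ×ˢ Ici 0 :=
    prod_mono Icc_subset_Ici_self Icc_subset_Ici_self
  obtain ⟨B1, h1⟩ := hK.exists_bound_of_continuousOn (hQ.regular.cont.mono hsub)
  obtain ⟨B2, h2⟩ := hK.exists_bound_of_continuousOn (hQ.regular.cont_dQ.mono hsub)
  refine ⟨max 0 (max B1 B2), le_max_left _ _, fun s L hs hsa hL hLb => ⟨?_, ?_⟩⟩
  · exact (le_abs_self _).trans ((h1 (s, L) ⟨⟨hs, hsa⟩, ⟨hL, hLb⟩⟩).trans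
      ((le_max_left _ _).trans (le_max_right _ _)))
  · exact (le_abs_self _).trans ((h2 (s, L) ⟨⟨hs, hsa⟩, ⟨hL, hLb⟩⟩).trans
      ((le_max_right _ _).trans (le_max_right _ _)))

theorem hasFiniteJ_indicator (hQ : Admissible Q) {S : Set Phase} (hS : MeasurableSet S)
    (hfin : volume S ≠ ⊤)
    (hsym : ∀ A : Space ≃ₗᵢ[ℝ] Space, IsRotation A → ∀ᵐ z : Phase, (A z.1, A z.2) ∈ S ↔ z ∈ S)
    {k N : ℝ} (hk : ∀ᵐ z, z ∈ S → ‖z‖ ≤ k) (hN : 0 ≤ N) :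
    HasFiniteJ Q (S.indicator fun _ => N) := by
  have hgs : IsSymmDensity (S.indicator fun _ => N) := isSymmDensity_indicator hS hfin hsym hN
  obtain ⟨B, -, hB⟩ := hQ.exists_bounds N (k ^ 4)
  have hIS : ∀ c : ℝ, Integrable (S.indicator fun _ => c) := fun c =>
    (integrable_indicator_iff hS).2 (integrableOn_const hfin)
  refine HasFiniteJ.of_bounds hQ hgs (hIS B) ?_ ?_
  · filter_upwards [hk] with z hz
    by_cases h : z ∈ S
    · rw [indicator_of_mem h, indicator_of_mem h]
      exact (hB _ _ hN le_rfl (angMom_nonneg z) (angMom_le_of_norm_le (hz h))).1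
    · rw [indicator_of_notMem h, indicator_of_notMem h, hQ.zero (angMom_nonneg z)]
  · refine (hIS (k ^ 2 * N)).mono' ((by fun_prop : Continuous fun z : Phase =>
      ‖z.2‖ ^ 2).aestronglyMeasurable.mul hgs.integrable.1) ?_
    filter_upwards [hk] with z hz
    by_cases h : z ∈ S
    · rw [indicator_of_mem h, indicator_of_mem h, Real.norm_of_nonneg (by positivity)]
      have := (norm_snd_le z).trans (hz h)
      gcongr
    · rw [indicator_of_notMem h, indicator_of_notMem h, mul_zero, norm_zero]

/-- The first variation tested with the normalized indicator function of a symmetric set. -/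
theorem IsMinimizer.setIntegral_firstVariation_nonneg (hQ : Admissible Q) {M : ℝ} (hM : 0 < M)
    (hf₀ : IsMinimizer Q M f₀) {S : Set Phase} (hS : MeasurableSet S) (hS0 : volume S ≠ 0)
    (hsym : ∀ A : Space ≃ₗᵢ[ℝ] Space, IsRotation A → ∀ᵐ z : Phase, (A z.1, A z.2) ∈ S ↔ z ∈ S)
    {k : ℝ} (hk : ∀ᵐ z, z ∈ S → ‖z‖ ≤ k ∧ f₀ z ≤ k) :
    IntegrableOn (fun z => firstVariation Q f₀ z - cutoffEnergy Q M f₀) S ∧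
      0 ≤ ∫ z in S, (firstVariation Q f₀ z - cutoffEnergy Q M f₀) := by
  obtain ⟨hf, hfM⟩ := mem_admissibleSet_iff.1 hf₀.1
  set E₀ := cutoffEnergy Q M f₀ with hE₀
  have hfin : volume S ≠ ⊤ := by
    refine ne_top_of_le_ne_top (measure_closedBall_lt_top (μ := (volume : Measure Phase)) (x := 0) (r := k)).ne ?_
    refine measure_mono_ae ?_
    filter_upwards [hk] with z hz hzS
    exact mem_closedBall_zero_iff.2 (hz hzS).1
  have hvol : 0 < volume.real S := ENNReal.toReal_pos hS0 hfin
  -- The height that gives the indicator mass `M`, so that segments from `f₀` to it stay in the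
  -- admissible class.
  set N := M / volume.real S with hN
  have hN0 : 0 < N := by positivity
  set g : Phase → ℝ := S.indicator fun _ => N with hg
  have hgs : IsSymmDensity g := isSymmDensity_indicator hS hfin hsym hN0.le
  set K := max N (max k 0) with hK
  have hK0 : 0 ≤ K := hN0.le.trans (le_max_left _ _)
  obtain ⟨B, hB0, hB⟩ := hQ.exists_bounds K (k ^ 4)
  have hIS : ∀ c : ℝ, Integrable (S.indicator fun _ => c) := fun c =>
    (integrable_indicator_iff hS).2 (integrableOn_const hfin)
  have hgJ : HasFiniteJ Q g := hasFiniteJ_indicator hQ hS hfin hsym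
    (hk.mono fun z hz hzS => (hz hzS).1) hN0.le
  have hgM : ∫ z, g z = M := by
    rw [hg, integral_indicator hS, setIntegral_const, smul_eq_mul, hN]
    field_simp
  have hEint : Integrable fun z => (energy f₀ z - E₀) * (g z - f₀ z) := by
    refine (((hf.integrable_energy_mul hQ hgJ).sub (hf.integrable_energy_mul hQ hf)).sub
      ((hgJ.integrable.sub hf.integrable).const_mul E₀)).congr (Eventually.of_forall fun z => ?_)
    simp only [Pi.sub_apply]; ring
  obtain ⟨kQ, hkQ, hkQle⟩ := hQ.exists_dQ_mul_le
  -- A majorant independent of `t`: on `S` everything is bounded; off `S` the test density vanishes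
  -- and `∂_f Q` is monotone, so `f₀ ∂_f Q(f₀,L) ≤ kQ Q(f₀,L)` applies.
  have hdom : ∀ t : ℝ, 0 ≤ t → t ≤ 1 → ∀ᵐ z,
      ‖dQ Q ((1 - t) * f₀ z + t * g z) (angMom z) * (g z - f₀ z)‖ ≤
        S.indicator (fun _ => B * K) z + kQ * Q (f₀ z) (angMom z) := by
    intro t ht0 ht1
    filter_upwards [hk, hf.nonneg] with z hz hnn
    have hL := angMom_nonneg z
    by_cases h : z ∈ S
    · have hz := hz h
      have e : g z = N := indicator_of_mem h _
      have hfK : f₀ z ≤ K := hz.2.trans ((le_max_left _ _).trans (le_max_right _ _))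
      have hNK : N ≤ K := le_max_left _ _
      have h1 : 0 ≤ (1 - t) * f₀ z + t * N :=
        add_nonneg (mul_nonneg (by linarith) hnn) (mul_nonneg ht0 hN0.le)
      have h2 : (1 - t) * f₀ z + t * N ≤ K := by nlinarith
      rw [e, indicator_of_mem h, norm_mul, Real.norm_of_nonneg (hQ.dQ_nonneg h1 hL)]
      have h3 := (hB _ _ h1 h2 hL (angMom_le_of_norm_le hz.1)).2
      have h4 : ‖N - f₀ z‖ ≤ K := by
        rw [Real.norm_eq_abs, abs_le]
        constructor <;> linarith
      have h5 := mul_le_mul h3 h4 (norm_nonneg _) hB0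
      have h6 := mul_nonneg hkQ.le (hQ.nonneg hnn hL)
      linarith
    · have e : g z = 0 := indicator_of_notMem h _
      have h1 : 0 ≤ (1 - t) * f₀ z := mul_nonneg (by linarith) hnn
      have h2 : (1 - t) * f₀ z ≤ f₀ z := by nlinarith
      rw [e, indicator_of_notMem h, mul_zero, add_zero, zero_sub, zero_add, norm_mul, norm_neg,
        Real.norm_of_nonneg (hQ.dQ_nonneg h1 hL), Real.norm_of_nonneg hnn]
      exact (mul_le_mul_of_nonneg_right (hQ.dQ_mono h1 h2 hL) hnn).trans (hkQle _ _ hnn hL)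
  have hbint : Integrable fun z => S.indicator (fun _ => B * K) z + kQ * Q (f₀ z) (angMom z) :=
    (hIS _).add ((hf.integrable_Q hQ).const_mul _)
  have hmeas : ∀ t : ℝ, 0 ≤ t → t ≤ 1 → AEStronglyMeasurable fun z =>
      dQ Q ((1 - t) * f₀ z + t * g z) (angMom z) * (g z - f₀ z) := by
    intro t ht0 ht1
    have hc := hf.toIsSymmDensity.convexCombo hgs ht0 ht1
    exact (hQ.regular.aestronglyMeasurable_dQ hc.integrable.1 hc.nonneg).mul
      (hgs.integrable.1.sub hf.integrable.1)
  have hpos : ∀ t : ℝ, 0 < t → t ≤ 1 →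
      0 ≤ (∫ z, dQ Q ((1 - t) * f₀ z + t * g z) (angMom z) * (g z - f₀ z)) +
        ∫ z, (energy f₀ z - E₀) * (g z - f₀ z) := by
    intro t ht0 ht1
    have hc := (hf.convexCombo hQ hgJ ht0.le ht1).1
    have hcM : ∫ z, ((1 - t) * f₀ z + t * g z) = M := by
      rw [integral_convexCombo hf.integrable hgJ.integrable, hfM, hgM]; ring
    have h1 := hf₀.casimirDist_nonneg hQ hc hcM
    have hI : Integrable fun z => dQ Q ((1 - t) * f₀ z + t * g z) (angMom z) * (g z - f₀ z) :=
      hbint.mono' (hmeas t ht0.le ht1) (hdom t ht0.le ht1)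
    -- Convexity is used at the moving point: the increment of `Q` is at most `t` times the
    -- derivative there. Dividing by `t` and letting `t → 0` gives the derivative at `f₀`.
    have h2 : casimirDist Q M f₀ (fun z => (1 - t) * f₀ z + t * g z) ≤
        ∫ z, t * (dQ Q ((1 - t) * f₀ z + t * g z) (angMom z) * (g z - f₀ z) +
          (energy f₀ z - E₀) * (g z - f₀ z)) := by
      refine integral_mono_ae (hf.integrable_casimirDist hQ M hc) ((hI.add hEint).const_mul t) ?_
      filter_upwards [hc.nonneg, hf.nonneg] with z h3 h4
      have h5 := hQ.tangent_le h3 h4 (angMom_nonneg z)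
      nlinarith
    rw [integral_const_mul, integral_add hI hEint] at h2
    exact nonneg_of_mul_nonneg_right (h1.trans h2) ht0
  have hlim : Tendsto (fun n : ℕ => ∫ z, dQ Q ((1 - 1 / ((n : ℝ) + 1)) * f₀ z +
      1 / ((n : ℝ) + 1) * g z) (angMom z) * (g z - f₀ z)) atTop
      (𝓝 (∫ z, dQ Q (f₀ z) (angMom z) * (g z - f₀ z))) := by
    have ht : ∀ n : ℕ, 0 ≤ 1 / ((n : ℝ) + 1) ∧ 1 / ((n : ℝ) + 1) ≤ 1 := fun n =>
      ⟨Nat.one_div_pos_of_nat.le, by rw [div_le_one (by positivity)]; linarith [n.cast_nonneg (α := ℝ)]⟩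
    refine tendsto_integral_of_dominated_convergence _ (fun n => hmeas _ (ht n).1 (ht n).2) hbint
      (fun n => hdom _ (ht n).1 (ht n).2) ?_
    filter_upwards [hf.nonneg] with z hz
    refine Tendsto.mul_const _ ?_
    have hcw := hQ.regular.continuousOn_dQ (angMom_nonneg z) (f₀ z) hz
    refine hcw.tendsto.comp (tendsto_nhdsWithin_iff.2 ⟨?_, Eventually.of_forall fun n => ?_⟩)
    · have h0 := tendsto_one_div_add_atTop_nhds_zero_nat (𝕜 := ℝ)
      have h1 := ((h0.const_sub 1).mul_const (f₀ z)).add (h0.mul_const (g z))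
      simpa using h1
    · exact add_nonneg (mul_nonneg (by linarith [(ht n).2]) hz)
        (mul_nonneg (ht n).1 (indicator_nonneg (fun _ _ => hN0.le) z))
  have hfinal : 0 ≤ (∫ z, dQ Q (f₀ z) (angMom z) * (g z - f₀ z)) +
      ∫ z, (energy f₀ z - E₀) * (g z - f₀ z) := by
    refine ge_of_tendsto' (hlim.add_const _) fun n => hpos _ Nat.one_div_pos_of_nat ?_
    rw [div_le_one (by positivity)]; linarith [n.cast_nonneg (α := ℝ)]
  have hI0 : Integrable fun z => dQ Q (f₀ z) (angMom z) * (g z - f₀ z) := by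
    have h1 := hbint.mono' (hmeas 0 le_rfl zero_le_one) (hdom 0 le_rfl zero_le_one)
    simpa using h1
  -- Testing against `f₀` itself contributes zero, so only the integral over `S` remains.
  obtain ⟨hz1, hz2⟩ := hf.integral_firstVariation_sub_mul hQ hM hfM
  have hI1 : Integrable fun z => (firstVariation Q f₀ z - E₀) * g z := by
    refine ((hI0.add hEint).add hz1).congr (Eventually.of_forall fun z => ?_)
    simp only [Pi.add_apply, firstVariation, ← hE₀]
    ring
  have hI01 : Integrable fun z => dQ Q (f₀ z) (angMom z) * (g z - f₀ z) +
      (energy f₀ z - E₀) * (g z - f₀ z) := hI0.add hEint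
  have hI2 : ∫ z, (firstVariation Q f₀ z - E₀) * g z =
      (∫ z, dQ Q (f₀ z) (angMom z) * (g z - f₀ z)) +
      ∫ z, (energy f₀ z - E₀) * (g z - f₀ z) := by
    rw [← add_zero ((∫ z, dQ Q (f₀ z) (angMom z) * (g z - f₀ z)) +
      ∫ z, (energy f₀ z - E₀) * (g z - f₀ z)), ← hz2, ← integral_add hI0 hEint,
      ← integral_add hI01 hz1]
    refine integral_congr_ae (Eventually.of_forall fun z => ?_)
    simp only [firstVariation, ← hE₀]
    ring
  have eg : (fun z => (firstVariation Q f₀ z - E₀) * g z) =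
      S.indicator fun z => N * (firstVariation Q f₀ z - E₀) := by
    ext z
    by_cases h : z ∈ S
    · rw [hg, indicator_of_mem h, indicator_of_mem h, mul_comm]
    · rw [hg, indicator_of_notMem h, indicator_of_notMem h, mul_zero]
  rw [eg] at hI1 hI2
  rw [integral_indicator hS, integral_const_mul] at hI2
  rw [integrable_indicator_iff hS] at hI1
  refine ⟨?_, nonneg_of_mul_nonneg_right (hfinal.trans hI2.ge) hN0⟩
  refine (hI1.const_mul N⁻¹).congr (Eventually.of_forall fun z => ?_)
  field_simp

/-- Moving mass into a set where the first variation lies below its mean `E₀` would lower the energy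
to first order. Both `f₀` and the first variation are invariant under rotations, so the sublevel set
is an admissible symmetric test set. -/
theorem IsMinimizer.cutoffEnergy_le (hQ : Admissible Q) {M : ℝ} (hM : 0 < M)
    (hf₀ : IsMinimizer Q M f₀) : ∀ᵐ z, cutoffEnergy Q M f₀ ≤ firstVariation Q f₀ z := by
  obtain ⟨hf, hfM⟩ := mem_admissibleSet_iff.1 hf₀.1
  set E₀ := cutoffEnergy Q M f₀ with hE₀
  have hGm := hf.toIsSymmDensity.aestronglyMeasurable_firstVariation hQ
  have key : ∀ k : ℕ, ∀ᵐ z, ¬ (firstVariation Q f₀ z < E₀ ∧ ‖z‖ ≤ k ∧ f₀ z ≤ k) := by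
    intro k
    -- The cutoff by `k` makes the test set of finite volume and `f₀` bounded on it; the sets
    -- exhaust the bad set as `k` grows.
    set T : Set Phase := {z | firstVariation Q f₀ z < E₀ ∧ ‖z‖ ≤ k ∧ f₀ z ≤ k} with hT
    have hTm : NullMeasurableSet T :=
      (nullMeasurableSet_lt hGm.aemeasurable aemeasurable_const).inter
        ((nullMeasurableSet_le (f := fun z : Phase => ‖z‖) (by fun_prop) aemeasurable_const).inter
          (nullMeasurableSet_le hf.integrable.1.aemeasurable aemeasurable_const))
    -- `T` is only null measurable, as `f₀` is given almost everywhere; a measurable hull changes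
    -- nothing up to null sets.
    set S := toMeasurable volume T with hS
    have hST : ∀ᵐ z, z ∈ S ↔ z ∈ T := hTm.toMeasurable_ae_eq.mem_iff
    suffices volume S = 0 by
      rw [ae_iff]
      refine measure_mono_null (fun z hz => subset_toMeasurable _ _ ?_) this
      simpa [hT] using hz
    by_contra hS0
    have h1 := hf₀.setIntegral_firstVariation_nonneg hQ hM (measurableSet_toMeasurable _ _) hS0
      (k := k) ?_ ?_
    · obtain ⟨hi, hnn⟩ := h1
      have hneg : ∫ z in S, -(firstVariation Q f₀ z - E₀) ≤ 0 := by
        rw [integral_neg]; exact neg_nonpos.2 hnn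
      have hpos : 0 < ∫ z in S, -(firstVariation Q f₀ z - E₀) := by
        have hlt : ∀ᵐ z ∂volume.restrict S, 0 < -(firstVariation Q f₀ z - E₀) := by
          rw [ae_restrict_iff' (measurableSet_toMeasurable _ _)]
          filter_upwards [hST] with z hz hzS
          have := (hz.1 hzS).1
          linarith
        rw [integral_pos_iff_support_of_nonneg_ae (hlt.mono fun z hz => hz.le) hi.neg]
        rw [pos_iff_ne_zero]
        intro h0
        have h2 : ∀ᵐ z ∂volume.restrict S, False := by
          have h3 : ∀ᵐ z ∂volume.restrict S,
              z ∉ Function.support fun z => -(firstVariation Q f₀ z - E₀) :=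
            measure_eq_zero_iff_ae_notMem.1 h0
          filter_upwards [hlt, h3] with z h4 h5
          exact h5 h4.ne'
        have h3 : volume.restrict S = 0 := by
          rw [← ae_eq_bot]
          exact Filter.eventually_false_iff_eq_bot.1 h2
        exact hS0 (Measure.restrict_eq_zero.1 h3)
      linarith
    · intro A hA
      have hq := (measurePreserving_isometry A).quasiMeasurePreserving.ae hST
      filter_upwards [hST, hq, hf.symm A hA, hf.toIsSymmDensity.firstVariation_isometry (Q := Q) hA]
        with z h1 h2 h3 h4
      rw [h1, h2]
      simp only [hT, mem_ofPred_eq, h3, h4, Prod.norm_def, A.norm_map]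
    · filter_upwards [hST] with z hz hzS
      exact (hz.1 hzS).2
  filter_upwards [ae_all_iff.2 key] with z hz
  by_contra hlt
  rw [not_le] at hlt
  obtain ⟨k, hk⟩ := exists_nat_ge (max ‖z‖ (f₀ z))
  exact hz k ⟨hlt, (le_max_left _ _).trans hk, (le_max_right _ _).trans hk⟩

/-- The Euler-Lagrange equation: `∂_f Q(f₀, L) + E = E₀` where `f₀` does not vanish. -/
theorem IsMinimizer.euler_lagrange (hQ : Admissible Q) {M : ℝ} (hM : 0 < M)
    (hf₀ : IsMinimizer Q M f₀) :
    ∀ᵐ z, (firstVariation Q f₀ z - cutoffEnergy Q M f₀) * f₀ z = 0 := by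
  obtain ⟨hf, hfM⟩ := mem_admissibleSet_iff.1 hf₀.1
  obtain ⟨h1, h2⟩ := hf.integral_firstVariation_sub_mul hQ hM hfM
  have hnn : 0 ≤ᵐ[volume] fun z => (firstVariation Q f₀ z - cutoffEnergy Q M f₀) * f₀ z := by
    filter_upwards [hf₀.cutoffEnergy_le hQ hM, hf.nonneg] with z h3 h4
    exact mul_nonneg (by linarith) h4
  exact (integral_eq_zero_iff_of_nonneg_ae hnn h1).1 h2

/-! ### Lower bounds for the distance -/

theorem isClosed_essSupport (f : Phase → ℝ) : IsClosed (essSupport f) := by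
  rw [← isOpen_compl_iff, isOpen_iff_mem_nhds]
  intro z hz
  simp only [essSupport, mem_compl_iff, mem_ofPred_eq, not_forall, not_not] at hz
  obtain ⟨W, hW, hW0⟩ := hz
  filter_upwards [eventually_mem_nhds_iff.2 hW] with y hy
  simp only [essSupport, mem_compl_iff, mem_ofPred_eq, not_forall, not_not]
  exact ⟨W, hy, hW0⟩

/-- Phase space is second countable, so a locally null set is null. -/
theorem ae_eq_zero_of_notMem_essSupport (f : Phase → ℝ) : ∀ᵐ z, z ∉ essSupport f → f z = 0 := by
  have h : volume ((essSupport f)ᶜ ∩ Function.support f) = 0 := by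
    refine measure_null_of_locally_null _ fun z hz => ?_
    have hz1 := hz.1
    simp only [essSupport, mem_compl_iff, mem_ofPred_eq, not_forall, not_not] at hz1
    obtain ⟨W, hW, hW0⟩ := hz1
    refine ⟨W ∩ ((essSupport f)ᶜ ∩ Function.support f),
      inter_mem (mem_nhdsWithin_of_mem_nhds hW) self_mem_nhdsWithin, measure_mono_null ?_ hW0⟩
    exact fun y hy => ⟨hy.1, hy.2.2⟩
  filter_upwards [measure_eq_zero_iff_ae_notMem.1 h] with z hz hz1
  by_contra hne
  exact hz ⟨hz1, hne⟩

theorem Admissible.convexityConst_le (hQ : Admissible Q) {C s L : ℝ} (hs : 0 < s) (hsC : s ≤ C)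
    (hL : 0 ≤ L) (hLC : L ≤ C) : convexityConst Q C ≤ d2Q Q s L := by
  refine csInf_le ⟨0, ?_⟩ ⟨s, L, hs, hsC, hL, hLC, rfl⟩
  rintro _ ⟨s, L, hs, -, hL, -, rfl⟩
  exact (hQ.d2Q_pos hs hL).le

/-- By the Euler-Lagrange relations the integrand of `d` is the convexity remainder of `Q` plus a
nonnegative term. On the support of `f₀` the remainder is at least `C₁/2 (g - f₀)²`; off the support
the integrand is at least `Q(g,L)`. The factor `2` on the right compensates the `1/2`. -/
theorem IsMinimizer.lintegral_le_casimirDist (hQ : Admissible Q) {M : ℝ} (hM : 0 < M)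
    (hf₀ : IsMinimizer Q M f₀) (hg : HasFiniteJ Q g) {C : ℝ} (hC1 : 0 < convexityConst Q C)
    (hgC : ∀ᵐ z, g z ≤ C) (hfC : ∀ᵐ z, f₀ z ≤ C)
    (hgL : ∀ᵐ z, g z ≠ 0 → angMom z ≤ C) (hfL : ∀ᵐ z, f₀ z ≠ 0 → angMom z ≤ C) :
    (∫⁻ z in (essSupport f₀)ᶜ, ENNReal.ofReal (Q (g z) (angMom z))) +
      ENNReal.ofReal (convexityConst Q C) *
        (∫⁻ z in essSupport f₀, ENNReal.ofReal ((g z - f₀ z) ^ 2)) ≤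
      ENNReal.ofReal (2 * casimirDist Q M f₀ g) := by
  obtain ⟨hf, hfM⟩ := mem_admissibleSet_iff.1 hf₀.1
  set I : Phase → ℝ := fun z => Q (g z) (angMom z) - Q (f₀ z) (angMom z) +
    (energy f₀ z - cutoffEnergy Q M f₀) * (g z - f₀ z) with hI
  have hIint : Integrable I := hf.integrable_casimirDist hQ M hg
  have key : ∀ᵐ z, convexityConst Q C * (g z - f₀ z) ^ 2 ≤ 2 * I z ∧
      (f₀ z = 0 → Q (g z) (angMom z) ≤ I z) := by
    filter_upwards [hf₀.cutoffEnergy_le hQ hM, hf₀.euler_lagrange hQ hM, hf.nonneg, hg.nonneg,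
      hgC, hfC, hgL, hfL] with z h1 h2 h3 h4 h5 h6 h7 h8
    have hL := angMom_nonneg z
    -- This linear part is `(∂_f Q(f₀,L) + E - E₀)(g - f₀)`. The product with `f₀` vanishes and the
    -- product with `g ≥ 0` is nonnegative.
    have hge : dQ Q (f₀ z) (angMom z) * (g z - f₀ z) +
        (energy f₀ z - cutoffEnergy Q M f₀) * (g z - f₀ z) ≥ 0 := by
      have e : dQ Q (f₀ z) (angMom z) * (g z - f₀ z) +
        (energy f₀ z - cutoffEnergy Q M f₀) * (g z - f₀ z) =
        (firstVariation Q f₀ z - cutoffEnergy Q M f₀) * g z -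
          (firstVariation Q f₀ z - cutoffEnergy Q M f₀) * f₀ z := by
        simp only [firstVariation]; ring
      rw [e, h2, sub_zero]
      exact mul_nonneg (by linarith) h4
    constructor
    -- Where both densities vanish there is no bound on `L`, but there is also nothing to prove;
    -- elsewhere one of them supplies `L ≤ C`.
    · by_cases hz : g z = 0 ∧ f₀ z = 0
      · simp [hI, hz.1, hz.2]
      · have hLC : angMom z ≤ C := by
          by_cases hg0 : g z = 0
          · exact h8 fun h => hz ⟨hg0, h⟩
          · exact h7 hg0
        have := hQ.regular.taylor (c := convexityConst Q C) h3 h4 hL fun s hs hsm =>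
          hQ.convexityConst_le hs (hsm.trans (max_le h6 h5)) hL hLC
        simp only [hI]
        linarith
    · intro h0
      simp only [hI]
      rw [h0] at hge ⊢
      rw [hQ.dQ_zero hL, zero_mul, zero_add] at hge
      rw [hQ.zero hL]
      linarith
  have hnn : ∀ᵐ z, 0 ≤ 2 * I z := by
    filter_upwards [key] with z hz
    exact (mul_nonneg hC1.le (sq_nonneg (g z - f₀ z))).trans hz.1
  have hSm : MeasurableSet (essSupport f₀) := (isClosed_essSupport f₀).measurableSet
  have e : ENNReal.ofReal (2 * casimirDist Q M f₀ g) = ∫⁻ z, ENNReal.ofReal (2 * I z) := by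
    rw [← ofReal_integral_eq_lintegral_ofReal (hIint.const_mul 2) hnn, integral_const_mul]
    rfl
  rw [e, ← lintegral_add_compl (fun z => ENNReal.ofReal (2 * I z)) hSm, add_comm]
  refine add_le_add ?_ ?_
  · rw [← lintegral_const_mul' _ _ ENNReal.ofReal_ne_top]
    refine lintegral_mono_ae (ae_restrict_of_ae (key.mono fun z hz => ?_))
    rw [← ENNReal.ofReal_mul hC1.le]
    exact ENNReal.ofReal_le_ofReal hz.1
  · refine lintegral_mono_ae ?_
    rw [ae_restrict_iff' hSm.compl]
    filter_upwards [key, hnn, ae_eq_zero_of_notMem_essSupport f₀] with z h1 h2 h3 h4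
    refine ENNReal.ofReal_le_ofReal ((h1.2 (h3 h4)).trans ?_)
    linarith

end VlasovPoisson
end

noncomputable section

namespace VlasovPoisson

/-! ### The field of a continuously differentiable density with compact support -/

theorem locallyIntegrable_norm_rpow {α : ℝ} (hα : -3 < α) :
    LocallyIntegrable (fun x : Space => ‖x‖ ^ α) := by
  have h3 : Module.finrank ℝ Space = 3 := by simp
  refine locallyIntegrable_of_norm_le_rpow (C := 1) (α := -α) (by omega) (by rw [h3]; push_cast; linarith) ?_ ?_
  · refine Eventually.of_forall fun x => ?_
    rw [Real.norm_of_nonneg (by positivity), neg_neg, one_mul]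
  · exact (by fun_prop : Measurable fun x : Space => ‖x‖ ^ α).aestronglyMeasurable

theorem hasCompactSupport_of_norm {E : Type*} [NormedAddCommGroup E] [ProperSpace E] {h : E → ℝ}
    {R : ℝ} (h0 : ∀ z, R < ‖z‖ → h z = 0) : HasCompactSupport h := by
  refine HasCompactSupport.intro (isCompact_closedBall (0 : E) R) fun z hz => h0 z ?_
  simpa using hz

theorem exists_norm_support {E : Type*} [NormedAddCommGroup E] {h : E → ℝ}
    (hc : HasCompactSupport h) : ∃ R, 0 ≤ R ∧ ∀ z, R < ‖z‖ → h z = 0 := by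
  obtain ⟨R, hR⟩ := hc.isCompact.isBounded.subset_closedBall 0
  refine ⟨max R 0, le_max_right _ _, fun z hz => ?_⟩
  by_contra hne
  have := mem_closedBall_zero_iff.1 (hR (subset_tsupport _ hne))
  linarith [le_max_left R 0]

/-- The velocity integral is the convolution, at `0`, of the constant `1` with `w ↦ h(x,-w)`, where
`x` is a parameter. Smoothness of parametrized convolutions then applies. -/
theorem contDiff_rho {h : Phase → ℝ} (hd : ContDiff ℝ 1 h) (hc : HasCompactSupport h) :
    ContDiff ℝ 1 (rho h) := by
  obtain ⟨R, -, h0⟩ := exists_norm_support hc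
  have key := contDiffOn_convolution_right_with_param_comp (n := 1) (μ := (volume : Measure Space))
    (ContinuousLinearMap.mul ℝ ℝ) (s := (univ : Set Space)) (v := fun _ => (0 : Space))
    contDiffOn_const (f := fun _ : Space => (1 : ℝ)) (g := fun x w => h (x, -w))
    (k := Metric.closedBall 0 R) isOpen_univ (isCompact_closedBall 0 R) ?_
    (locallyIntegrable_const 1) ?_
  · rw [contDiffOn_univ] at key
    convert key using 2 with x
    · simp
    · simp [rho, convolution]
  · intro x w _ hw
    refine h0 _ ?_
    rw [mem_closedBall_zero_iff, not_le] at hw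
    rw [← norm_neg] at hw
    exact hw.trans_le (norm_snd_le (x, -w))
  · exact (hd.comp (contDiff_fst.prodMk contDiff_snd.neg)).contDiffOn

theorem rho_eq_zero {h : Phase → ℝ} {R : ℝ} (h0 : ∀ z : Phase, R < ‖z‖ → h z = 0) {x : Space}
    (hx : R < ‖x‖) : rho h x = 0 := by
  rw [rho]
  have : ∀ v : Space, h (x, v) = 0 := fun v => h0 _ (hx.trans_le (norm_fst_le (x, v)))
  simp [this]

theorem hasCompactSupport_rho {h : Phase → ℝ} (hc : HasCompactSupport h) :
    HasCompactSupport (rho h) := by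
  obtain ⟨R, -, hR⟩ := exists_norm_support hc
  exact hasCompactSupport_of_norm fun x hx => rho_eq_zero hR hx

/-- The derivative of the convolution of `rho h` with `1/|·|` can be put on the compactly supported
`C¹` factor. No symmetry is needed and the origin is included, so the characteristic field is
continuous on the whole space. -/
theorem contDiff_potential {h : Phase → ℝ} (hd : ContDiff ℝ 1 h) (hc : HasCompactSupport h) :
    ContDiff ℝ 1 (potential h) := by
  have key := (hasCompactSupport_rho hc).contDiff_convolution_left (n := 1)
    (μ := (volume : Measure Space)) (ContinuousLinearMap.mul ℝ ℝ) (contDiff_rho hd hc)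
    (locallyIntegrable_norm_rpow (α := -1) (by norm_num))
  convert key.neg using 2 with x
  · simp
  · simp [potential, convolution, Real.rpow_neg_one, div_eq_mul_inv]

theorem integrable_rho_div {h : Phase → ℝ} (hd : ContDiff ℝ 1 h) (hc : HasCompactSupport h)
    (x : Space) : Integrable fun y => rho h y / ‖x - y‖ := by
  have := (hasCompactSupport_rho hc).convolutionExists_left (μ := (volume : Measure Space))
    (ContinuousLinearMap.mul ℝ ℝ) (contDiff_rho hd hc).continuous
    (locallyIntegrable_norm_rpow (α := -1) (by norm_num)) x
  refine this.congr (Eventually.of_forall fun y => ?_)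
  simp [Real.rpow_neg_one, div_eq_mul_inv]

theorem rho_sub {g h : Phase → ℝ} (hg : Continuous g) (hgc : HasCompactSupport g)
    (hh : Continuous h) (hhc : HasCompactSupport h) (x : Space) :
    rho (fun z => g z - h z) x = rho g x - rho h x := by
  have aux : ∀ u : Phase → ℝ, Continuous u → HasCompactSupport u →
      Integrable fun v : Space => u (x, v) := fun u hu huc => by
    obtain ⟨R, -, hR⟩ := exists_norm_support huc
    exact (by fun_prop : Continuous fun v : Space => u (x, v)).integrable_of_hasCompactSupport
      (hasCompactSupport_of_norm fun v hv => hR _ (hv.trans_le (norm_snd_le (x, v))))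
  exact integral_sub (aux g hg hgc) (aux h hh hhc)

theorem potential_sub {g h : Phase → ℝ} (hg : ContDiff ℝ 1 g) (hgc : HasCompactSupport g)
    (hh : ContDiff ℝ 1 h) (hhc : HasCompactSupport h) (x : Space) :
    potential (fun z => g z - h z) x = potential g x - potential h x := by
  simp only [potential, rho_sub hg.continuous hgc hh.continuous hhc, sub_div]
  rw [integral_sub (integrable_rho_div hg hgc x) (integrable_rho_div hh hhc x)]
  ring

theorem field_sub {g h : Phase → ℝ} (hg : ContDiff ℝ 1 g) (hgc : HasCompactSupport g)
    (hh : ContDiff ℝ 1 h) (hhc : HasCompactSupport h) (x : Space) :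
    field (fun z => g z - h z) x = field g x - field h x := by
  have h1 := ((contDiff_potential hg hgc).differentiable one_ne_zero x).hasGradientAt
  have h2 := ((contDiff_potential hh hhc).differentiable one_ne_zero x).hasGradientAt
  have e : potential (fun z => g z - h z) = fun x => potential g x - potential h x :=
    funext (potential_sub hg hgc hh hhc)
  rw [field, e]
  have h3 := (h1.hasFDerivAt.sub h2.hasFDerivAt)
  rw [← map_sub] at h3
  exact (hasGradientAt_iff_hasFDerivAt.2 h3).gradient

theorem continuous_field {h : Phase → ℝ} (hd : ContDiff ℝ 1 h) (hc : HasCompactSupport h) :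
    Continuous (field h) := by
  have := (contDiff_potential hd hc).continuous_fderiv one_ne_zero
  exact (InnerProductSpace.toDual ℝ Space).symm.continuous.comp this

theorem fderiv_potential_apply (h : Phase → ℝ) (x w : Space) : fderiv ℝ (potential h) x w = inner ℝ (field h x) w := by
  simp [field, gradient]

theorem abs_one_div_sub_one_div_le {a b : Space} (ha : a ≠ 0) (hb : b ≠ 0) :
    |1 / ‖a‖ - 1 / ‖b‖| ≤ ‖a - b‖ * (‖a‖ ^ (-2 : ℝ) + ‖b‖ ^ (-2 : ℝ)) := by
  have ha' := norm_pos_iff.2 ha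
  have hb' := norm_pos_iff.2 hb
  have e : 1 / ‖a‖ - 1 / ‖b‖ = (‖b‖ - ‖a‖) * (‖a‖⁻¹ * ‖b‖⁻¹) := by field_simp
  rw [e, abs_mul, Real.rpow_neg ha'.le, Real.rpow_neg hb'.le, Real.rpow_two, Real.rpow_two,
    abs_of_pos (by positivity : 0 < ‖a‖⁻¹ * ‖b‖⁻¹)]
  have h1 : |‖b‖ - ‖a‖| ≤ ‖a - b‖ := by rw [abs_sub_comm]; exact abs_norm_sub_norm_le a b
  have h2 : ‖a‖⁻¹ * ‖b‖⁻¹ ≤ (‖a‖ ^ 2)⁻¹ + (‖b‖ ^ 2)⁻¹ := by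
    rw [← inv_pow, ← inv_pow]
    nlinarith [sq_nonneg (‖a‖⁻¹ - ‖b‖⁻¹), sq_nonneg ‖a‖⁻¹, sq_nonneg ‖b‖⁻¹]
  gcongr

/-- The kernel `|y|^{-2}` is at most an integrable function supported in the unit ball plus `1`.
Translation invariance makes the bound independent of `x`. -/
theorem exists_setIntegral_inv_sq_le (R : ℝ) :
    ∃ C : ℝ, 0 ≤ C ∧ ∀ x : Space,
      IntegrableOn (fun y => ‖x - y‖ ^ (-2 : ℝ)) (Metric.closedBall 0 R) ∧
      ∫ y in Metric.closedBall 0 R, ‖x - y‖ ^ (-2 : ℝ) ≤ C := by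
  have hloc := locallyIntegrable_norm_rpow (α := -2) (by norm_num)
  set k : Space → ℝ := (Metric.closedBall (0 : Space) 1).indicator fun y => ‖y‖ ^ (-2 : ℝ) with hk
  have hkint : Integrable k :=
    (integrable_indicator_iff measurableSet_closedBall).2
      (hloc.integrableOn_isCompact (isCompact_closedBall 0 1))
  have hk0 : ∀ y, 0 ≤ k y := indicator_nonneg fun y _ => by positivity
  have hle : ∀ y : Space, ‖y‖ ^ (-2 : ℝ) ≤ k y + 1 := fun y => by
    by_cases hy : ‖y‖ ≤ 1
    · rw [hk, indicator_of_mem (mem_closedBall_zero_iff.2 hy)]; linarith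
    · have : ‖y‖ ^ (-2 : ℝ) ≤ 1 := Real.rpow_le_one_of_one_le_of_nonpos (by linarith) (by norm_num)
      linarith [hk0 y]
  have hfin : volume (Metric.closedBall (0 : Space) R) ≠ ⊤ := measure_closedBall_lt_top.ne
  refine ⟨(∫ y, k y) + volume.real (Metric.closedBall (0 : Space) R),
    add_nonneg (integral_nonneg hk0) measureReal_nonneg, fun x => ?_⟩
  have hkx : Integrable fun y => k (x - y) := hkint.comp_sub_left x
  have hdom : IntegrableOn (fun y => k (x - y) + 1) (Metric.closedBall 0 R) :=
    hkx.integrableOn.add (integrableOn_const hfin)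
  have hi : IntegrableOn (fun y => ‖x - y‖ ^ (-2 : ℝ)) (Metric.closedBall 0 R) := by
    refine Integrable.mono' hdom
      (by fun_prop : Measurable fun y : Space => ‖x - y‖ ^ (-2 : ℝ)).aestronglyMeasurable
      (Eventually.of_forall fun y => ?_)
    rw [Real.norm_of_nonneg (by positivity)]
    exact hle _
  refine ⟨hi, (integral_mono hi hdom fun y => hle (x - y)).trans ?_⟩
  rw [integral_add hkx.integrableOn (integrableOn_const hfin)]
  refine add_le_add ?_ (by simp)
  rw [← integral_sub_left_eq_self k volume x]
  exact setIntegral_le_integral hkx (Eventually.of_forall fun y => hk0 _)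

theorem abs_rho_le {h : Phase → ℝ} {R N : ℝ} (h0 : ∀ z : Phase, R < ‖z‖ → h z = 0)
    (hN : ∀ z, |h z| ≤ N) (x : Space) :
    |rho h x| ≤ N * volume.real (Metric.closedBall (0 : Space) R) := by
  have e : rho h x = ∫ v in Metric.closedBall (0 : Space) R, h (x, v) := by
    rw [rho, setIntegral_eq_integral_of_forall_compl_eq_zero]
    intro v hv
    refine h0 _ ?_
    rw [mem_closedBall_zero_iff, not_le] at hv
    exact hv.trans_le (norm_snd_le (x, v))
  rw [e, ← Real.norm_eq_abs]
  exact norm_setIntegral_le_of_norm_le_const measure_closedBall_lt_top fun v _ => hN _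

/-- The potential is Lipschitz because `|1/|a| - 1/|b||` is at most `|a - b|(|a|^{-2} + |b|^{-2})`,
and these kernels integrate uniformly over the support. The constant depends only on the support
radius, as the uniqueness argument requires. -/
theorem exists_norm_field_le (R : ℝ) :
    ∃ C : ℝ, 0 ≤ C ∧ ∀ h : Phase → ℝ, ContDiff ℝ 1 h → (∀ z : Phase, R < ‖z‖ → h z = 0) →
      ∀ N, (∀ z, |h z| ≤ N) → ∀ x, ‖field h x‖ ≤ C * N := by
  obtain ⟨C, hC0, hC⟩ := exists_setIntegral_inv_sq_le R
  set V := volume.real (Metric.closedBall (0 : Space) R) with hV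
  have hV0 : 0 ≤ V := measureReal_nonneg
  refine ⟨V * (2 * C), by positivity, fun h hd h0 N hN x => ?_⟩
  have hN0 : 0 ≤ N := (abs_nonneg _).trans (hN 0)
  have hc : HasCompactSupport h := hasCompactSupport_of_norm h0
  rw [field, gradient, LinearIsometryEquiv.norm_map]
  refine norm_fderiv_le_of_lip' ℝ (by positivity) (Eventually.of_forall fun x' => ?_)
  have e : potential h x' - potential h x =
      ∫ y in Metric.closedBall 0 R, rho h y * (1 / ‖x - y‖ - 1 / ‖x' - y‖) := by
    rw [setIntegral_eq_integral_of_forall_compl_eq_zero, potential, potential,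
      neg_sub_neg, ← integral_sub (integrable_rho_div hd hc x) (integrable_rho_div hd hc x')]
    · exact integral_congr_ae (Eventually.of_forall fun y => by simp only; ring)
    · intro y hy
      rw [mem_closedBall_zero_iff, not_le] at hy
      rw [rho_eq_zero h0 hy, zero_mul]
  rw [e]
  have hb : ∀ᵐ y ∂volume.restrict (Metric.closedBall (0 : Space) R),
      ‖rho h y * (1 / ‖x - y‖ - 1 / ‖x' - y‖)‖ ≤
        N * V * (‖x' - x‖ * (‖x - y‖ ^ (-2 : ℝ) + ‖x' - y‖ ^ (-2 : ℝ))) := by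
    have hne : ∀ a : Space, ∀ᵐ y : Space, a - y ≠ 0 := fun a => by
      simp only [ne_eq, sub_eq_zero]
      filter_upwards [compl_mem_ae_iff.2 (measure_singleton (μ := (volume : Measure Space)) a)]
        with y hy hay
      exact hy hay.symm
    refine ae_restrict_of_ae ?_
    filter_upwards [hne x, hne x'] with y h1 h2
    rw [norm_mul, Real.norm_eq_abs, Real.norm_eq_abs]
    have h3 := abs_one_div_sub_one_div_le h1 h2
    rw [sub_sub_sub_cancel_right, norm_sub_rev x x'] at h3
    exact mul_le_mul (abs_rho_le h0 hN y) h3 (abs_nonneg _) (by positivity)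
  refine (norm_integral_le_of_norm_le ?_ hb).trans ?_
  · exact (((hC x).1.add (hC x').1).const_mul _).const_mul _
  · rw [integral_const_mul, integral_const_mul, integral_add (hC x).1 (hC x').1]
    have h1 := (hC x).2
    have h2 := (hC x').2
    calc _ ≤ N * V * (‖x' - x‖ * (C + C)) := by gcongr
      _ = _ := by ring

end VlasovPoisson
end

noncomputable section

namespace VlasovPoisson

/-! ### The transport operator -/

theorem integral_fderiv_apply_eq_zero {E : Type*} [NormedAddCommGroup E] [NormedSpace ℝ E]
    [MeasurableSpace E] [BorelSpace E] [FiniteDimensional ℝ E] (μ : Measure E) [μ.IsAddHaarMeasure]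
    {ψ : E → ℝ} (hd : ContDiff ℝ 1 ψ) (hc : HasCompactSupport ψ) (v : E) :
    ∫ x, fderiv ℝ ψ x v ∂μ = 0 := by
  have h1 : Integrable (fun x => fderiv ℝ ψ x v) μ :=
    ((hd.continuous_fderiv one_ne_zero).clm_apply continuous_const).integrable_of_hasCompactSupport
      (hc.fderiv_apply ℝ v)
  have h2 : Integrable ψ μ := hd.continuous.integrable_of_hasCompactSupport hc
  have := integral_mul_fderiv_eq_neg_fderiv_mul_of_integrable (μ := μ) (f := fun _ : E => (1 : ℝ))
    (g := ψ) (v := v) (by simp) (by simpa using h1) (by simpa using h2) (fun x _ => by fun_prop)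
    (fun x _ => hd.differentiable one_ne_zero x)
  simpa using this

theorem hasFDerivAt_slice_fst {ψ : Phase → ℝ} (hd : ContDiff ℝ 1 ψ) (x v : Space) :
    HasFDerivAt (fun y => ψ (y, v)) ((fderiv ℝ ψ (x, v)).comp (ContinuousLinearMap.inl ℝ Space Space))
      x :=
  ((hd.differentiable one_ne_zero (x, v)).hasFDerivAt).comp x (hasFDerivAt_prodMk_left x v)

theorem hasFDerivAt_slice_snd {ψ : Phase → ℝ} (hd : ContDiff ℝ 1 ψ) (x v : Space) :
    HasFDerivAt (fun w => ψ (x, w)) ((fderiv ℝ ψ (x, v)).comp (ContinuousLinearMap.inr ℝ Space Space))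
      v :=
  ((hd.differentiable one_ne_zero (x, v)).hasFDerivAt).comp v (hasFDerivAt_prodMk_right x v)

/-- The transport operator along a force field which depends only on the position has a
divergence-free coefficient. -/
theorem integral_transport_eq_zero {ψ : Phase → ℝ} (hd : ContDiff ℝ 1 ψ) (hc : HasCompactSupport ψ)
    {F : Space → Space} (hF : Continuous F) :
    Integrable (fun z : Phase => fderiv ℝ ψ z (z.2, -F z.1)) ∧
      ∫ z : Phase, fderiv ℝ ψ z (z.2, -F z.1) = 0 := by
  obtain ⟨R, -, hR⟩ := exists_norm_support hc
  have hcd := hd.continuous_fderiv one_ne_zero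
  have hint : ∀ u : Phase → Phase, Continuous u → Integrable fun z => fderiv ℝ ψ z (u z) := by
    intro u hu
    refine (hcd.clm_apply hu).integrable_of_hasCompactSupport ?_
    refine (hc.fderiv ℝ).mono fun z hz => ?_
    contrapose! hz
    simp [Function.notMem_support.1 hz]
  have h1 := hint (fun z => (z.2, 0)) (by fun_prop)
  have h2 := hint (fun z => (0, -F z.1)) (by fun_prop)
  have e : ∀ z : Phase, fderiv ℝ ψ z (z.2, -F z.1) =
      fderiv ℝ ψ z (z.2, 0) + fderiv ℝ ψ z (0, -F z.1) := fun z => by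
    rw [← map_add]; simp
  refine ⟨hint _ (by fun_prop), ?_⟩
  simp_rw [e]
  rw [integral_add h1 h2]
  have z1 : ∫ z : Phase, fderiv ℝ ψ z (z.2, 0) = 0 := by
    rw [Measure.volume_eq_prod] at h1 ⊢
    rw [integral_prod_symm _ h1]
    refine integral_eq_zero_of_ae (Eventually.of_forall fun v => ?_)
    have := integral_fderiv_apply_eq_zero (volume : Measure Space) (ψ := fun x => ψ (x, v))
      (hd.comp (contDiff_id.prodMk contDiff_const))
      (hasCompactSupport_of_norm fun x hx => hR _ (hx.trans_le (norm_fst_le (x, v)))) v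
    rw [Pi.zero_apply, ← this]
    refine integral_congr_ae (Eventually.of_forall fun x => ?_)
    simp only [(hasFDerivAt_slice_fst hd x v).fderiv]
    simp
  have z2 : ∫ z : Phase, fderiv ℝ ψ z (0, -F z.1) = 0 := by
    rw [Measure.volume_eq_prod] at h2 ⊢
    rw [integral_prod _ h2]
    refine integral_eq_zero_of_ae (Eventually.of_forall fun x => ?_)
    have := integral_fderiv_apply_eq_zero (volume : Measure Space) (ψ := fun v => ψ (x, v))
      (hd.comp (contDiff_const.prodMk contDiff_id))
      (hasCompactSupport_of_norm fun v hv => hR _ (hv.trans_le (norm_snd_le (x, v)))) (-F x)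
    rw [Pi.zero_apply, ← this]
    refine integral_congr_ae (Eventually.of_forall fun v => ?_)
    simp only [(hasFDerivAt_slice_snd hd x v).fderiv]
    simp
  rw [z1, z2, add_zero]

/-! ### Families which are differentiable in time -/

/-- A family of functions on phase space on the time interval `[0,∞[` with locally uniformly
bounded supports, which together with its time derivative is continuous. -/
structure SmoothFamily (ψ ψ' : ℝ → Phase → ℝ) : Prop where
  cont : ContinuousOn (fun p : ℝ × Phase => ψ p.1 p.2) (Ici 0 ×ˢ univ)
  cont' : ContinuousOn (fun p : ℝ × Phase => ψ' p.1 p.2) (Ici 0 ×ˢ univ)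
  supp : ∀ T, ∃ R, ∀ t, 0 ≤ t → t ≤ T → ∀ z, R < ‖z‖ → ψ t z = 0 ∧ ψ' t z = 0
  hasDerivAt : ∀ t, 0 < t → ∀ z, HasDerivAt (fun s => ψ s z) (ψ' t z) t

variable {ψ ψ' : ℝ → Phase → ℝ}

theorem SmoothFamily.continuous (h : SmoothFamily ψ ψ') {t : ℝ} (ht : 0 ≤ t) :
    Continuous (ψ t) :=
  h.cont.comp_continuous (by fun_prop : Continuous fun z : Phase => (t, z)) fun _ => ⟨ht, mem_univ _⟩

theorem SmoothFamily.continuous' (h : SmoothFamily ψ ψ') {t : ℝ} (ht : 0 ≤ t) :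
    Continuous (ψ' t) :=
  h.cont'.comp_continuous (by fun_prop : Continuous fun z : Phase => (t, z)) fun _ => ⟨ht, mem_univ _⟩

theorem SmoothFamily.hasCompactSupport (h : SmoothFamily ψ ψ') {t : ℝ} (ht : 0 ≤ t) :
    HasCompactSupport (ψ t) := by
  obtain ⟨R, hR⟩ := h.supp t
  exact hasCompactSupport_of_norm fun z hz => (hR t ht le_rfl z hz).1

theorem SmoothFamily.integrable (h : SmoothFamily ψ ψ') {t : ℝ} (ht : 0 ≤ t) :
    Integrable (ψ t) :=
  (h.continuous ht).integrable_of_hasCompactSupport (h.hasCompactSupport ht)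

theorem SmoothFamily.exists_bound (h : SmoothFamily ψ ψ') (T : ℝ) :
    ∃ R K, 0 ≤ R ∧ 0 ≤ K ∧ ∀ t, 0 ≤ t → t ≤ T → ∀ z,
      |ψ t z| ≤ (Metric.closedBall 0 R).indicator (fun _ => K) z ∧
      |ψ' t z| ≤ (Metric.closedBall 0 R).indicator (fun _ => K) z := by
  obtain ⟨R, hR⟩ := h.supp T
  have hK : IsCompact (Icc (0 : ℝ) T ×ˢ Metric.closedBall (0 : Phase) (max R 0)) :=
    isCompact_Icc.prod (isCompact_closedBall _ _)
  have hsub : Icc (0 : ℝ) T ×ˢ Metric.closedBall (0 : Phase) (max R 0) ⊆ Ici 0 ×ˢ univ :=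
    prod_mono Icc_subset_Ici_self (subset_univ _)
  obtain ⟨K1, h1⟩ := hK.exists_bound_of_continuousOn (h.cont.mono hsub)
  obtain ⟨K2, h2⟩ := hK.exists_bound_of_continuousOn (h.cont'.mono hsub)
  refine ⟨max R 0, max 0 (max K1 K2), le_max_right _ _, le_max_left _ _, fun t ht htT z => ?_⟩
  by_cases hz : z ∈ Metric.closedBall (0 : Phase) (max R 0)
  · rw [indicator_of_mem hz]
    exact ⟨(h1 (t, z) ⟨⟨ht, htT⟩, hz⟩).trans ((le_max_left _ _).trans (le_max_right _ _)),
      (h2 (t, z) ⟨⟨ht, htT⟩, hz⟩).trans ((le_max_right _ _).trans (le_max_right _ _))⟩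
  · rw [indicator_of_notMem hz]
    rw [mem_closedBall_zero_iff, not_le] at hz
    obtain ⟨h3, h4⟩ := hR t ht htT z ((le_max_left _ _).trans_lt hz)
    simp [h3, h4]

theorem SmoothFamily.continuousOn_integral (h : SmoothFamily ψ ψ') :
    ContinuousOn (fun t => ∫ z, ψ t z) (Ici 0) := by
  intro t ht
  obtain ⟨R, hR⟩ := h.supp (t + 1)
  have key : ContinuousOn (fun t => ∫ z, ψ t z) (Icc 0 (t + 1)) := by
    refine continuousOn_integral_of_compact_support (isCompact_closedBall (0 : Phase) R)
      (h.cont.mono (prod_mono Icc_subset_Ici_self (subset_univ _))) fun s z hs hz => ?_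
    rw [mem_closedBall_zero_iff, not_le] at hz
    exact (hR s hs.1 hs.2 z hz).1
  refine (key t ⟨ht, by linarith⟩).mono_of_mem_nhdsWithin ?_
  rw [← Ici_inter_Iic]
  exact inter_mem self_mem_nhdsWithin (mem_nhdsWithin_of_mem_nhds (Iic_mem_nhds (by linarith)))

theorem SmoothFamily.hasDerivAt_integral (h : SmoothFamily ψ ψ') {t : ℝ} (ht : 0 < t) :
    HasDerivAt (fun s => ∫ z, ψ s z) (∫ z, ψ' t z) t := by
  obtain ⟨R, K, -, -, hb⟩ := h.exists_bound (t + 1)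
  have hs : Ioo 0 (t + 1) ∈ 𝓝 t := Ioo_mem_nhds ht (by linarith)
  refine (hasDerivAt_integral_of_dominated_loc_of_deriv_le hs ?_ (h.integrable ht.le)
    (h.continuous' ht.le).aestronglyMeasurable (bound := (Metric.closedBall 0 R).indicator fun _ => K)
    ?_ ?_ ?_).2
  · filter_upwards [hs] with s hs
    exact (h.continuous hs.1.le).aestronglyMeasurable
  · exact Eventually.of_forall fun z s hs => (hb s hs.1.le hs.2.le z).2
  · exact (integrable_indicator_iff measurableSet_closedBall).2
      (integrableOn_const measure_closedBall_lt_top.ne)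
  · exact Eventually.of_forall fun z s hs => h.hasDerivAt s hs.1 z

theorem eq_of_hasDerivAt_zero {e : ℝ → ℝ} (hc : ContinuousOn e (Ici 0))
    (hd : ∀ t, 0 < t → HasDerivAt e 0 t) {t : ℝ} (ht : 0 ≤ t) : e t = e 0 := by
  rcases ht.eq_or_lt with rfl | ht
  · rfl
  obtain ⟨c, -, hc⟩ := exists_hasDerivAt_eq_slope e (fun _ => 0) ht
    (hc.mono Icc_subset_Ici_self) fun s hs => hd s hs.1
  rw [eq_comm, div_eq_zero_iff] at hc
  rcases hc with hc | hc <;> linarith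

theorem SmoothFamily.integral_eq (h : SmoothFamily ψ ψ') (h0 : ∀ t, 0 < t → ∫ z, ψ' t z = 0)
    {t : ℝ} (ht : 0 ≤ t) : ∫ z, ψ t z = ∫ z, ψ 0 z := by
  refine eq_of_hasDerivAt_zero (e := fun t => ∫ z, ψ t z) h.continuousOn_integral
    (fun s hs => ?_) ht
  rw [← h0 s hs]
  exact h.hasDerivAt_integral hs

theorem SmoothFamily.mul (h : SmoothFamily ψ ψ') {k : Phase → ℝ} (hk : Continuous k) :
    SmoothFamily (fun t z => k z * ψ t z) (fun t z => k z * ψ' t z) where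
  cont := (hk.comp continuous_snd).continuousOn.mul h.cont
  cont' := (hk.comp continuous_snd).continuousOn.mul h.cont'
  supp T := by
    obtain ⟨R, hR⟩ := h.supp T
    exact ⟨R, fun t ht htT z hz => by simp [hR t ht htT z hz]⟩
  hasDerivAt t ht z := (h.hasDerivAt t ht z).const_mul _

/-! ### Regularity of solutions -/

variable {f : ℝ → Phase → ℝ}

/-- The time derivative of a function on `[0,∞[` with values in functions on phase space. -/
def timeDeriv (f : ℝ → Phase → ℝ) (t : ℝ) (z : Phase) : ℝ :=
  derivWithin (fun s => f s z) (Ici 0) t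

theorem IsSolution.hasFDerivWithinAt (hf : IsSolution f) {t : ℝ} (ht : 0 ≤ t) (z : Phase) :
    HasFDerivWithinAt (fun p : ℝ × Phase => f p.1 p.2)
      (fderivWithin ℝ (fun p : ℝ × Phase => f p.1 p.2) (Ici 0 ×ˢ univ) (t, z))
      (Ici 0 ×ˢ univ) (t, z) :=
  ((hf.contDiff.differentiableOn one_ne_zero) (t, z) ⟨ht, mem_univ _⟩).hasFDerivWithinAt

theorem IsSolution.continuousOn_fderivWithin (hf : IsSolution f) :
    ContinuousOn (fderivWithin ℝ (fun p : ℝ × Phase => f p.1 p.2) (Ici 0 ×ˢ univ))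
      (Ici 0 ×ˢ univ) :=
  hf.contDiff.continuousOn_fderivWithin ((uniqueDiffOn_Ici 0).prod uniqueDiffOn_univ) le_rfl

theorem IsSolution.contDiff_slice (hf : IsSolution f) {t : ℝ} (ht : 0 ≤ t) :
    ContDiff ℝ 1 (f t) :=
  hf.contDiff.comp_contDiff (contDiff_prodMk_right t) fun _ => ⟨ht, mem_univ _⟩

theorem IsSolution.fderiv_eq (hf : IsSolution f) {t : ℝ} (ht : 0 ≤ t) (z : Phase) :
    fderiv ℝ (f t) z = (fderivWithin ℝ (fun p : ℝ × Phase => f p.1 p.2) (Ici 0 ×ˢ univ)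
      (t, z)).comp (ContinuousLinearMap.inr ℝ ℝ Phase) := by
  have h1 : HasFDerivWithinAt (fun z : Phase => (t, z)) (ContinuousLinearMap.inr ℝ ℝ Phase) univ z :=
    (hasFDerivAt_prodMk_right t z).hasFDerivWithinAt
  have h2 := (hf.hasFDerivWithinAt ht z).comp z h1 fun _ _ => ⟨ht, mem_univ _⟩
  exact (hasFDerivWithinAt_univ.1 h2).fderiv

theorem IsSolution.hasDerivWithinAt (hf : IsSolution f) {t : ℝ} (ht : 0 ≤ t) (z : Phase) :
    HasDerivWithinAt (fun s => f s z) (fderivWithin ℝ (fun p : ℝ × Phase => f p.1 p.2)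
      (Ici 0 ×ˢ univ) (t, z) (1, 0)) (Ici 0) t := by
  have h1 : HasDerivWithinAt (fun s : ℝ => (s, z)) ((1 : ℝ), (0 : Phase)) (Ici 0) t :=
    (hasDerivWithinAt_id t _).prodMk (hasDerivWithinAt_const t _ z)
  exact (hf.hasFDerivWithinAt ht z).comp_hasDerivWithinAt t h1
    fun s (hs : 0 ≤ s) => (⟨hs, mem_univ _⟩ : (s, z) ∈ Ici (0 : ℝ) ×ˢ univ)

theorem IsSolution.timeDeriv_eq (hf : IsSolution f) {t : ℝ} (ht : 0 ≤ t) (z : Phase) :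
    timeDeriv f t z = fderivWithin ℝ (fun p : ℝ × Phase => f p.1 p.2) (Ici 0 ×ˢ univ) (t, z) (1, 0) :=
  (hf.hasDerivWithinAt ht z).derivWithin (uniqueDiffOn_Ici 0 t ht)

theorem IsSolution.continuousOn_fderiv (hf : IsSolution f) :
    ContinuousOn (fun p : ℝ × Phase => fderiv ℝ (f p.1) p.2) (Ici 0 ×ˢ univ) := by
  refine (hf.continuousOn_fderivWithin.clm_comp
    (continuousOn_const (c := ContinuousLinearMap.inr ℝ ℝ Phase))).congr fun p hp => ?_
  exact hf.fderiv_eq hp.1 p.2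

/-- The Vlasov equation as a transport equation on phase space. -/
theorem IsSolution.timeDeriv_eq_transport (hf : IsSolution f) {t : ℝ} (ht : 0 ≤ t) (z : Phase) :
    timeDeriv f t z = -fderiv ℝ (f t) z (z.2, -field (f t) z.1) := by
  have h1 := hf.vlasov t ht z.1 z.2
  have hd := hf.contDiff_slice ht
  rw [(hasFDerivAt_slice_fst hd z.1 z.2).fderiv, (hasFDerivAt_slice_snd hd z.1 z.2).fderiv] at h1
  have e : (z.2, -field (f t) z.1) = (z.2, 0) - ((0 : Space), field (f t) z.1) := by simp
  rw [e, map_sub]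
  simp only [ContinuousLinearMap.comp_apply, ContinuousLinearMap.inl_apply,
    ContinuousLinearMap.inr_apply, Prod.mk.eta] at h1
  simp only [timeDeriv]
  linarith

theorem fderiv_eq_zero_of_norm {g : Phase → ℝ} {R : ℝ}
    (h : ∀ z, R < ‖z‖ → g z = 0) {z : Phase} (hz : R < ‖z‖) : fderiv ℝ g z = 0 := by
  have : g =ᶠ[𝓝 z] fun _ => 0 := by
    filter_upwards [(isOpen_lt continuous_const continuous_norm).mem_nhds hz] with y hy
    exact h y hy
  rw [this.fderiv_eq]
  simp

theorem IsSolution.smoothFamily (hf : IsSolution f) : SmoothFamily f (timeDeriv f) where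
  cont := hf.contDiff.continuousOn
  cont' := (hf.continuousOn_fderivWithin.clm_apply continuousOn_const).congr fun p hp =>
    hf.timeDeriv_eq hp.1 p.2
  supp T := by
    obtain ⟨R, hR⟩ := hf.support_bdd T
    refine ⟨R, fun t ht htT z hz => ⟨hR t ht htT z hz, ?_⟩⟩
    -- Outside the support radius the phase space gradient vanishes, so the Vlasov equation makes
    -- the time derivative vanish as well.
    rw [hf.timeDeriv_eq_transport ht, fderiv_eq_zero_of_norm (hR t ht htT) hz]
    simp
  hasDerivAt t ht z := by
    rw [hf.timeDeriv_eq ht.le]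
    exact (hf.hasDerivWithinAt ht.le z).hasDerivAt (Ici_mem_nhds ht)

theorem IsSolution.hasCompactSupport (hf : IsSolution f) {t : ℝ} (ht : 0 ≤ t) :
    HasCompactSupport (f t) := hf.smoothFamily.hasCompactSupport ht

theorem IsSolution.continuous_field (hf : IsSolution f) {t : ℝ} (ht : 0 ≤ t) :
    Continuous (field (f t)) :=
  VlasovPoisson.continuous_field (hf.contDiff_slice ht) (hf.hasCompactSupport ht)

theorem IsSolution.exists_fderiv_bound (hf : IsSolution f) (T : ℝ) :
    ∃ K, 0 ≤ K ∧ ∀ t, 0 ≤ t → t ≤ T → ∀ z, ‖fderiv ℝ (f t) z‖ ≤ K := by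
  obtain ⟨R, hR⟩ := hf.support_bdd T
  have hK : IsCompact (Icc (0 : ℝ) T ×ˢ Metric.closedBall (0 : Phase) R) :=
    isCompact_Icc.prod (isCompact_closedBall _ _)
  obtain ⟨K, h⟩ := hK.exists_bound_of_continuousOn (hf.continuousOn_fderiv.mono
    (prod_mono Icc_subset_Ici_self (subset_univ _)))
  refine ⟨max K 0, le_max_right _ _, fun t ht htT z => ?_⟩
  by_cases hz : ‖z‖ ≤ R
  · exact (h (t, z) ⟨⟨ht, htT⟩, mem_closedBall_zero_iff.2 hz⟩).trans (le_max_left _ _)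
  · rw [fderiv_eq_zero_of_norm (hR t ht htT) (not_le.1 hz), norm_zero]
    exact le_max_right _ _

end VlasovPoisson
end

noncomputable section

namespace VlasovPoisson

variable {f : ℝ → Phase → ℝ}

/-! ### Spherical symmetry of solutions -/

/-- The action of a linear isometry of space on phase space. -/
def phaseMap (A : Space ≃ₗᵢ[ℝ] Space) : Phase →L[ℝ] Phase :=
  (A.toContinuousLinearEquiv : Space →L[ℝ] Space).prodMap
    (A.toContinuousLinearEquiv : Space →L[ℝ] Space)

theorem phaseMap_apply (A : Space ≃ₗᵢ[ℝ] Space) (z : Phase) : phaseMap A z = (A z.1, A z.2) := rfl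

theorem norm_phaseMap (A : Space ≃ₗᵢ[ℝ] Space) (z : Phase) : ‖phaseMap A z‖ = ‖z‖ := by
  simp [phaseMap_apply, Prod.norm_def]

theorem integral_comp_isometry (A : Space ≃ₗᵢ[ℝ] Space) (k : Space → ℝ) :
    ∫ y, k (A y) = ∫ y, k y :=
  A.measurePreserving.integral_comp A.toHomeomorph.measurableEmbedding k

theorem potential_comp_phaseMap (A : Space ≃ₗᵢ[ℝ] Space) (g : Phase → ℝ) (x : Space) :
    potential (fun z => g (phaseMap A z)) x = potential g (A x) := by
  have h1 : ∀ y, rho (fun z => g (phaseMap A z)) y = rho g (A y) := fun y =>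
    integral_comp_isometry A fun v => g (A y, v)
  simp only [potential, h1]
  rw [← integral_comp_isometry A fun y => rho g y / ‖A x - y‖]
  simp only [← map_sub, A.norm_map]

theorem map_field_comp_phaseMap (A : Space ≃ₗᵢ[ℝ] Space) {g : Phase → ℝ} (hd : ContDiff ℝ 1 g)
    (hc : HasCompactSupport g) (x : Space) :
    A (field (fun z => g (phaseMap A z)) x) = field g (A x) := by
  refine ext_inner_right ℝ fun w => ?_
  obtain ⟨w, rfl⟩ := A.surjective w
  rw [A.inner_map_map, ← fderiv_potential_apply, ← fderiv_potential_apply,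
    funext (potential_comp_phaseMap A g)]
  have h1 : HasFDerivAt (fun x => A x) (A.toContinuousLinearEquiv : Space →L[ℝ] Space) x :=
    (A.toContinuousLinearEquiv : Space →L[ℝ] Space).hasFDerivAt
  have h2 := ((contDiff_potential hd hc).differentiable one_ne_zero (A x)).hasFDerivAt.comp x h1
  have h3 : fderiv ℝ (fun x => potential g (A x)) x =
      (fderiv ℝ (potential g) (A x)).comp (A.toContinuousLinearEquiv : Space →L[ℝ] Space) :=
    h2.fderiv
  rw [h3]
  rfl

/-- Only left difference quotients are used, since a maximum in time may sit at the right end of the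
interval. -/
theorem nonneg_of_hasDerivAt_of_le {e : ℝ → ℝ} {d t : ℝ} (h : HasDerivAt e d t) (ht : 0 < t)
    (hle : ∀ s, 0 ≤ s → s ≤ t → e s ≤ e t) : 0 ≤ d := by
  have h1 := (hasDerivWithinAt_iff_tendsto_slope' (s := Iio t) (lt_irrefl t)).1 h.hasDerivWithinAt
  refine ge_of_tendsto h1 ?_
  filter_upwards [self_mem_nhdsWithin, mem_nhdsWithin_of_mem_nhds (Ioi_mem_nhds ht)] with s hs hs0
  rw [slope_def_field]
  exact div_nonneg_of_nonpos (sub_nonpos.2 (hle s (le_of_lt hs0) (le_of_lt hs)))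
    (sub_nonpos.2 (le_of_lt hs))

theorem contDiff_comp_phaseMap {g : Phase → ℝ} (hd : ContDiff ℝ 1 g) (A : Space ≃ₗᵢ[ℝ] Space) :
    ContDiff ℝ 1 fun z => g (phaseMap A z) := hd.comp (phaseMap A).contDiff

/-- Uniqueness of solutions, for initial data which differ by a rotation. -/
theorem IsSolution.comp_isometry (hf : IsSolution f) {A : Space ≃ₗᵢ[ℝ] Space}
    (h0 : ∀ z, f 0 (phaseMap A z) = f 0 z) {t : ℝ} (ht : 0 ≤ t) (z : Phase) :
    f t (phaseMap A z) = f t z := by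
  by_contra hne
  obtain ⟨R, hR⟩ := hf.support_bdd t
  obtain ⟨C, hC0, hC⟩ := exists_norm_field_le R
  obtain ⟨K, hK0, hK⟩ := hf.exists_fderiv_bound t
  set h : ℝ → Phase → ℝ := fun s z => f s z - f s (phaseMap A z) with hh
  have hsupp : ∀ s, 0 ≤ s → s ≤ t → ∀ z, R < ‖z‖ → h s z = 0 := fun s hs hst z hz => by
    simp only [hh]
    rw [hR s hs hst z hz, hR s hs hst _ (by rwa [norm_phaseMap]), sub_zero]
  -- The growth rate of `h²` at a spatial maximum is at most `2KC`; the extra `1` makes the weighted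
  -- quantity strictly decreasing there.
  set l : ℝ := 2 * (K * C) + 1 with hl
  set e : ℝ × Phase → ℝ := fun p => Real.exp (-l * p.1) * h p.1 p.2 ^ 2 with he
  have hmaps : MapsTo (fun p : ℝ × Phase => (p.1, phaseMap A p.2)) (Ici 0 ×ˢ univ) (Ici 0 ×ˢ univ) :=
    fun p hp => ⟨hp.1, mem_univ _⟩
  have hcont : ContinuousOn (fun p : ℝ × Phase => h p.1 p.2) (Ici 0 ×ˢ univ) :=
    hf.contDiff.continuousOn.sub (hf.contDiff.continuousOn.comp
      (f := fun p : ℝ × Phase => (p.1, phaseMap A p.2)) (by fun_prop) hmaps)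
  have hecont : ContinuousOn e (Icc 0 t ×ˢ Metric.closedBall 0 R) := by
    refine ContinuousOn.mono (s := Ici 0 ×ˢ univ) ?_ (prod_mono Icc_subset_Ici_self (subset_univ _))
    exact (by fun_prop : Continuous fun p : ℝ × Phase => Real.exp (-l * p.1)).continuousOn.mul
      (hcont.pow 2)
  have hzt : h t z ≠ 0 := sub_ne_zero.2 fun h' => hne h'.symm
  have hzR : z ∈ Metric.closedBall (0 : Phase) R := by
    rw [mem_closedBall_zero_iff]
    by_contra hlt
    exact hzt (hsupp t ht le_rfl z (not_le.1 hlt))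
  -- A maximum of the weighted square over time and phase space. It is positive, so it does not
  -- occur at time `0`, where `h` vanishes.
  obtain ⟨⟨s, y⟩, ⟨hs, hy⟩, hmax⟩ := (isCompact_Icc.prod (isCompact_closedBall (0 : Phase) R)
    ).exists_isMaxOn ⟨(t, z), ⟨ht, le_rfl⟩, hzR⟩ hecont
  simp only at hs hy
  have hpos : 0 < e (s, y) := lt_of_lt_of_le (mul_pos (Real.exp_pos _) (by positivity))
    (hmax (⟨⟨ht, le_rfl⟩, hzR⟩ : (t, z) ∈ Icc 0 t ×ˢ Metric.closedBall (0 : Phase) R))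
  have hsy : h s y ≠ 0 := fun h' => by simp [he, h'] at hpos
  have hs0 : 0 < s := by
    refine lt_of_le_of_ne hs.1 fun h' => hsy ?_
    rw [← h']
    simp only [hh, h0 y, sub_self]
  have hsq : ∀ w, h s w ^ 2 ≤ h s y ^ 2 := fun w => by
    by_cases hw : ‖w‖ ≤ R
    · have h1 : e (s, w) ≤ e (s, y) :=
        hmax (⟨hs, mem_closedBall_zero_iff.2 hw⟩ : (s, w) ∈ Icc 0 t ×ˢ Metric.closedBall (0 : Phase) R)
      exact le_of_mul_le_mul_left h1 (Real.exp_pos _)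
    · rw [hsupp s hs.1 hs.2 w (not_le.1 hw)]
      exact (zero_pow two_ne_zero).trans_le (sq_nonneg _)
  have hfd := hf.contDiff_slice hs.1
  have hfc := hf.hasCompactSupport hs.1
  have hgd := contDiff_comp_phaseMap hfd A
  have hgc : HasCompactSupport fun z => f s (phaseMap A z) :=
    hasCompactSupport_of_norm fun w hw => hR s hs.1 hs.2 _ (by rwa [norm_phaseMap])
  have hu : HasFDerivAt (f s) (fderiv ℝ (f s) y) y := (hfd.differentiable one_ne_zero y).hasFDerivAt
  have hw : HasFDerivAt (fun z => f s (phaseMap A z))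
      ((fderiv ℝ (f s) (phaseMap A y)).comp (phaseMap A)) y :=
    ((hfd.differentiable one_ne_zero (phaseMap A y)).hasFDerivAt).comp y (phaseMap A).hasFDerivAt
  -- At the spatial maximum of `h²` the gradients of `f` and of its rotated copy agree. The
  -- transport terms then cancel except for the difference of the fields, which is bounded by `C`
  -- times the maximum of `|h|`.
  have hgrad : fderiv ℝ (f s) y = (fderiv ℝ (f s) (phaseMap A y)).comp (phaseMap A) := by
    have h1 : IsLocalMax (fun w => h s w ^ 2) y := Eventually.of_forall hsq
    have h2 := h1.hasFDerivAt_eq_zero ((hu.sub hw).pow 2)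
    have h3 : (2 * h s y) • (fderiv ℝ (f s) y -
        (fderiv ℝ (f s) (phaseMap A y)).comp (phaseMap A)) = 0 := by simpa [hh] using h2
    rcases smul_eq_zero.1 h3 with h4 | h4
    · exact absurd h4 (mul_ne_zero two_ne_zero hsy)
    · exact sub_eq_zero.1 h4
  have hfield := map_field_comp_phaseMap A hfd hfc y.1
  have hsub := field_sub hfd hfc hgd hgc y.1
  have htime : timeDeriv f s y - timeDeriv f s (phaseMap A y) =
      fderiv ℝ (f s) y (0, field (h s) y.1) := by
    have e1 : ((A y.2, -field (f s) (A y.1)) : Phase) =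
        phaseMap A (y.2, -field (fun z => f s (phaseMap A z)) y.1) := by
      rw [phaseMap_apply, map_neg, hfield]
    have e2 : timeDeriv f s (phaseMap A y) = -fderiv ℝ (f s) y
        (y.2, -field (fun z => f s (phaseMap A z)) y.1) := by
      rw [hf.timeDeriv_eq_transport hs.1, hgrad]
      congr 1
      exact congrArg (fderiv ℝ (f s) (phaseMap A y)) e1
    have e3 : field (h s) y.1 = field (f s) y.1 - field (fun z => f s (phaseMap A z)) y.1 := hsub
    rw [e2, hf.timeDeriv_eq_transport hs.1, e3, sub_neg_eq_add, neg_add_eq_sub, ← map_sub]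
    congr 1
    simp
    abel
  have hder : HasDerivAt (fun r => e (r, y)) (Real.exp (-l * s) * (-l) * h s y ^ 2 +
      Real.exp (-l * s) * (2 * h s y * (timeDeriv f s y - timeDeriv f s (phaseMap A y)))) s := by
    have h1 : HasDerivAt (fun r => h r y) (timeDeriv f s y - timeDeriv f s (phaseMap A y)) s :=
      (hf.smoothFamily.hasDerivAt s hs0 y).sub (hf.smoothFamily.hasDerivAt s hs0 (phaseMap A y))
    have h2 : HasDerivAt (fun r => Real.exp (-l * r)) (Real.exp (-l * s) * (-l)) s := by
      simpa using ((hasDerivAt_id s).const_mul (-l)).exp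
    refine (h2.mul (h1.pow 2)).congr_deriv ?_
    simp
  have hge := nonneg_of_hasDerivAt_of_le hder hs0 fun r hr hrs =>
    hmax (⟨⟨hr, hrs.trans hs.2⟩, hy⟩ : (r, y) ∈ Icc 0 t ×ˢ Metric.closedBall (0 : Phase) R)
  have hbound : |timeDeriv f s y - timeDeriv f s (phaseMap A y)| ≤ K * (C * |h s y|) := by
    rw [htime]
    refine ((fderiv ℝ (f s) y).le_opNorm _).trans ?_
    have h1 : ‖((0 : Space), field (h s) y.1)‖ = ‖field (h s) y.1‖ := by simp [Prod.norm_def]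
    rw [h1]
    have h2 := hC (h s) (hfd.sub hgd) (hsupp s hs.1 hs.2) |h s y| (fun w => sq_le_sq.1 (hsq w)) y.1
    exact mul_le_mul (hK s hs.1 hs.2 y) h2 (norm_nonneg _) hK0
  have h5 : h s y * (timeDeriv f s y - timeDeriv f s (phaseMap A y)) ≤ K * C * h s y ^ 2 := by
    calc _ ≤ |h s y| * |timeDeriv f s y - timeDeriv f s (phaseMap A y)| := by
          rw [← abs_mul]; exact le_abs_self _
      _ ≤ |h s y| * (K * (C * |h s y|)) := by gcongr
      _ = K * C * |h s y| ^ 2 := by ring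
      _ = _ := by rw [sq_abs]
  have h6 : 0 < h s y ^ 2 := by positivity
  have h7 : 0 ≤ -l * h s y ^ 2 +
      2 * (h s y * (timeDeriv f s y - timeDeriv f s (phaseMap A y))) := by
    refine nonneg_of_mul_nonneg_right (a := Real.exp (-l * s)) ?_ (Real.exp_pos _)
    linarith
  nlinarith

theorem IsSolution.comp_rotation (hf : IsSolution f) (hs : SphericallySymmetric (f 0))
    {A : Space ≃ₗᵢ[ℝ] Space} (hA : IsRotation A) {t : ℝ} (ht : 0 ≤ t) (z : Phase) :
    f t (phaseMap A z) = f t z := by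
  refine hf.comp_isometry (fun z => ?_) ht z
  have hc := (hf.contDiff_slice le_rfl).continuous
  -- The symmetry of the data holds almost everywhere, hence everywhere by continuity.
  exact congrFun ((Continuous.ae_eq_iff_eq volume (hc.comp (phaseMap A).continuous) hc).1 (hs A hA)) z

theorem IsSolution.sphericallySymmetric (hf : IsSolution f) (hs : SphericallySymmetric (f 0))
    {t : ℝ} (ht : 0 ≤ t) : SphericallySymmetric (f t) := fun _ hA =>
  Eventually.of_forall fun z => hf.comp_rotation hs hA ht z

/-! ### Conservation of angular momentum -/

theorem potential_eq_of_norm_eq {g : Phase → ℝ}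
    (hs : ∀ A : Space ≃ₗᵢ[ℝ] Space, IsRotation A → ∀ z, g (phaseMap A z) = g z) {x y : Space}
    (h : ‖x‖ = ‖y‖) : potential g x = potential g y := by
  obtain ⟨A, hA, rfl⟩ := exists_isRotation_apply_eq h
  rw [← potential_comp_phaseMap A g x, funext (hs A hA)]

/-- The potential is constant on the sphere through `x`, hence along a great circle leaving `x` in
the direction `w`; differentiating there shows that the field has no tangential component. -/
theorem inner_field_eq_zero {g : Phase → ℝ} (hd : ContDiff ℝ 1 g) (hc : HasCompactSupport g)
    (hs : ∀ A : Space ≃ₗᵢ[ℝ] Space, IsRotation A → ∀ z, g (phaseMap A z) = g z) {x w : Space}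
    (hx : x ≠ 0) (hw : inner ℝ x w = 0) : inner ℝ (field g x) w = 0 := by
  rcases eq_or_ne w 0 with rfl | hw0
  · simp
  have hx' : ‖x‖ ≠ 0 := norm_ne_zero_iff.2 hx
  have hw' : ‖w‖ ≠ 0 := norm_ne_zero_iff.2 hw0
  -- Rescales `w` to the length of `x`, so that the curve below stays on the sphere.
  set k : ℝ := ‖x‖ / ‖w‖ with hk
  set c : ℝ → Space := fun s => Real.cos s • x + Real.sin s • (k • w) with hcdef
  have hnorm : ∀ s, ‖c s‖ = ‖x‖ := fun s => by
    refine (sq_eq_sq₀ (norm_nonneg _) (norm_nonneg _)).1 ?_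
    rw [hcdef]
    simp only
    rw [norm_add_sq_real, inner_smul_left, inner_smul_right, inner_smul_right, hw, norm_smul,
      norm_smul, norm_smul, mul_pow, mul_pow, mul_pow, Real.norm_eq_abs, Real.norm_eq_abs,
      Real.norm_eq_abs, sq_abs, sq_abs, sq_abs, hk, div_pow]
    field_simp
    simp only [mul_zero, add_zero]
    linear_combination ‖x‖ * ‖w‖ * Real.sin_sq_add_cos_sq s
  have hder : HasDerivAt c (k • w) 0 := by
    have h1 := ((Real.hasDerivAt_cos 0).smul_const x).add
      ((Real.hasDerivAt_sin 0).smul_const (k • w))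
    refine h1.congr_deriv ?_
    simp
  have hc0 : c 0 = x := by simp [hcdef]
  have h1 : HasDerivAt (fun s => potential g (c s)) (fderiv ℝ (potential g) (c 0) (k • w)) 0 :=
    (((contDiff_potential hd hc).differentiable one_ne_zero (c 0)).hasFDerivAt).comp_hasDerivAt 0 hder
  have h2 : (fun s => potential g (c s)) = fun _ => potential g x :=
    funext fun s => potential_eq_of_norm_eq hs (hnorm s)
  rw [h2] at h1
  have h3 := h1.unique (hasDerivAt_const 0 _)
  rw [hc0, fderiv_potential_apply, inner_smul_right] at h3
  exact (mul_eq_zero.1 h3).resolve_left (div_ne_zero hx' hw')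

theorem hasFDerivAt_angMom_apply (x v b : Space) :
    fderiv ℝ angMom (x, v) (v, b) = 2 * inner ℝ (‖x‖ ^ 2 • v - inner ℝ x v • x) b := by
  have h1 : HasFDerivAt (fun z : Phase => z.1) (ContinuousLinearMap.fst ℝ Space Space) (x, v) :=
    hasFDerivAt_fst
  have h2 : HasFDerivAt (fun z : Phase => z.2) (ContinuousLinearMap.snd ℝ Space Space) (x, v) :=
    hasFDerivAt_snd
  have h3 := (h2.norm_sq.mul h1.norm_sq).sub ((h1.inner ℝ h2).pow 2)
  have h4 : fderiv ℝ angMom (x, v) = _ := h3.fderiv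
  rw [h4]
  simp [inner_sub_left, inner_smul_left]
  ring

/-- Free motion preserves `L`, and the velocity gradient `2(|x|²v - (x·v)x)` is orthogonal to `x`,
hence to the radial force. -/
theorem fderiv_angMom_transport {g : Phase → ℝ} (hd : ContDiff ℝ 1 g) (hc : HasCompactSupport g)
    (hs : ∀ A : Space ≃ₗᵢ[ℝ] Space, IsRotation A → ∀ z, g (phaseMap A z) = g z) (z : Phase) :
    fderiv ℝ angMom z (z.2, -field g z.1) = 0 := by
  obtain ⟨x, v⟩ := z
  rw [hasFDerivAt_angMom_apply]
  rcases eq_or_ne x 0 with rfl | hx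
  · simp
  rw [inner_neg_right, real_inner_comm, inner_field_eq_zero hd hc hs hx]
  · simp
  · rw [inner_sub_right, inner_smul_right, inner_smul_right, real_inner_self_eq_norm_sq]
    ring

/-! ### Conservation laws -/

theorem IsSolution.smoothFamily_comp (hf : IsSolution f) {φ : ℝ × ℝ → ℝ} (hφ : ContDiff ℝ 1 φ)
    (h0 : ∀ b, φ (0, b) = 0) :
    SmoothFamily (fun t z => φ (f t z, angMom z))
      (fun t z => fderiv ℝ φ (f t z, angMom z) (timeDeriv f t z, 0)) where
  cont := hφ.continuous.comp_continuousOn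
    (hf.smoothFamily.cont.prodMk (continuous_angMom.comp continuous_snd).continuousOn)
  cont' := ((hφ.continuous_fderiv one_ne_zero).comp_continuousOn
    (hf.smoothFamily.cont.prodMk (continuous_angMom.comp continuous_snd).continuousOn)).clm_apply
    (hf.smoothFamily.cont'.prodMk continuousOn_const)
  supp T := by
    obtain ⟨R, hR⟩ := hf.smoothFamily.supp T
    refine ⟨R, fun t ht htT z hz => ?_⟩
    obtain ⟨h1, h2⟩ := hR t ht htT z hz
    refine ⟨by rw [h1, h0], ?_⟩
    rw [h2]
    exact map_zero _
  hasDerivAt t ht z :=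
    ((hφ.differentiable one_ne_zero (f t z, angMom z)).hasFDerivAt).comp_hasDerivAt t
      ((hf.smoothFamily.hasDerivAt t ht z).prodMk (hasDerivAt_const t (angMom z)))

/-- Both `f` and `L` are carried by the flow, so `φ(f,L)` satisfies the same transport equation. The
coefficient field is divergence free, so the integral is constant. The condition at `f = 0` keeps
the support compact. -/
theorem IsSolution.integral_comp_eq (hf : IsSolution f) (hs : SphericallySymmetric (f 0))
    {φ : ℝ × ℝ → ℝ} (hφ : ContDiff ℝ 1 φ) (h0 : ∀ b, φ (0, b) = 0) {t : ℝ} (ht : 0 ≤ t) :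
    ∫ z, φ (f t z, angMom z) = ∫ z, φ (f 0 z, angMom z) := by
  refine (hf.smoothFamily_comp hφ h0).integral_eq (fun s hs' => ?_) ht
  have hd := hf.contDiff_slice hs'.le
  have hc := hf.hasCompactSupport hs'.le
  have hψd : ContDiff ℝ 1 fun z => φ (f s z, angMom z) := hφ.comp (hd.prodMk contDiff_angMom)
  have hψc := (hf.smoothFamily_comp hφ h0).hasCompactSupport hs'.le
  rw [← neg_eq_zero, ← integral_neg]
  refine Eq.trans ?_ (integral_transport_eq_zero hψd hψc (hf.continuous_field hs'.le)).2
  refine integral_congr_ae (Eventually.of_forall fun z => ?_)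
  have h1 : HasFDerivAt (fun z => φ (f s z, angMom z)) ((fderiv ℝ φ (f s z, angMom z)).comp
      ((fderiv ℝ (f s) z).prod (fderiv ℝ angMom z))) z :=
    ((hφ.differentiable one_ne_zero _).hasFDerivAt).comp z
      ((hd.differentiable one_ne_zero z).hasFDerivAt.prodMk
        (contDiff_angMom.differentiable one_ne_zero z).hasFDerivAt)
  simp only [h1.fderiv, ContinuousLinearMap.comp_apply, ContinuousLinearMap.prod_apply,
    hf.timeDeriv_eq_transport hs'.le,
    fderiv_angMom_transport hd hc (fun A hA z => hf.comp_rotation hs hA hs'.le z) z]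
  rw [← map_neg]
  congr 1
  simp

end VlasovPoisson
end

/-! ### Conservation of the joint distribution of `f` and `L`. -/

noncomputable section

namespace VlasovPoisson

variable {f : ℝ → Phase → ℝ} {Q : ℝ → ℝ → ℝ}

/-- The joint distribution of `(g, L)` under the measure with density `g²`. -/
def sqDistribution (g : Phase → ℝ) : Measure (ℝ × ℝ) :=
  (volume.withDensity fun z => ENNReal.ofReal (g z ^ 2)).map fun z => (g z, angMom z)

theorem measurable_ofReal_sq {g : Phase → ℝ} (hg : Continuous g) :
    Measurable fun z => ENNReal.ofReal (g z ^ 2) :=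
  (hg.measurable.pow_const 2).ennreal_ofReal

theorem lintegral_sqDistribution {g : Phase → ℝ} (hg : Continuous g) {H : ℝ × ℝ → ENNReal}
    (hH : Measurable H) : ∫⁻ p, H p ∂sqDistribution g =
      ∫⁻ z, ENNReal.ofReal (g z ^ 2) * H (g z, angMom z) := by
  have hm : Measurable fun z : Phase => (g z, angMom z) :=
    hg.measurable.prodMk continuous_angMom.measurable
  rw [sqDistribution, lintegral_map hH hm]
  exact lintegral_withDensity_eq_lintegral_mul _ (measurable_ofReal_sq hg) (hH.comp hm)

theorem integrable_sq {g : Phase → ℝ} (hg : Continuous g) (hc : HasCompactSupport g) :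
    Integrable fun z => g z ^ 2 := by
  obtain ⟨R, -, hR⟩ := exists_norm_support hc
  exact (by fun_prop : Continuous fun z : Phase => g z ^ 2).integrable_of_hasCompactSupport
    (hasCompactSupport_of_norm (R := R) fun z hz => by simp [hR z hz])

theorem isFiniteMeasure_sqDistribution {g : Phase → ℝ} (hg : Continuous g)
    (hc : HasCompactSupport g) : IsFiniteMeasure (sqDistribution g) := by
  have := isFiniteMeasure_withDensity_ofReal (integrable_sq hg hc).2
  rw [sqDistribution]
  infer_instance

theorem charFunDual_sqDistribution {g : Phase → ℝ} (hg : Continuous g) (hc : HasCompactSupport g)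
    (l : StrongDual ℝ (ℝ × ℝ)) : charFunDual (sqDistribution g) l =
      ((∫ z, g z ^ 2 * Real.cos (l (g z, angMom z)) : ℝ) : ℂ) +
      ((∫ z, g z ^ 2 * Real.sin (l (g z, angMom z)) : ℝ) : ℂ) * Complex.I := by
  have hm : Continuous fun z : Phase => (g z, angMom z) := hg.prodMk continuous_angMom
  rw [charFunDual_apply, sqDistribution, integral_map hm.measurable.aemeasurable
    (by fun_prop), integral_withDensity_eq_integral_toReal_smul
    (measurable_ofReal_sq hg) (Eventually.of_forall fun z => ENNReal.ofReal_lt_top)]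
  have hint : ∀ k : ℝ → ℝ, Continuous k → (∀ s, |k s| ≤ 1) →
      Integrable fun z => g z ^ 2 * k (l (g z, angMom z)) := fun k hk hk1 => by
    refine (integrable_sq hg hc).mono'
      ((hg.pow 2).mul (hk.comp (l.continuous.comp hm))).aestronglyMeasurable
      (Eventually.of_forall fun z => ?_)
    rw [norm_mul, Real.norm_of_nonneg (sq_nonneg _)]
    exact mul_le_of_le_one_right (sq_nonneg _) (hk1 _)
  have h1 := hint _ Real.continuous_cos Real.abs_cos_le_one
  have h2 := hint _ Real.continuous_sin Real.abs_sin_le_one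
  rw [← integral_complex_ofReal, ← integral_complex_ofReal, ← integral_mul_const,
    ← integral_add h1.ofReal (h2.ofReal.mul_const _)]
  refine integral_congr_ae (Eventually.of_forall fun z => ?_)
  simp only [ENNReal.toReal_ofReal (sq_nonneg _), Complex.exp_mul_I, Complex.real_smul]
  push_cast
  ring

/-- A finite measure is determined by its characteristic function, whose real and imaginary parts
are integrals of the smooth functions `f² cos(l(f,L))` and `f² sin(l(f,L))`. The weight `f²` makes
the measure finite, although `f = 0` on a set of infinite volume. -/
theorem IsSolution.sqDistribution_eq (hf : IsSolution f) (hs : SphericallySymmetric (f 0)) {t : ℝ}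
    (ht : 0 ≤ t) : sqDistribution (f t) = sqDistribution (f 0) := by
  have h1 := (hf.contDiff_slice ht).continuous
  have h2 := hf.hasCompactSupport ht
  have h3 := (hf.contDiff_slice le_rfl).continuous
  have h4 := hf.hasCompactSupport le_rfl
  have := isFiniteMeasure_sqDistribution h1 h2
  have := isFiniteMeasure_sqDistribution h3 h4
  refine Measure.ext_of_charFunDual (funext fun l => ?_)
  rw [charFunDual_sqDistribution h1 h2, charFunDual_sqDistribution h3 h4]
  have e1 := hf.integral_comp_eq hs (φ := fun p => p.1 ^ 2 * Real.cos (l p)) (by fun_prop)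
    (by simp) ht
  have e2 := hf.integral_comp_eq hs (φ := fun p => p.1 ^ 2 * Real.sin (l p)) (by fun_prop)
    (by simp) ht
  rw [e1, e2]

/-- Conservation of all Casimir functionals. -/
theorem IsSolution.lintegral_comp_eq (hf : IsSolution f) (hs : SphericallySymmetric (f 0))
    {H : ℝ × ℝ → ENNReal} (hH : Measurable H) (h0 : ∀ b, H (0, b) = 0) {t : ℝ} (ht : 0 ≤ t) :
    ∫⁻ z, H (f t z, angMom z) = ∫⁻ z, H (f 0 z, angMom z) := by
  -- Removes the weight `f²` again. At `f = 0` the inverse is infinite, but `H` vanishes there and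
  -- the product is `0`.
  set H' : ℝ × ℝ → ENNReal := fun p => H p * (ENNReal.ofReal (p.1 ^ 2))⁻¹ with hH'
  have hm : Measurable H' := hH.mul (by fun_prop)
  have key : ∀ p : ℝ × ℝ, ENNReal.ofReal (p.1 ^ 2) * H' p = H p := fun p => by
    by_cases hp : p.1 = 0
    · have : p = (0, p.2) := Prod.ext hp rfl
      rw [this]
      simp [hH', h0]
    · rw [hH']
      simp only
      rw [mul_comm, mul_assoc, ENNReal.inv_mul_cancel, mul_one]
      · simpa using hp
      · exact ENNReal.ofReal_ne_top
  have h1 := lintegral_sqDistribution (hf.contDiff_slice ht).continuous hm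
  have h2 := lintegral_sqDistribution (hf.contDiff_slice le_rfl).continuous hm
  rw [hf.sqDistribution_eq hs ht, h2] at h1
  have h3 : ∀ s, ∫⁻ z, ENNReal.ofReal (f s z ^ 2) * H' (f s z, angMom z) =
      ∫⁻ z, H (f s z, angMom z) := fun s => lintegral_congr fun z => key (f s z, angMom z)
  rw [← h3, ← h3, h1]

/-- Applied to half planes and similar sets, this propagates the sign, the upper bound and the bound
on `L`. The set must avoid `f = 0`, so that its indicator is a Casimir density. -/
theorem IsSolution.ae_notMem (hf : IsSolution f) (hs : SphericallySymmetric (f 0)) {S : Set (ℝ × ℝ)}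
    (hS : MeasurableSet S) (h0 : ∀ b, (0, b) ∉ S) (h : ∀ᵐ z, (f 0 z, angMom z) ∉ S) {t : ℝ}
    (ht : 0 ≤ t) : ∀ᵐ z, (f t z, angMom z) ∉ S := by
  have hm : ∀ s, 0 ≤ s → MeasurableSet {z : Phase | (f s z, angMom z) ∈ S} := fun s hs' =>
    ((hf.contDiff_slice hs').continuous.prodMk continuous_angMom).measurable hS
  have e : ∀ s, 0 ≤ s → ∫⁻ z, S.indicator (fun _ => 1) (f s z, angMom z) =
      volume {z : Phase | (f s z, angMom z) ∈ S} := fun s hs' => by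
    rw [← lintegral_indicator_one (hm s hs')]
    rfl
  have h1 := hf.lintegral_comp_eq hs (H := S.indicator fun _ => 1) (measurable_const.indicator hS)
    (fun b => indicator_of_notMem (h0 b) _) ht
  rw [e t ht, e 0 le_rfl] at h1
  have h2 : volume {z : Phase | (f 0 z, angMom z) ∈ S} = 0 := measure_eq_zero_iff_ae_notMem.2 h
  rw [h2] at h1
  exact measure_eq_zero_iff_ae_notMem.1 h1

theorem IsSolution.isSymmDensity (hf : IsSolution f) (h0 : IsSymmDensity (f 0)) {t : ℝ}
    (ht : 0 ≤ t) : IsSymmDensity (f t) where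
  integrable := hf.smoothFamily.integrable ht
  nonneg := by
    have := hf.ae_notMem h0.symm (S := {p | p.1 < 0}) (measurableSet_lt (by fun_prop) (by fun_prop))
      (fun b => lt_irrefl (0 : ℝ)) (h0.nonneg.mono fun z hz => not_lt.2 hz) ht
    exact this.mono fun z hz => not_lt.1 hz
  symm := hf.sphericallySymmetric h0.symm ht

theorem IsSolution.ae_le (hf : IsSolution f) (hs : SphericallySymmetric (f 0)) {C : ℝ} (hC : 0 ≤ C)
    (h : ∀ z, f 0 z ≤ C) {t : ℝ} (ht : 0 ≤ t) : ∀ᵐ z, f t z ≤ C := by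
  have := hf.ae_notMem hs (S := {p | C < p.1}) (measurableSet_lt (by fun_prop) (by fun_prop))
    (fun b => not_lt.2 hC) (Eventually.of_forall fun z => not_lt.2 (h z)) ht
  exact this.mono fun z hz => not_lt.1 hz

theorem IsSolution.ae_angMom_le (hf : IsSolution f) (hs : SphericallySymmetric (f 0)) {C : ℝ}
    (h : ∀ z, f 0 z ≠ 0 → angMom z ≤ C) {t : ℝ} (ht : 0 ≤ t) :
    ∀ᵐ z, f t z ≠ 0 → angMom z ≤ C := by
  have := hf.ae_notMem hs (S := {p | p.1 ≠ 0 ∧ C < p.2})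
    ((measurableSet_eq_fun (f := fun p : ℝ × ℝ => p.1) (by fun_prop) measurable_const).compl.inter
      (measurableSet_lt measurable_const measurable_snd))
    (fun b hb => hb.1 rfl) (Eventually.of_forall fun z hz => not_le.2 hz.2 (h z hz.1)) ht
  exact this.mono fun z hz hne => not_lt.1 fun hlt => hz ⟨hne, hlt⟩

theorem IsSolution.integral_eq (hf : IsSolution f) (hs : SphericallySymmetric (f 0)) {t : ℝ}
    (ht : 0 ≤ t) : ∫ z, f t z = ∫ z, f 0 z :=
  hf.integral_comp_eq hs (φ := fun p => p.1) contDiff_fst (fun _ => rfl) ht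

/-- `Q` is only continuous in `L`, so the version for `C¹` integrands does not apply directly;
equality of the distributions needs nothing more than measurability. -/
theorem IsSolution.lintegral_Q_eq (hf : IsSolution f) (hQ : Admissible Q) (h0 : IsSymmDensity (f 0))
    {t : ℝ} (ht : 0 ≤ t) : ∫⁻ z, ENNReal.ofReal (Q (f t z) (angMom z)) =
      ∫⁻ z, ENNReal.ofReal (Q (f 0 z) (angMom z)) := by
  have h1 := hf.lintegral_comp_eq h0.symm (H := fun p => ENNReal.ofReal (Q (max p.1 0) (max p.2 0)))
    hQ.regular.continuous_ext.measurable.ennreal_ofReal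
    (fun b => by simp only [max_self, hQ.zero (le_max_right b 0), ENNReal.ofReal_zero]) ht
  have h2 : ∀ s, 0 ≤ s → ∫⁻ z, ENNReal.ofReal (Q (max (f s z) 0) (max (angMom z) 0)) =
      ∫⁻ z, ENNReal.ofReal (Q (f s z) (angMom z)) := fun s hs => by
    refine lintegral_congr_ae ?_
    filter_upwards [(hf.isSymmDensity h0 hs).nonneg] with z hz
    rw [max_eq_left hz, max_eq_left (angMom_nonneg z)]
  rw [← h2 t ht, ← h2 0 le_rfl, h1]

theorem integrable_kinetic_of_compact {g : Phase → ℝ} (hg : Continuous g)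
    (hc : HasCompactSupport g) : Integrable fun z : Phase => ‖z.2‖ ^ 2 * g z := by
  obtain ⟨R, -, hR⟩ := exists_norm_support hc
  exact (by fun_prop : Continuous fun z : Phase => ‖z.2‖ ^ 2 * g z).integrable_of_hasCompactSupport
    (hasCompactSupport_of_norm (R := R) fun z hz => by simp [hR z hz])

theorem IsSolution.hasFiniteJ (hf : IsSolution f) (hQ : Admissible Q) (h0 : HasFiniteJ Q (f 0))
    {t : ℝ} (ht : 0 ≤ t) : HasFiniteJ Q (f t) where
  toIsSymmDensity := hf.isSymmDensity h0.toIsSymmDensity ht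
  J_lt_top := by
    have h1 := h0.J_lt_top
    rw [J] at h1 ⊢
    rw [hf.lintegral_Q_eq hQ h0.toIsSymmDensity ht]
    refine ENNReal.add_lt_top.2 ⟨(ENNReal.add_lt_top.1 h1).1, ?_⟩
    exact ENNReal.mul_lt_top ENNReal.ofReal_lt_top
      (integrable_kinetic_of_compact (hf.contDiff_slice ht).continuous
        (hf.hasCompactSupport ht)).lintegral_lt_top

end VlasovPoisson
end

noncomputable section

namespace VlasovPoisson

variable {f : ℝ → Phase → ℝ} {Q : ℝ → ℝ → ℝ}

/-! ### Conservation of energy -/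

/-- With the potential frozen at time `t`, the transport operator annihilates `E`: the terms `v·∇U`
and `-∇U·v` cancel. So `E ∂_t f` is minus the transport derivative of `E f`, which integrates to
zero. -/
theorem IsSolution.integral_energy_mul_timeDeriv (hf : IsSolution f) {t : ℝ} (ht : 0 ≤ t) :
    ∫ z, energy (f t) z * timeDeriv f t z = 0 := by
  have hd := hf.contDiff_slice ht
  have hc := hf.hasCompactSupport ht
  have hU := contDiff_potential hd hc
  have hk : ContDiff ℝ 1 (energy (f t)) :=
    ((contDiff_snd.norm_sq ℝ).div_const 2).add (hU.comp contDiff_fst)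
  obtain ⟨R, -, hR⟩ := exists_norm_support hc
  have hψd : ContDiff ℝ 1 fun z => energy (f t) z * f t z := hk.mul hd
  have hψc : HasCompactSupport fun z => energy (f t) z * f t z :=
    hasCompactSupport_of_norm (R := R) fun z hz => by rw [hR z hz, mul_zero]
  rw [← neg_eq_zero, ← integral_neg]
  refine Eq.trans ?_ (integral_transport_eq_zero hψd hψc (hf.continuous_field ht)).2
  refine integral_congr_ae (Eventually.of_forall fun z => ?_)
  have h1 := (hk.differentiable one_ne_zero z).hasFDerivAt.mul
    (hd.differentiable one_ne_zero z).hasFDerivAt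
  have h2 : fderiv ℝ (energy (f t)) z (z.2, -field (f t) z.1) = 0 := by
    have h3 : HasFDerivAt (fun z : Phase => z.1) (ContinuousLinearMap.fst ℝ Space Space) z :=
      hasFDerivAt_fst
    have h4 : HasFDerivAt (fun z : Phase => z.2) (ContinuousLinearMap.snd ℝ Space Space) z :=
      hasFDerivAt_snd
    have h5 := (h4.norm_sq.mul_const (1 / 2 : ℝ)).add
      (((hU.differentiable one_ne_zero z.1).hasFDerivAt).comp z h3)
    have h6 : HasFDerivAt (energy (f t)) _ z :=
      h5.congr_of_eventuallyEq (Eventually.of_forall fun z => by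
        simp [energy, div_eq_mul_inv])
    rw [h6.fderiv]
    simp [fderiv_potential_apply, real_inner_comm]
  have h7 : fderiv ℝ (fun z => energy (f t) z * f t z) z = _ := h1.fderiv
  simp only [h7, add_apply, smul_apply, h2, smul_eq_mul,
    mul_zero, add_zero, hf.timeDeriv_eq_transport ht]
  ring

theorem massIn_abs_sub_le {g h χ : Phase → ℝ} (hg : Integrable g) (hh : Integrable h)
    (hχ : Integrable χ) {c : ℝ} (hle : ∀ z, |g z - h z| ≤ c * χ z) (r : ℝ) :
    |massIn g r - massIn h r| ≤ c * massIn χ r := by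
  rw [← massIn_sub hg hh, ← massIn_const_mul]
  exact norm_integral_le_of_norm_le (f := fun z => g z - h z) (hχ.const_mul c).integrableOn
    (Eventually.of_forall fun z => hle z)

theorem IsSolution.abs_sub_le (hf : IsSolution f) (T : ℝ) :
    ∃ R K, 0 ≤ K ∧ ∀ s ∈ Icc 0 T, ∀ t ∈ Icc 0 T, ∀ z,
      |f t z - f s z| ≤ K * |t - s| * (Metric.closedBall 0 R).indicator (fun _ => 1) z := by
  obtain ⟨R, K, -, hK, hb⟩ := hf.smoothFamily.exists_bound T
  refine ⟨R, K, hK, fun s hs t ht z => ?_⟩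
  by_cases hz : z ∈ Metric.closedBall (0 : Phase) R
  · rw [indicator_of_mem hz, mul_one]
    refine Convex.norm_image_sub_le_of_norm_hasDerivWithin_le (f := fun s => f s z)
      (f' := fun s => timeDeriv f s z) (s := Icc 0 T) (fun r hr => ?_) (fun r hr => ?_)
      (convex_Icc 0 T) hs ht
    · have := hf.hasDerivWithinAt hr.1 z
      rw [← hf.timeDeriv_eq hr.1] at this
      exact this.mono Icc_subset_Ici_self
    · have := (hb r hr.1 hr.2 z).2
      rwa [indicator_of_mem hz] at this
  · have h1 := (hb s hs.1 hs.2 z).1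
    have h2 := (hb t ht.1 ht.2 z).1
    rw [indicator_of_notMem hz] at h1 h2 ⊢
    rw [abs_nonpos_iff.1 h1, abs_nonpos_iff.1 h2]
    simp

/-- On bounded time intervals `f` is Lipschitz in time with uniformly bounded support, so the mass
functions differ by at most `K|t - s|` times that of the indicator of a ball. The self-interaction
of this indicator is finite, which makes the bound quadratic in `t - s`. -/
theorem IsSolution.potEnergy_sub_le (hf : IsSolution f) (hQ : Admissible Q)
    (h0 : HasFiniteJ Q (f 0)) (T : ℝ) :
    ∃ B, ∀ s ∈ Icc 0 T, ∀ t ∈ Icc 0 T,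
      potEnergy (fun r => massIn (f t) r - massIn (f s) r) ≤ B * (t - s) ^ 2 := by
  obtain ⟨R, K, hK, hb⟩ := hf.abs_sub_le T
  set χ : Phase → ℝ := (Metric.closedBall 0 R).indicator fun _ => 1 with hχ
  have hχJ : HasFiniteJ Q χ := by
    refine hasFiniteJ_indicator hQ measurableSet_closedBall measure_closedBall_lt_top.ne
      (fun A _ => Eventually.of_forall fun z => ?_) (k := R)
      (Eventually.of_forall fun z hz => mem_closedBall_zero_iff.1 hz) zero_le_one
    rw [mem_closedBall_zero_iff, mem_closedBall_zero_iff, ← phaseMap_apply, norm_phaseMap]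
  refine ⟨K ^ 2 * (1 / 2 * ∫ r in Ioi (0 : ℝ), massIn χ r * massIn χ r / r ^ 2),
    fun s hs t ht => ?_⟩
  have hi := HasFiniteJ.integrableOn_massIn_mul hQ hχJ hχJ
  have hi2 := HasFiniteJ.integrableOn_massIn_sub_sq hQ (hf.hasFiniteJ hQ h0 ht.1)
    (hf.hasFiniteJ hQ h0 hs.1)
  have key : ∫ r in Ioi (0 : ℝ), (massIn (f t) r - massIn (f s) r) ^ 2 / r ^ 2 ≤
      ∫ r in Ioi (0 : ℝ), (K * |t - s|) ^ 2 * (massIn χ r * massIn χ r / r ^ 2) := by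
    refine integral_mono hi2 (hi.const_mul _) fun r => ?_
    have h1 := massIn_abs_sub_le (hf.smoothFamily.integrable ht.1) (hf.smoothFamily.integrable hs.1)
      hχJ.integrable (hb s hs t ht) r
    have h2 := sq_le_sq' (by linarith [abs_nonneg (massIn (f t) r - massIn (f s) r)]) h1
    rw [sq_abs] at h2
    simp only
    rw [← mul_div_assoc]
    gcongr
    linarith
  rw [integral_const_mul, mul_pow, sq_abs] at key
  rw [potEnergy]
  linarith

/-- The expansion of the energy holds about any state, not only a minimizer. About `f(s)` the
Casimir terms cancel by conservation of `∬ Q`, leaving the linear energy term and the quadratic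
field term. -/
theorem IsSolution.energyCasimir_sub (hf : IsSolution f) (hQ : Admissible Q)
    (h0 : HasFiniteJ Q (f 0)) {s t : ℝ} (hs : 0 ≤ s) (ht : 0 ≤ t) :
    energyCasimir Q (f t) - energyCasimir Q (f s) =
      (∫ z, energy (f s) z * f t z) - (∫ z, energy (f s) z * f s z) -
        potEnergy (fun r => massIn (f t) r - massIn (f s) r) := by
  have hJs := hf.hasFiniteJ hQ h0 hs
  have hJt := hf.hasFiniteJ hQ h0 ht
  have hms := hf.integral_eq h0.symm hs
  have hmt := hf.integral_eq h0.symm ht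
  rw [VlasovPoisson.energyCasimir_sub hQ hJs hJt hms hmt]
  congr 1
  have hQint : ∀ r, 0 ≤ r → ∫ z, Q (f r z) (angMom z) =
      (∫⁻ z, ENNReal.ofReal (Q (f 0 z) (angMom z))).toReal := fun r hr => by
    have hJ := hf.hasFiniteJ hQ h0 hr
    rw [← hf.lintegral_Q_eq hQ h0.toIsSymmDensity hr]
    refine integral_eq_lintegral_of_nonneg_ae ?_ (hJ.integrable_Q hQ).1
    filter_upwards [hJ.nonneg] with z hz using hQ.nonneg hz (angMom_nonneg z)
  -- The value of this constant is irrelevant: it multiplies the difference of two equal masses.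
  set E₀ := cutoffEnergy Q (∫ z, f 0 z) (f s) with hE₀
  have i1 := hJt.integrable_Q hQ
  have i2 := hJs.integrable_Q hQ
  have i3 := hJs.integrable_energy_mul hQ hJt
  have i4 := hJs.integrable_energy_mul hQ hJs
  have i5 := hJt.integrable.const_mul E₀
  have i6 := hJs.integrable.const_mul E₀
  have e : casimirDist Q (∫ z, f 0 z) (f s) (f t) =
      ∫ z, ((Q (f t z) (angMom z) - Q (f s z) (angMom z)) +
        ((energy (f s) z * f t z - energy (f s) z * f s z) - (E₀ * f t z - E₀ * f s z))) := by
    rw [casimirDist]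
    refine integral_congr_ae (Eventually.of_forall fun z => ?_)
    simp only [← hE₀]
    ring
  have j1 : Integrable fun z => Q (f t z) (angMom z) - Q (f s z) (angMom z) := i1.sub i2
  have j2 : Integrable fun z => energy (f s) z * f t z - energy (f s) z * f s z := i3.sub i4
  have j3 : Integrable fun z => E₀ * f t z - E₀ * f s z := i5.sub i6
  have j4 : Integrable fun z => (energy (f s) z * f t z - energy (f s) z * f s z) -
      (E₀ * f t z - E₀ * f s z) := j2.sub j3
  rw [e, integral_add j1 j4, integral_sub i1 i2, integral_sub j2 j3, integral_sub i3 i4, integral_sub i5 i6,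
    integral_const_mul, integral_const_mul, hms, hmt, hQint t ht, hQint s hs]
  ring

/-- At each `s > 0`, expand about `f(s)`: the linear term has zero derivative because the frozen
energy is conserved, and the remainder is `O((t - s)²)`. The self-consistent potential thus never
has to be differentiated in time. -/
theorem IsSolution.energyCasimir_eq (hf : IsSolution f) (hQ : Admissible Q)
    (h0 : HasFiniteJ Q (f 0)) {t : ℝ} (ht : 0 ≤ t) :
    energyCasimir Q (f t) = energyCasimir Q (f 0) := by
  have hfam : ∀ s, 0 ≤ s → SmoothFamily (fun t z => energy (f s) z * f t z)
      (fun t z => energy (f s) z * timeDeriv f t z) := fun s hs => by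
    have hU := (contDiff_potential (hf.contDiff_slice hs) (hf.hasCompactSupport hs)).continuous
    refine hf.smoothFamily.mul ?_
    exact (by fun_prop : Continuous fun z : Phase => ‖z.2‖ ^ 2 / 2 + potential (f s) z.1)
  have hform : ∀ s, 0 ≤ s → ∀ t, 0 ≤ t → energyCasimir Q (f t) =
      (energyCasimir Q (f s) - ∫ z, energy (f s) z * f s z) + (∫ z, energy (f s) z * f t z) -
        potEnergy (fun r => massIn (f t) r - massIn (f s) r) := fun s hs t ht => by
    have := hf.energyCasimir_sub hQ h0 hs ht
    linarith
  refine eq_of_hasDerivAt_zero (e := fun t => energyCasimir Q (f t)) (fun s hs => ?_)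
    (fun s hs => ?_) ht
  · have hs : 0 ≤ s := hs
    obtain ⟨B, hB⟩ := hf.potEnergy_sub_le hQ h0 (s + 1)
    have hP : Tendsto (fun t => potEnergy (fun r => massIn (f t) r - massIn (f s) r))
        (𝓝[Ici 0] s) (𝓝 0) := by
      have hlim : Tendsto (fun t : ℝ => B * (t - s) ^ 2) (𝓝[Ici 0] s) (𝓝 0) := by
        have : Tendsto (fun t : ℝ => B * (t - s) ^ 2) (𝓝 s) (𝓝 (B * (s - s) ^ 2)) :=
          Continuous.tendsto (by fun_prop) s
        rw [sub_self, zero_pow two_ne_zero, mul_zero] at this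
        exact this.mono_left nhdsWithin_le_nhds
      refine tendsto_of_tendsto_of_tendsto_of_le_of_le' tendsto_const_nhds hlim
        (Eventually.of_forall fun t => potEnergy_nonneg _) ?_
      filter_upwards [self_mem_nhdsWithin,
        mem_nhdsWithin_of_mem_nhds (Iic_mem_nhds (by linarith : s < s + 1))] with t ht1 ht2
      exact hB s ⟨hs, by linarith⟩ t ⟨ht1, ht2⟩
    have hI : Tendsto (fun t => ∫ z, energy (f s) z * f t z) (𝓝[Ici 0] s)
        (𝓝 (∫ z, energy (f s) z * f s z)) := (hfam s hs).continuousOn_integral s hs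
    have h1 := (hI.const_add (energyCasimir Q (f s) - ∫ z, energy (f s) z * f s z)).sub hP
    have h2 : Tendsto (fun t => energyCasimir Q (f t)) (𝓝[Ici 0] s)
        (𝓝 (energyCasimir Q (f s) - (∫ z, energy (f s) z * f s z) +
          (∫ z, energy (f s) z * f s z) - 0)) := by
      refine Tendsto.congr' ?_ h1
      filter_upwards [self_mem_nhdsWithin] with t ht
      exact (hform s hs t ht).symm
    rwa [sub_zero, sub_add_cancel] at h2
  · obtain ⟨B, hB⟩ := hf.potEnergy_sub_le hQ h0 (s + 1)
    have hs' : Icc 0 (s + 1) ∈ 𝓝 s := Icc_mem_nhds hs (by linarith)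
    have hP : HasDerivAt (fun t => potEnergy (fun r => massIn (f t) r - massIn (f s) r)) 0 s := by
      have hO : (fun t => potEnergy (fun r => massIn (f t) r - massIn (f s) r)) =O[𝓝 s]
          fun t => ‖t - s‖ ^ 2 := by
        refine Asymptotics.IsBigO.of_bound B ?_
        filter_upwards [hs'] with t ht
        rw [Real.norm_of_nonneg (potEnergy_nonneg _), Real.norm_of_nonneg (by positivity),
          Real.norm_eq_abs, sq_abs]
        exact hB s ⟨hs.le, by linarith⟩ t ht
      simpa using (hO.hasFDerivAt one_lt_two).hasDerivAt
    have h1 := (((hfam s hs.le).hasDerivAt_integral hs).const_add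
      (energyCasimir Q (f s) - ∫ z, energy (f s) z * f s z)).sub hP
    rw [hf.integral_energy_mul_timeDeriv hs.le, sub_zero] at h1
    refine h1.congr_of_eventuallyEq ?_
    filter_upwards [hs'] with t ht
    exact hform s hs.le t ht.1

end VlasovPoisson
end

noncomputable section

namespace VlasovPoisson

variable {f₀ : Phase → ℝ} {Q : ℝ → ℝ → ℝ}

/-! ### Nonlinear stability -/

theorem ae_le_of_eLpNorm_lt {C : ℝ} (h : eLpNorm f₀ ⊤ volume < ENNReal.ofReal C) :
    ∀ᵐ z, f₀ z ≤ C := by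
  rw [eLpNorm_exponent_top] at h
  have hC : 0 < C := ENNReal.ofReal_pos.1 (bot_le.trans_lt h)
  filter_upwards [enorm_ae_le_eLpNormEssSup f₀ volume] with z hz
  have h1 := hz.trans h.le
  rw [← ofReal_norm, ENNReal.ofReal_le_ofReal_iff hC.le] at h1
  exact (le_abs_self _).trans h1

theorem ae_angMom_le_of_iSup_lt {C : ℝ}
    (h : (⨆ z ∈ essSupport f₀, ENNReal.ofReal (angMom z)) < ENNReal.ofReal C) :
    ∀ᵐ z, f₀ z ≠ 0 → angMom z ≤ C := by
  have hC : 0 < C := ENNReal.ofReal_pos.1 (bot_le.trans_lt h)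
  filter_upwards [ae_eq_zero_of_notMem_essSupport f₀] with z hz hne
  have hmem : z ∈ essSupport f₀ := by
    by_contra hz'
    exact hne (hz hz')
  exact (ENNReal.ofReal_le_ofReal_iff hC.le).1
    ((le_iSup₂ (f := fun z _ => ENNReal.ofReal (angMom z)) z hmem).trans h.le)

end VlasovPoisson
end

/-! ### The stability estimate. -/

theorem mainTheorem4 (Q : ℝ → ℝ → ℝ) (hQ : VlasovPoisson.Admissible Q)
    (M : ℝ) (hM : 0 < M) (f₀ : VlasovPoisson.Phase → ℝ)
    (hf₀ : VlasovPoisson.IsUniqueMinimizer Q M f₀) :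
    ∀ ε : ℝ, 0 < ε → ∃ δ : ℝ, 0 < δ ∧
      ∀ C₀ : ℝ,
        eLpNorm f₀ ⊤ volume
            + (⨆ z ∈ VlasovPoisson.essSupport f₀, ENNReal.ofReal (VlasovPoisson.angMom z))
          < ENNReal.ofReal C₀ →
        0 < VlasovPoisson.convexityConst Q C₀ →
      ∀ f : ℝ → VlasovPoisson.Phase → ℝ, VlasovPoisson.IsSolution f →
        ContDiff ℝ 1 (f 0) → HasCompactSupport (f 0) →
        f 0 ∈ VlasovPoisson.admissibleSet Q M →
        (∀ z, f 0 z ≤ C₀) →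
        (∀ z ∈ tsupport (f 0), VlasovPoisson.angMom z ≤ C₀) →
        VlasovPoisson.casimirDist Q M f₀ (f 0)
            + 1 / (8 * Real.pi) *
              ∫ x, ‖VlasovPoisson.field (f 0) x - VlasovPoisson.field f₀ x‖ ^ 2 < δ →
      ∀ t : ℝ, 0 ≤ t →
        (∫⁻ z in (VlasovPoisson.essSupport f₀)ᶜ,
            ENNReal.ofReal (Q (f t z) (VlasovPoisson.angMom z)))
          + ENNReal.ofReal (VlasovPoisson.convexityConst Q C₀) *
            (∫⁻ z in VlasovPoisson.essSupport f₀, ENNReal.ofReal ((f t z - f₀ z) ^ 2))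
          + ENNReal.ofReal (1 / (8 * Real.pi)) *
            (∫⁻ x, ENNReal.ofReal
              (‖VlasovPoisson.field (f t) x - VlasovPoisson.field f₀ x‖ ^ 2))
          < ENNReal.ofReal ε := by
  intro ε hε
  -- The tolerances add up as `2(ε/4 + ε/6) + ε/6 = ε`. Both are fixed before `C₀` is introduced, so
  -- `δ` does not depend on it.
  obtain ⟨δ, hδ, hδW⟩ := VlasovPoisson.exists_delta_potEnergy_lt hQ hM hf₀ (ε := ε / 6) (by positivity)
  obtain ⟨hJ₀, hM₀⟩ := VlasovPoisson.mem_admissibleSet_iff.1 hf₀.1.1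
  refine ⟨min δ (ε / 4), lt_min hδ (by positivity), ?_⟩
  intro C₀ hC₀ hC₁ f hf _ _ hmem hle hL hd t ht
  obtain ⟨hJ, hfM⟩ := VlasovPoisson.mem_admissibleSet_iff.1 hmem
  rw [VlasovPoisson.integral_norm_field_sub_sq hJ.toIsSymmDensity hJ₀.toIsSymmDensity] at hd
  have hW0 := VlasovPoisson.potEnergy_nonneg fun r => VlasovPoisson.massIn (f 0) r - VlasovPoisson.massIn f₀ r
  have hC₀pos : 0 < C₀ := ENNReal.ofReal_pos.1 (bot_le.trans_lt hC₀)
  have hJt := hf.hasFiniteJ hQ hJ ht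
  have hMt : ∫ z, f t z = M := (hf.integral_eq hJ.symm ht).trans hfM
  have hE := hf.energyCasimir_eq hQ hJ ht
  have hD0 := VlasovPoisson.energyCasimir_sub hQ hJ₀ hJ hM₀ hfM
  have hDt := VlasovPoisson.energyCasimir_sub hQ hJ₀ hJt hM₀ hMt
  have hδ1 := min_le_left δ (ε / 4)
  have hδ2 := min_le_right δ (ε / 4)
  -- By conservation the excess energy at time `t` is that at time `0`, namely `d` minus the field
  -- energy, hence at most their sum.
  have hWt := hδW (f t) hJt hMt (by linarith)
  have hlow := hf₀.1.lintegral_le_casimirDist hQ hM hJt hC₁ (hf.ae_le hJ.symm hC₀pos.le hle ht)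
    (VlasovPoisson.ae_le_of_eLpNorm_lt (le_self_add.trans_lt hC₀))
    (hf.ae_angMom_le hJ.symm (fun z hz => hL z (subset_tsupport _ hz)) ht)
    (VlasovPoisson.ae_angMom_le_of_iSup_lt (le_add_self.trans_lt hC₀))
  have hfield := VlasovPoisson.lintegral_norm_field_sub_sq hJt.toIsSymmDensity hJ₀.toIsSymmDensity
    (VlasovPoisson.HasFiniteJ.integrableOn_massIn_sub_sq hQ hJt hJ₀)
  rw [hfield]
  have hdt := hf₀.1.casimirDist_nonneg hQ hJt hMt
  have hWt0 := VlasovPoisson.potEnergy_nonneg fun r => VlasovPoisson.massIn (f t) r - VlasovPoisson.massIn f₀ r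
  -- Here `d(f(t),f₀)` equals the conserved excess energy, less than `ε/4`, plus the field energy,
  -- less than `ε/6`. It is doubled by the lower bound, and the field energy is added once more.
  refine (add_le_add_left hlow _).trans_lt ?_
  rw [← ENNReal.ofReal_add (by positivity) hWt0]
  exact (ENNReal.ofReal_lt_ofReal_iff hε).2 (by linarith)
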